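/- Let $\mathfrak g$ be a split real form of a complex simple Lie algebra of type $A_3$, $B_2$, $G_2$ or $D_l$ with $l\ge 5$, with Cartan--Killing form $\langle\cdot,\cdot\rangle$, split Cartan subalgebra $\mathfrak a$, and Cartan involution $\theta$ with $\theta|_{\mathfrak a}=-1$. Fix a choice of simple roots, let $\Pi^-$ be the set of negative roots, and put $\mathfrak n^-=\sum_{\alpha\in\Pi^-}\mathfrak g_\alpha$. Let $K$ be the group generated by $\exp(\mathrm{ad}\,X)$ with $\theta X=X$, let $M$ be the centralizer of $\mathfrak a$ in $K$, and let $\mathbb F=K/M$ be the maximal real flag manifold, with $T_{b_0}\mathbb F=\mathfrak n^-$ at the origin $b_0$. Two roots $\alpha,\beta\in\Pi^-$ are $M$-equivalent, $\alpha\sim_M\beta$, if the representations of $M$ on $\mathfrak g_\alpha$ and $\mathfrak g_\beta$ are equivalent; write $V_{[\alpha]}=\sum_{\beta\sim_M\alpha}\mathfrak g_\beta$. Fix a Weyl basis, that is, root vectors $X_\alpha\in\mathfrak g_\alpha$ with $\langle X_\alpha,X_{-\alpha}\rangle=1$ and $[X_\alpha,X_\beta]=m_{\alpha,\beta}X_{\alpha+\beta}$,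 where $m_{-\alpha,-\beta}=-m_{\alpha,\beta}$, and $m_{\alpha,\beta}=0$ if $\alpha+\beta$ is not a root. Let $X^*_\alpha=\langle X_{-\alpha},\cdot\rangle\in(\mathfrak n^-)^*$. Let $\mathbb J$ be an invariant generalized almost complex structure on $\mathbb F$, that is, an endomorphism of $\mathfrak n^-\oplus(\mathfrak n^-)^*$ with $\mathbb J^2=-1$ which is orthogonal for $\langle X+\xi,Y+\eta\rangle=\frac12(\xi(Y)+\eta(X))$ and commutes with $\mathrm{Ad}\oplus\mathrm{Ad}^*$ of $M$. Then: (1) Every $M$-equivalence class in $\Pi^-$ consists of exactly two roots. (2) For each class $[\alpha]=\{\alpha,\beta\}$ with $\alpha\neq\beta$, the restriction of $\mathbb J$ to $V_{[\alpha]}\oplus V_{[\alpha]}^*$ has, in the basis $(X_\alpha,X_\beta,X^*_\alpha,X^*_\beta)$, exactly one of the forms $$\begin{pmatrix} a&0&0&-x\\0&a&x&0\\0&-y&-a&0\\y&0&0&-a\end{pmatrix}\ \text{(noncomplex type)},\qquad \begin{pmatrix} b&-\frac{1+b^2}{c}&0&0\\c&-b&0&0\\0&0&-b&-c\\0&0&\frac{1+b^2}{c}&b\end{pmatrix}\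 \text{(complex type)}$$ with real $a,x,y$ such that $a^2=xy-1$, respectively real $b,c$ with $c\ne0$. In the complex case let $J^c$ be the complex structure on $V_{[\alpha]}$ such that $\mathbb J v=-J^cv$ for $v\in V_{[\alpha]}$; its $(1,0)$-forms (complex one-forms $\Omega$ on $V_{[\alpha]}$ with $\Omega(J^cv)=i\,\Omega(v)$) are the complex multiples of $-cX^*_\alpha+(b+i)X^*_\beta$. (3) For each class choose an ordering $(\alpha,\beta)$ of its two roots. The pure spinor line of $\mathbb J$, that is, the set of all $\varphi\in\bigwedge^\bullet(\mathfrak n^-)^*\otimes\mathbb C$ annihilated by the $+i$-eigenspace $L$ of $\mathbb J$ under the Clifford action $(X+\xi)\cdot\varphi=i_X\varphi+\xi\wedge\varphi$, is invariant under $M$ and is generated by $$\varphi=e^{\sum_{[\alpha]\text{ of noncomplex type}}(B_\alpha+i\omega_\alpha)}\wedge\bigwedge_{[\alpha]\text{ of complex type}}\Omega_\alpha ,$$ where $B_\alpha=-\frac ax X^*_\alpha\wedge X^*_\beta$ and $\omega_\alpha=\frac1x X^*_\alpha\wedge X^*_\beta$, with $a$ and $x$ the entries of the matrix of the class, $\Omega_\alpha$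 is any nonzero $(1,0)$-form of $J^c$ on $V_{[\alpha]}$, and the classes of complex type are taken in any order. Moreover $\varphi\ne0$ is a pure spinor, its null space $L_\varphi$ equals $L$, and $L_\varphi\cap\overline{L_\varphi}=\{0\}$. -/

import Mathlib

open scoped TensorProduct
open Module LieModule

noncomputable section

/-! ### Linear generalized complex geometry on a real vector space `V` -/

namespace GenCplx

variable (V : Type*) [AddCommGroup V] [Module ℝ V]

/-- The generalized tangent space `V ⊕ V*`. -/
abbrev GenTangent : Type _ := V × Dual ℝ V

/-- Complex exterior forms `⋀•V* ⊗ ℂ`, realized as the complex exterior algebra of `V* ⊗ ℂ`. -/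
abbrev Forms : Type _ := ExteriorAlgebra ℂ (ℂ ⊗[ℝ] Dual ℝ V)

variable {V}

/-- The inner product `⟨X + ξ, Y + η⟩ = (ξ(Y) + η(X)) / 2`. -/
def pairing : LinearMap.BilinForm ℝ (GenTangent V) :=
  LinearMap.mk₂ ℝ (fun u v => (u.2 v.1 + v.2 u.1) / 2)
    (by intro u u' v; simp; ring) (by intro c u v; simp; ring)
    (by intro u v v'; simp; ring) (by intro c u v; simp; ring)

/-- A generalized almost complex structure on `V`: an endomorphism of `V ⊕ V*` with square `-1`
that is orthogonal for the natural inner product. -/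
def IsGenAlmostComplex (J : GenTangent V →ₗ[ℝ] GenTangent V) : Prop :=
  (∀ u, J (J u) = -u) ∧ ∀ u v, pairing (J u) (J v) = pairing u v

/-- The `+i`-eigenspace of `J` in `(V ⊕ V*) ⊗ ℂ`. -/
def plusEigenspace (J : GenTangent V →ₗ[ℝ] GenTangent V) :
    Submodule ℂ (ℂ ⊗[ℝ] GenTangent V) :=
  Module.End.eigenspace (J.baseChange ℂ) Complex.I

/-- Complex conjugation on `(V ⊕ V*) ⊗ ℂ`. -/
def conjT : ℂ ⊗[ℝ] GenTangent V →ₗ[ℝ] ℂ ⊗[ℝ] GenTangent V :=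
  LinearMap.rTensor (GenTangent V) Complex.conjAe.toLinearMap

/-- A real one-form, seen as a complex form of degree one. -/
def oneForm (ξ : Dual ℝ V) : Forms V := ExteriorAlgebra.ι ℂ ((1 : ℂ) ⊗ₜ[ℝ] ξ)

/-- Evaluation of complex one-forms at a real vector. -/
def evalAt (X : V) : Dual ℂ (ℂ ⊗[ℝ] Dual ℝ V) :=
  LinearMap.liftBaseChange ℂ
    ((Algebra.linearMap ℝ ℂ) ∘ₗ (Dual.eval ℝ V X))

/-- Interior product with a real vector: the antiderivation `i_X` of the algebra of complex forms
with `i_X ξ = ξ(X)` for one-forms `ξ`. -/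
def interiorProd (X : V) : Forms V →ₗ[ℂ] Forms V :=
  CliffordAlgebra.contractLeft (Q := (0 : QuadraticForm ℂ (ℂ ⊗[ℝ] Dual ℝ V))) (evalAt X)

/-- The Clifford action `(X + ξ) · φ = i_X φ + ξ ∧ φ` of `V ⊕ V*` on complex forms. -/
def cliffordReal : GenTangent V →ₗ[ℝ] (Forms V →ₗ[ℂ] Forms V) where
  toFun u := interiorProd u.1 + LinearMap.mulLeft ℂ (oneForm u.2)
  map_add' u v := by
    have h1 : evalAt (u.1 + v.1) = evalAt u.1 + evalAt v.1 := by
      ext; simp [evalAt]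
    refine LinearMap.ext fun φ => ?_
    simp [interiorProd, oneForm, h1, TensorProduct.tmul_add, add_mul]
    abel
  map_smul' c u := by
    have h1 : evalAt (c • u.1) = (c : ℂ) • evalAt u.1 := by
      ext; simp [evalAt]
    have h2 : (1 : ℂ) ⊗ₜ[ℝ] (c • u.2) = (c : ℂ) • ((1 : ℂ) ⊗ₜ[ℝ] u.2) := by
      rw [TensorProduct.tmul_smul, TensorProduct.smul_tmul']
      simp [TensorProduct.smul_tmul']
    refine LinearMap.ext fun φ => ?_
    simp only [interiorProd, oneForm, Prod.smul_fst, Prod.smul_snd, h1, h2, map_smul,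
      LinearMap.add_apply, LinearMap.smul_apply, LinearMap.mulLeft_apply, smul_mul_assoc,
      RingHom.id_apply, smul_add]
    simp only [Complex.coe_smul]

/-- The Clifford action, extended complex linearly to `(V ⊕ V*) ⊗ ℂ`. -/
def clifford : ℂ ⊗[ℝ] GenTangent V →ₗ[ℂ] (Forms V →ₗ[ℂ] Forms V) :=
  LinearMap.liftBaseChange ℂ cliffordReal

/-- The null space `L_φ` of a complex form. -/
def nullSpace (φ : Forms V) : Submodule ℂ (ℂ ⊗[ℝ] GenTangent V) :=
  LinearMap.ker (clifford.flip φ)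

/-- Isotropy for the complex bilinear extension of the inner product. -/
def IsIsotropic (L : Submodule ℂ (ℂ ⊗[ℝ] GenTangent V)) : Prop :=
  ∀ u ∈ L, ∀ v ∈ L, (pairing (V := V)).baseChange ℂ u v = 0

/-- A pure spinor: its null space is maximal isotropic. -/
def IsPureSpinor (φ : Forms V) : Prop :=
  IsIsotropic (nullSpace φ) ∧
    ∀ L : Submodule ℂ (ℂ ⊗[ℝ] GenTangent V), IsIsotropic L → nullSpace φ ≤ L → L = nullSpace φ

/-- The pure spinor line of `J`: the forms annihilated by the `+i`-eigenspace of `J`. -/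
def spinorLine (J : GenTangent V →ₗ[ℝ] GenTangent V) : Submodule ℂ (Forms V) where
  carrier := {φ | ∀ w ∈ plusEigenspace J, clifford w φ = 0}
  add_mem' h h' w hw := by rw [map_add, h w hw, h' w hw, add_zero]
  zero_mem' w _ := map_zero _
  smul_mem' c φ h w hw := by rw [map_smul, h w hw, smul_zero]

/-- The exponential `∑ ωᵏ / k!` of a form; for a form of degree two the omitted terms vanish,
since the degree `2k` of `ωᵏ` exceeds the dimension of `V`. -/
def formExp (ω : Forms V) : Forms V :=
  ∑ k ∈ Finset.range (finrank ℝ V + 1), ((Nat.factorial k : ℂ)⁻¹) • ω ^ k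

/-- Pullback of complex forms along a real endomorphism of `V`. -/
def pullback (f : V →ₗ[ℝ] V) : Forms V →ₗ[ℂ] Forms V :=
  (ExteriorAlgebra.map (f.dualMap.baseChange ℂ)).toLinearMap

end GenCplx

/-! ### Automorphisms of a real Lie algebra and the group `K` -/

/-- The group of automorphisms of a Lie algebra. -/
instance lieAutGroup {R L : Type*} [CommRing R] [LieRing L] [LieAlgebra R L] :
    Group (L ≃ₗ⁅R⁆ L) where
  mul f g := g.trans f
  one := LieEquiv.refl
  inv f := f.symm
  mul_assoc _ _ _ := rfl
  one_mul _ := rfl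
  mul_one _ := rfl
  inv_mul_cancel f := LieEquiv.ext fun x => f.symm_apply_apply x

/-- The exponential of an endomorphism of a finite-dimensional real vector space. -/
def endExp {V : Type*} [AddCommGroup V] [Module ℝ V] [FiniteDimensional ℝ V]
    (f : V →ₗ[ℝ] V) : V →ₗ[ℝ] V :=
  Matrix.toLin (finBasis ℝ V) (finBasis ℝ V)
    (NormedSpace.exp (LinearMap.toMatrix (finBasis ℝ V) (finBasis ℝ V) f))

namespace RealFlag

open LieAlgebra LieAlgebra.IsKilling GenCplx

variable {𝔤 : Type*} [LieRing 𝔤] [LieAlgebra ℝ 𝔤] [FiniteDimensional ℝ 𝔤]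

/-- `θ` is a Cartan involution of `𝔤` that is `-1` on `𝔞`: an involutive automorphism for which
`-⟨X, θ X⟩` is positive definite, `⟨·,·⟩` being the Cartan-Killing form. -/
structure IsCartanInvolution (𝔞 : LieSubalgebra ℝ 𝔤) (θ : 𝔤 ≃ₗ⁅ℝ⁆ 𝔤) : Prop where
  involutive : ∀ X, θ (θ X) = X
  neg_def : ∀ X, X ≠ 0 → killingForm ℝ 𝔤 X (θ X) < 0
  on_cartan : ∀ X ∈ 𝔞, θ X = -X

/-- The maximal compact group `K`, generated by `exp(ad X)` with `X ∈ 𝔨 = {X | θ X = X}`. -/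
def groupK (θ : 𝔤 ≃ₗ⁅ℝ⁆ 𝔤) : Subgroup (𝔤 ≃ₗ⁅ℝ⁆ 𝔤) :=
  Subgroup.closure {g | ∃ X : 𝔤, θ X = X ∧
    ((g : 𝔤 →ₗ⁅ℝ⁆ 𝔤) : 𝔤 →ₗ[ℝ] 𝔤) = endExp (LieAlgebra.ad ℝ 𝔤 X)}

/-- The group `M`: the centralizer of `𝔞` in `K`. It is the isotropy group of `K` at the origin
of the maximal flag manifold `K / M`. -/
def groupM (𝔞 : LieSubalgebra ℝ 𝔤) (θ : 𝔤 ≃ₗ⁅ℝ⁆ 𝔤) : Subgroup (𝔤 ≃ₗ⁅ℝ⁆ 𝔤) where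
  carrier := {g | g ∈ groupK θ ∧ ∀ h ∈ 𝔞, g h = h}
  mul_mem' {f g} hf hg := ⟨mul_mem hf.1 hg.1, fun h hh => by
    change f (g h) = h
    rw [hg.2 h hh, hf.2 h hh]⟩
  one_mem' := ⟨one_mem _, fun _ _ => rfl⟩
  inv_mem' {f} hf := ⟨inv_mem hf.1, fun h hh => by
    change f.symm h = h
    conv_lhs => rw [← hf.2 h hh]
    exact f.symm_apply_apply h⟩

variable [IsKilling ℝ 𝔤]
variable (𝔞 : LieSubalgebra ℝ 𝔤) [𝔞.IsCartanSubalgebra] [IsTriangularizable ℝ 𝔞 𝔤]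

/-- The root system is of type `A₃`: the roots are `λᵢ - λⱼ` with `i ≠ j` in `{1, …, 4}`. -/
def IsTypeA3 : Prop :=
  ∃ l : Fin 4 → Dual ℝ 𝔞, LinearIndependent ℝ (fun i : Fin 3 => l i.castSucc - l i.succ) ∧
    Set.range (rootSystem 𝔞).root = {f | ∃ i j, i ≠ j ∧ f = l i - l j}

/-- The root system is of type `B₂`: the roots are `±λᵢ` and `±λ₁ ± λ₂`. -/
def IsTypeB2 : Prop :=
  ∃ l₁ l₂ : Dual ℝ 𝔞, LinearIndependent ℝ ![l₁, l₂] ∧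
    Set.range (rootSystem 𝔞).root =
      {l₁, -l₁, l₂, -l₂, l₁ + l₂, -(l₁ + l₂), l₁ - l₂, -(l₁ - l₂)}

/-- The root system is of type `G₂`: the roots are `±λ₁`, `±λ₂`, `±(λ₁ + λ₂)`, `±(λ₁ + 2λ₂)`,
`±(λ₁ + 3λ₂)` and `±(2λ₁ + 3λ₂)`. -/
def IsTypeG2 : Prop :=
  ∃ l₁ l₂ : Dual ℝ 𝔞, LinearIndependent ℝ ![l₁, l₂] ∧
    Set.range (rootSystem 𝔞).root =
      {l₁, -l₁, l₂, -l₂, l₁ + l₂, -(l₁ + l₂), l₁ + 2 • l₂, -(l₁ + 2 • l₂),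
        l₁ + 3 • l₂, -(l₁ + 3 • l₂), 2 • l₁ + 3 • l₂, -(2 • l₁ + 3 • l₂)}

/-- The root system is of type `D_l`: the roots are `±λᵢ ± λⱼ` with `i < j` in `{1, …, l}`. -/
def IsTypeD (n : ℕ) : Prop :=
  ∃ l : Fin n → Dual ℝ 𝔞, LinearIndependent ℝ l ∧
    Set.range (rootSystem 𝔞).root =
      {f | ∃ i j, i < j ∧ (f = l i + l j ∨ f = -(l i + l j) ∨ f = l i - l j ∨ f = -(l i - l j))}

variable {𝔞}

/-- A Weyl basis: root vectors `X_α` with `⟨X_α, X_{-α}⟩ = 1` and `[X_α, X_β] = m_{α,β} X_{α+β}`,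
where `m_{-α,-β} = -m_{α,β}` and `m_{α,β} = 0` if `α + β` is not a root. (The value of `X` at the
zero weight plays no role.) -/
structure IsWeylBasis (X : Weight ℝ 𝔞 𝔤 → 𝔤) : Prop where
  mem : ∀ α : Weight ℝ 𝔞 𝔤, α.IsNonZero → X α ∈ rootSpace 𝔞 α
  pair : ∀ α : Weight ℝ 𝔞 𝔤, α.IsNonZero → killingForm ℝ 𝔤 (X α) (X (-α)) = 1
  bracket : ∃ m : Weight ℝ 𝔞 𝔤 → Weight ℝ 𝔞 𝔤 → ℝ,
    (∀ α β γ : Weight ℝ 𝔞 𝔤, α.IsNonZero → β.IsNonZero → γ.IsNonZero →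
      (γ : 𝔞 → ℝ) = (α : 𝔞 → ℝ) + (β : 𝔞 → ℝ) → ⁅X α, X β⁆ = m α β • X γ) ∧
    (∀ α β : Weight ℝ 𝔞 𝔤, α.IsNonZero → β.IsNonZero → m (-α) (-β) = -m α β) ∧
    (∀ α β : Weight ℝ 𝔞 𝔤, α.IsNonZero → β.IsNonZero →
      (∀ γ : Weight ℝ 𝔞 𝔤, γ.IsNonZero → (γ : 𝔞 → ℝ) ≠ (α : 𝔞 → ℝ) + (β : 𝔞 → ℝ)) →
      m α β = 0)

/-- The set `Π⁻` of negative roots, for the positive system given by the simple roots `b`. -/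
abbrev NegRoot (b : (rootSystem 𝔞).Base) : Type _ := {α : 𝔞.root // ¬ b.IsPos α}

/-- The weight underlying a negative root. -/
abbrev NegRoot.wt {b : (rootSystem 𝔞).Base} (α : NegRoot b) : Weight ℝ 𝔞 𝔤 := α.1.1

/-- The root space `𝔤_α` as a real subspace of `𝔤`. -/
abbrev rootSub (α : Weight ℝ 𝔞 𝔤) : Submodule ℝ 𝔤 := (rootSpace 𝔞 α).toSubmodule

/-- The subspace `𝔫⁻`, sum of the root spaces of the negative roots: the tangent space of the
maximal flag manifold at the origin. -/
def nMinus (b : (rootSystem 𝔞).Base) : Submodule ℝ 𝔤 :=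
  ⨆ α : NegRoot b, rootSub α.wt

lemma groupM_map_rootSub {θ : 𝔤 ≃ₗ⁅ℝ⁆ 𝔤} {m : 𝔤 ≃ₗ⁅ℝ⁆ 𝔤} (hm : m ∈ groupM 𝔞 θ)
    (α : Weight ℝ 𝔞 𝔤) : ∀ x ∈ rootSub α, m x ∈ rootSub α := by
  intro x hx
  apply weightSpace_le_genWeightSpace
  rw [mem_weightSpace]
  intro h
  have h1 : ⁅(h : 𝔤), x⁆ = α h • x := lie_eq_smul_of_mem_rootSpace hx h
  have h2 : m ⁅(h : 𝔤), x⁆ = ⁅(h : 𝔤), m x⁆ := by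
    rw [LieEquiv.map_lie, hm.2 h h.2]
  change ⁅(h : 𝔤), m x⁆ = α h • m x
  rw [← h2, h1]
  exact map_smul (m : 𝔤 →ₗ⁅ℝ⁆ 𝔤) _ _

lemma groupM_map_nMinus {θ : 𝔤 ≃ₗ⁅ℝ⁆ 𝔤} {m : 𝔤 ≃ₗ⁅ℝ⁆ 𝔤} (hm : m ∈ groupM 𝔞 θ)
    (b : (rootSystem 𝔞).Base) : ∀ x ∈ nMinus b, m x ∈ nMinus b := by
  intro x hx
  have : nMinus b ≤ (nMinus b).comap ((m : 𝔤 →ₗ⁅ℝ⁆ 𝔤) : 𝔤 →ₗ[ℝ] 𝔤) :=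
    iSup_le fun α y hy => le_iSup (fun α : NegRoot b => rootSub α.wt) α
      (groupM_map_rootSub hm α.wt y hy)
  exact this hx

/-- The representation of `M` on `𝔤_α`. -/
def actRoot (θ : 𝔤 ≃ₗ⁅ℝ⁆ 𝔤) (α : Weight ℝ 𝔞 𝔤) (m : groupM 𝔞 θ) :
    rootSub α →ₗ[ℝ] rootSub α :=
  ((m.1 : 𝔤 →ₗ⁅ℝ⁆ 𝔤) : 𝔤 →ₗ[ℝ] 𝔤).restrict (groupM_map_rootSub m.2 α)

/-- The isotropy representation of `M` on `𝔫⁻`. -/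
def actN (θ : 𝔤 ≃ₗ⁅ℝ⁆ 𝔤) (b : (rootSystem 𝔞).Base) (m : groupM 𝔞 θ) :
    nMinus b →ₗ[ℝ] nMinus b :=
  ((m.1 : 𝔤 →ₗ⁅ℝ⁆ 𝔤) : 𝔤 →ₗ[ℝ] 𝔤).restrict (groupM_map_nMinus m.2 b)

/-- The representation `Ad ⊕ Ad*` of `M` on `𝔫⁻ ⊕ (𝔫⁻)*`, where `Ad*(m) ξ = ξ ∘ Ad(m⁻¹)`. -/
def actGen (θ : 𝔤 ≃ₗ⁅ℝ⁆ 𝔤) (b : (rootSystem 𝔞).Base) (m : groupM 𝔞 θ) :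
    GenTangent (nMinus b) →ₗ[ℝ] GenTangent (nMinus b) :=
  (actN θ b m).prodMap (actN θ b m⁻¹).dualMap

/-- `M`-equivalence of negative roots: the representations of `M` on `𝔤_α` and `𝔤_β` are
equivalent. -/
def mSetoid (θ : 𝔤 ≃ₗ⁅ℝ⁆ 𝔤) (b : (rootSystem 𝔞).Base) : Setoid (NegRoot b) where
  r α β := ∃ e : rootSub α.wt ≃ₗ[ℝ] rootSub β.wt,
    ∀ m : groupM 𝔞 θ, ∀ x, e (actRoot θ α.wt m x) = actRoot θ β.wt m (e x)
  iseqv :=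
    { refl := fun _ => ⟨LinearEquiv.refl ℝ _, fun _ _ => rfl⟩
      symm := fun ⟨e, he⟩ => ⟨e.symm, fun m x => by
        rw [LinearEquiv.symm_apply_eq, he, LinearEquiv.apply_symm_apply]⟩
      trans := fun ⟨e, he⟩ ⟨f, hf⟩ => ⟨e.trans f, fun m x => by
        rw [LinearEquiv.trans_apply, LinearEquiv.trans_apply, he, hf]⟩ }

/-- The set of `M`-equivalence classes of negative roots. -/
abbrev MClass (θ : 𝔤 ≃ₗ⁅ℝ⁆ 𝔤) (b : (rootSystem 𝔞).Base) : Type _ := Quotient (mSetoid θ b)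

/-- An invariant generalized almost complex structure on the maximal flag manifold `K / M`, given
by its value at the origin: a generalized almost complex structure on `𝔫⁻` that commutes with
the isotropy representation `Ad ⊕ Ad*` of `M`. -/
def IsInvariantGACS (θ : 𝔤 ≃ₗ⁅ℝ⁆ 𝔤) (b : (rootSystem 𝔞).Base)
    (J : GenTangent (nMinus b) →ₗ[ℝ] GenTangent (nMinus b)) : Prop :=
  IsGenAlmostComplex J ∧ ∀ (m : groupM 𝔞 θ) (u), J (actGen θ b m u) = actGen θ b m (J u)

variable {b : (rootSystem 𝔞).Base}

/-- The vector `X_α` of the Weyl basis, as an element of `𝔫⁻`. -/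
def vec {X : Weight ℝ 𝔞 𝔤 → 𝔤} (hX : IsWeylBasis X) (α : NegRoot b) : nMinus b :=
  ⟨X α.wt, le_iSup (fun α : NegRoot b => rootSub α.wt) α
    (hX.mem _ (LieSubalgebra.isNonZero_coe_root (H := 𝔞) α.1))⟩

/-- The covector `X*_α = ⟨X_{-α}, ·⟩` in `(𝔫⁻)*`. -/
def covec (b : (rootSystem 𝔞).Base) (X : Weight ℝ 𝔞 𝔤 → 𝔤) (α : NegRoot b) :
    Dual ℝ (nMinus b) :=
  (killingForm ℝ 𝔤 (X (-α.wt))).domRestrict (nMinus b)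

/-- In the basis `(X_α, X_β, X*_α, X*_β)` the restriction of `J` to `V_[α] ⊕ V*_[α]` has the
noncomplex type matrix
`((a, 0, 0, -x), (0, a, x, 0), (0, -y, -a, 0), (y, 0, 0, -a))` with `a² = x y - 1`. -/
structure IsNoncomplexBlock {X : Weight ℝ 𝔞 𝔤 → 𝔤} (hX : IsWeylBasis X)
    (J : GenTangent (nMinus b) →ₗ[ℝ] GenTangent (nMinus b)) (α β : NegRoot b)
    (a x y : ℝ) : Prop where
  eqn : a ^ 2 = x * y - 1
  col₁ : J (vec hX α, 0) = (a • vec hX α, y • covec b X β)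
  col₂ : J (vec hX β, 0) = (a • vec hX β, -y • covec b X α)
  col₃ : J (0, covec b X α) = (x • vec hX β, -a • covec b X α)
  col₄ : J (0, covec b X β) = (-x • vec hX α, -a • covec b X β)

/-- In the basis `(X_α, X_β, X*_α, X*_β)` the restriction of `J` to `V_[α] ⊕ V*_[α]` has the
complex type matrix
`((b, -(1+b²)/c, 0, 0), (c, -b, 0, 0), (0, 0, -b, -c), (0, 0, (1+b²)/c, b))` with `c ≠ 0`
(the parameter `b` is called `p` here). -/
structure IsComplexBlock {X : Weight ℝ 𝔞 𝔤 → 𝔤} (hX : IsWeylBasis X)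
    (J : GenTangent (nMinus b) →ₗ[ℝ] GenTangent (nMinus b)) (α β : NegRoot b)
    (p c : ℝ) : Prop where
  ne : c ≠ 0
  col₁ : J (vec hX α, 0) = (p • vec hX α + c • vec hX β, 0)
  col₂ : J (vec hX β, 0) = (-((1 + p ^ 2) / c) • vec hX α - p • vec hX β, 0)
  col₃ : J (0, covec b X α) = (0, -p • covec b X α + ((1 + p ^ 2) / c) • covec b X β)
  col₄ : J (0, covec b X β) = (0, -c • covec b X α + p • covec b X β)

/-- `Ω ∈ ⋀^{1,0} V*_[α]`, where `J` is of complex type on the class `{α, β}`: a complex one-form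
in the span of `X*_α, X*_β` such that `Ω(Jᶜ v) = i Ω(v)` for `v ∈ V_[α]`, where `Jᶜ` is the complex
structure on `V_[α]` with `J(v) = -Jᶜ v`. -/
def IsOneZeroForm {X : Weight ℝ 𝔞 𝔤 → 𝔤} (hX : IsWeylBasis X)
    (J : GenTangent (nMinus b) →ₗ[ℝ] GenTangent (nMinus b)) (α β : NegRoot b)
    (Ω : ℂ ⊗[ℝ] Dual ℝ (nMinus b)) : Prop :=
  Ω ∈ Submodule.span ℂ {(1 : ℂ) ⊗ₜ[ℝ] covec b X α, (1 : ℂ) ⊗ₜ[ℝ] covec b X β} ∧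
  ∀ v ∈ Submodule.span ℝ {vec hX α, vec hX β},
    evalAt (-(J (v, 0)).1) Ω = Complex.I * evalAt v Ω

/-- The two-form `B_α = -(a / x) X*_α ∧ X*_β`. -/
def formB (X : Weight ℝ 𝔞 𝔤 → 𝔤) (α β : NegRoot b) (a x : ℝ) : Forms (nMinus b) :=
  ((-(a / x) : ℝ) : ℂ) • (oneForm (covec b X α) * oneForm (covec b X β))

/-- The two-form `ω_α = (1 / x) X*_α ∧ X*_β`. -/
def formOmega (X : Weight ℝ 𝔞 𝔤 → 𝔤) (α β : NegRoot b) (x : ℝ) : Forms (nMinus b) :=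
  ((1 / x : ℝ) : ℂ) • (oneForm (covec b X α) * oneForm (covec b X β))

end RealFlag

end

/-! The first assertion is about sign characters of `M`. Each root space is a line preserved by `M`;
since `M` preserves the Killing form and commutes with `θ`, it acts on the line by a sign, the same
one for `α` and `-α` (`exists_actsBy`, `ActsBy.neg`). So `M`-equivalence is equality of characters
(`mSetoid_iff`), and one must show that each root shares its character with exactly one other root,
up to sign.

Different characters are separated by explicit elements. If `γ` is long in the sense of `IsLong` and
`e` is a root vector such that `γ^∨, e, -θ e` is an sl2-triple, then `Y = e + θ e` is in `𝔨`, and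
`exp(π ad Y)` is in `M` and acts on `𝔤_δ` by the parity of `⟨δ, γ^∨⟩` (`exists_mem_groupM`).

Coincidences must hold for every element of `K` that centralizes `𝔞`, and no generators of `M` are
at hand. Let `α, β` be orthogonal long roots such that every other root is orthogonal to both or
pairs to `±1` with both. The involution `exp(π ad Y_α)` grades `𝔨`; `Y_α` and `Y_β` centralize the
even part and have square `-1` on the odd part. Hence `Y_α + Y_β` lies in a subspace stable under
`ad 𝔨`, so under `K`, that `Y_α - Y_β` centralizes (`exists_stable_of_sq_eq`). An element of `M`
with opposite signs on the two root spaces sends `Y_α + Y_β` to `±(Y_α - Y_β)`, which is then in the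
same subspace; this, and the same with `-Y_β` for `Y_β`, contradicts the existence of an odd vector
(`PairData.charEq`).

In type `D_n` the partner of `u l_p + v l_q` is `u l_p - v l_q`. Index pairs sharing one index are
separated by a root on one of the pairs, disjoint ones by a root that uses a fifth index; so the
argument covers `n ≥ 5`, and also `n = 3`, that is `A₃`, where disjoint pairs do not exist. In `B₂`
the element `Y_α ± Y_β` is central in `𝔨` for one choice of sign, so the long characters are trivial
(`IsLongPair.actsBy_one`), and the two short ones then agree. In `G₂` multiplicativity of the
characters along sums of roots suffices.

Given the classes, an invariant `J` preserves each `V_[α] ⊕ V_[α]*`. Orthogonality and `J² = -1`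
make `J` skew, and the remaining quadratic equations have only the two families of solutions in
`block_cases`.

For the spinor, one checks on a basis that `φ` is killed by the `+i`-eigenspace `L`
(`spinor_mem_spinorLine`). The rest holds for any generalized almost complex structure: `L` and the
`-i`-eigenspace are isotropic and dual to each other, so they act on forms as annihilation and
creation operators, and the vacuum is unique up to scalars
(`IsGenAlmostComplex.spinorLine_eq_span`). Maximality of `L` among isotropic subspaces gives purity
and `L_φ = L`, and `M` multiplies `φ` by a product of signs. -/

noncomputable section

set_option linter.unusedSectionVars false

/-! ### Uniqueness of the vacuum for annihilation and creation operators -/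

section Fock

variable {K F ι : Type*} [Field K] [CharZero K] [AddCommGroup F] [Module K F]

/-- Uniqueness of the vacuum of a finite family of annihilation operators `a` with creation
operators `b`. -/
lemma exists_eq_smul_of_annihilated [Finite ι] [DecidableEq ι] {a b : ι → End K F}
    (hab : ∀ i j, a i * b j + b j * a i = if i = j then 1 else 0)
    (hbb : ∀ i j, b i * b j + b j * b i = 0) {φ ψ : F} (hφ : ∀ i, a i φ = 0)
    (hψ : ∀ i, a i ψ = 0) (hspan : ∃ c : K, ψ - c • φ ∈ ⨆ i, LinearMap.range (b i)) :
    ∃ c : K, ψ = c • φ := by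
  have : Fintype ι := Fintype.ofFinite ι
  have hsq : ∀ i, b i * b i = 0 := fun i => by
    have h := hbb i i
    rwa [← two_smul K (b i * b i), smul_eq_zero_iff_right two_ne_zero] at h
  -- For `i ≠ j` the operator `b j` anticommutes with both `a i` and `b i`, so it commutes with
  -- their product.
  have hcomm : ∀ (l : List ι) (j : ι), j ∉ l →
      (l.map fun i => a i * b i).prod * b j = b j * (l.map fun i => a i * b i).prod := by
    intro l j hj
    induction l with
    | nil => simp
    | cons i l ih =>
      rw [List.mem_cons, not_or] at hj
      have h1 := hab i j
      rw [if_neg (fun h => hj.1 h.symm)] at h1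
      have h2 : a i * b i * b j = b j * (a i * b i) := by
        rw [mul_assoc, eq_neg_of_add_eq_zero_left (hbb i j), mul_neg, ← mul_assoc,
          eq_neg_of_add_eq_zero_left h1, neg_mul, neg_neg, mul_assoc]
      rw [List.map_cons, List.prod_cons, mul_assoc, ih hj.2, ← mul_assoc, h2, mul_assoc]
  have hkill : ∀ (l : List ι), l.Nodup → ∀ k ∈ l, (l.map fun i => a i * b i).prod * b k = 0 := by
    intro l
    induction l with
    | nil => simp
    | cons i l ih =>
      intro hl k hk
      rw [List.map_cons, List.prod_cons]
      rw [List.nodup_cons] at hl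
      rcases List.mem_cons.1 hk with rfl | hk
      · rw [mul_assoc, hcomm l k hl.1, ← mul_assoc, mul_assoc (a k), hsq, mul_zero, zero_mul]
      · rw [mul_assoc, ih hl.2 k hk, mul_zero]
  have hfix : ∀ (l : List ι) (x : F), (∀ i, a i x = 0) → (l.map fun i => a i * b i).prod x = x := by
    intro l x hx
    induction l with
    | nil => simp
    | cons i l ih =>
      rw [List.map_cons, List.prod_cons, Module.End.mul_apply, ih]
      have h := LinearMap.congr_fun (hab i i) x
      simpa [hx i] using h
  obtain ⟨c, hc⟩ := hspan
  refine ⟨c, ?_⟩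
  -- `P` is the projection onto the vacuum: it fixes every vector killed by all `a i`, and it kills
  -- the range of every `b i` because `b i` has square zero. Applying it to `ψ - c • φ` gives the
  -- claim.
  set P := ((Finset.univ : Finset ι).toList.map fun i => a i * b i).prod with hP
  have hle : (⨆ i, LinearMap.range (b i)) ≤ LinearMap.ker P := by
    refine iSup_le fun i => ?_
    rintro _ ⟨y, rfl⟩
    have h := hkill _ (Finset.nodup_toList Finset.univ) i (by simp)
    exact LinearMap.congr_fun h y
  have h := hle hc
  rw [LinearMap.mem_ker, map_sub, map_smul, hfix _ _ hφ, hfix _ _ hψ, sub_eq_zero] at h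
  exact h

end Fock

/-! ### The exterior algebra as an irreducible Clifford module -/

namespace ExteriorAlgebra

variable {K W ι : Type*} [Field K] [AddCommGroup W] [Module K W]

/-- Interior product with a linear functional. -/
abbrev contr (d : Dual K W) : ExteriorAlgebra K W →ₗ[K] ExteriorAlgebra K W :=
  CliffordAlgebra.contractLeft (Q := (0 : QuadraticForm K W)) d

lemma contr_ι_mul (d : Dual K W) (w : W) (x : ExteriorAlgebra K W) :
    contr d (ExteriorAlgebra.ι K w * x) = d w • x - ExteriorAlgebra.ι K w * contr d x :=
  CliffordAlgebra.contractLeft_ι_mul d w x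

lemma ι_mul_ι_swap (v w : W) :
    ExteriorAlgebra.ι K v * ExteriorAlgebra.ι K w = -(ExteriorAlgebra.ι K w * ExteriorAlgebra.ι K v) :=
  eq_neg_of_add_eq_zero_left (ExteriorAlgebra.ι_add_mul_swap v w)

variable [CharZero K]

/-- A form annihilated by all interior products is a scalar. -/
lemma exists_eq_smul_one_of_contr [Finite ι] (B : Basis ι K W) {φ : ExteriorAlgebra K W}
    (h : ∀ i, contr (B.coord i) φ = 0) : ∃ c : K, φ = c • 1 := by
  classical
  -- The vacuum is the form `1`; the spanning condition says that a form is a scalar plus an element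
  -- of the ideal generated by one-forms.
  refine exists_eq_smul_of_annihilated (a := fun i => contr (B.coord i))
    (b := fun i => LinearMap.mulLeft K (ExteriorAlgebra.ι K (B i))) ?_ ?_
    (fun i => CliffordAlgebra.contractLeft_one (0 : QuadraticForm K W) (B.coord i)) h ?_
  · intro i j
    refine LinearMap.ext fun x => ?_
    simp only [LinearMap.add_apply, Module.End.mul_apply, LinearMap.mulLeft_apply, contr_ι_mul,
      sub_add_cancel, Basis.coord_apply, Basis.repr_self, Finsupp.single_apply]
    by_cases hij : i = j
    · simp [hij]
    · simp [hij, Ne.symm hij]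
  · intro i j
    refine LinearMap.ext fun x => ?_
    simp [← mul_assoc, ← add_mul]
  · have hmem : ∀ (w : W) (x : ExteriorAlgebra K W), ExteriorAlgebra.ι K w * x ∈
        ⨆ i, LinearMap.range (LinearMap.mulLeft K (ExteriorAlgebra.ι K (B i))) := by
      intro w x
      have := Fintype.ofFinite ι
      rw [← B.sum_repr w, map_sum, Finset.sum_mul]
      refine Submodule.sum_mem _ fun i _ => ?_
      rw [map_smul, smul_mul_assoc]
      exact Submodule.smul_mem _ _ (Submodule.mem_iSup_of_mem i ⟨x, rfl⟩)
    clear h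
    induction φ using CliffordAlgebra.left_induction with
    | algebraMap r => exact ⟨r, by rw [Algebra.algebraMap_eq_smul_one, sub_self]; exact zero_mem _⟩
    | add x y hx hy =>
      obtain ⟨c, hc⟩ := hx
      obtain ⟨d, hd⟩ := hy
      refine ⟨c + d, ?_⟩
      have : x + y - (c + d) • 1 = (x - c • 1) + (y - d • 1) := by rw [add_smul]; abel
      rw [this]
      exact add_mem hc hd
    | ι_mul x m _ => exact ⟨0, by rw [zero_smul, sub_zero]; exact hmem m x⟩

/-- A nonzero space of forms stable under interior and exterior products is everything. -/
lemma eq_top_of_stable [Finite ι] (B : Basis ι K W) {S : Submodule K (ExteriorAlgebra K W)}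
    {φ : ExteriorAlgebra K W} (hφ : φ ≠ 0) (hS : φ ∈ S)
    (h1 : ∀ i, ∀ x ∈ S, contr (B.coord i) x ∈ S)
    (h2 : ∀ i, ∀ x ∈ S, ExteriorAlgebra.ι K (B i) * x ∈ S) : S = ⊤ := by
  classical
  have := Fintype.ofFinite ι
  -- Contract with one coordinate after another, skipping a contraction that would give zero. Since
  -- contractions anticommute and have square zero, the earlier ones still vanish, and a nonzero
  -- scalar is left in `S` at the end.
  have key : ∀ s : Finset ι, ∃ x ∈ S, x ≠ 0 ∧ ∀ i ∈ s, contr (B.coord i) x = 0 := by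
    intro s
    induction s using Finset.induction_on with
    | empty => exact ⟨φ, hS, hφ, by simp⟩
    | insert j s _ ih =>
      obtain ⟨x, hx, hx0, hxs⟩ := ih
      by_cases hj : contr (B.coord j) x = 0
      · refine ⟨x, hx, hx0, fun i hi => ?_⟩
        rcases Finset.mem_insert.1 hi with rfl | hi
        exacts [hj, hxs i hi]
      · refine ⟨_, h1 j x hx, hj, fun i hi => ?_⟩
        rcases Finset.mem_insert.1 hi with rfl | hi
        · exact CliffordAlgebra.contractLeft_contractLeft _ _
        · have h := CliffordAlgebra.contractLeft_comm (Q := (0 : QuadraticForm K W))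
            (B.coord i) (B.coord j) x
          rw [h, hxs i hi, map_zero, neg_zero]
  obtain ⟨x, hx, hx0, hxs⟩ := key Finset.univ
  obtain ⟨c, rfl⟩ := exists_eq_smul_one_of_contr B fun i => hxs i (Finset.mem_univ i)
  have hc : c ≠ 0 := by rintro rfl; simp at hx0
  have hone : (1 : ExteriorAlgebra K W) ∈ S := by
    have := S.smul_mem c⁻¹ hx
    rwa [smul_smul, inv_mul_cancel₀ hc, one_smul] at this
  rw [eq_top_iff]
  intro y _
  induction y using CliffordAlgebra.left_induction with
  | algebraMap r => rw [Algebra.algebraMap_eq_smul_one]; exact S.smul_mem r hone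
  | add x y hx hy => exact S.add_mem (hx trivial) (hy trivial)
  | ι_mul x m hx =>
    change ExteriorAlgebra.ι K m * x ∈ S
    rw [← B.sum_repr m, map_sum, Finset.sum_mul]
    refine Submodule.sum_mem _ fun i _ => ?_
    rw [map_smul, smul_mul_assoc]
    exact S.smul_mem _ (h2 i x (hx trivial))

end ExteriorAlgebra

/-! ### The Clifford action and the spinor line of a generalized almost complex structure -/

namespace GenCplx

variable {V : Type*} [AddCommGroup V] [Module ℝ V]

@[simp] lemma evalAt_tmul (X : V) (z : ℂ) (ξ : Dual ℝ V) :
    evalAt X (z ⊗ₜ[ℝ] ξ) = z * (ξ X : ℝ) := by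
  simp [evalAt]

lemma cliffordReal_apply (u : GenTangent V) (φ : Forms V) :
    cliffordReal u φ = interiorProd u.1 φ + oneForm u.2 * φ := rfl

@[simp] lemma clifford_tmul (z : ℂ) (u : GenTangent V) (φ : Forms V) :
    clifford (z ⊗ₜ[ℝ] u) φ = z • cliffordReal u φ := by
  simp [clifford]

lemma interiorProd_ι_mul (X : V) (w : ℂ ⊗[ℝ] Dual ℝ V) (φ : Forms V) :
    interiorProd X (ExteriorAlgebra.ι ℂ w * φ) =
      evalAt X w • φ - ExteriorAlgebra.ι ℂ w * interiorProd X φ :=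
  ExteriorAlgebra.contr_ι_mul _ _ _

/-- Two interior products anticommute and so do two exterior products; only the mixed terms survive,
and these evaluate covectors on vectors. -/
lemma cliffordReal_anticomm (u v : GenTangent V) (φ : Forms V) :
    cliffordReal u (cliffordReal v φ) + cliffordReal v (cliffordReal u φ) =
      ((2 * pairing u v : ℝ) : ℂ) • φ := by
  have h1 : interiorProd u.1 (interiorProd v.1 φ) = - interiorProd v.1 (interiorProd u.1 φ) :=
    CliffordAlgebra.contractLeft_comm _ _ _
  have h2 : oneForm u.2 * (oneForm v.2 * φ) = -(oneForm v.2 * (oneForm u.2 * φ)) := by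
    rw [← mul_assoc, ← mul_assoc, oneForm, oneForm, ExteriorAlgebra.ι_mul_ι_swap, neg_mul]
  simp only [cliffordReal_apply, map_add]
  rw [h1, h2]
  simp only [oneForm, interiorProd_ι_mul, evalAt_tmul, one_mul, pairing, LinearMap.mk₂_apply]
  have : ((2 * ((u.2 v.1 + v.2 u.1) / 2) : ℝ) : ℂ) = ((u.2 v.1 : ℝ) : ℂ) + ((v.2 u.1 : ℝ) : ℂ) := by
    push_cast; ring
  rw [this, add_smul]
  abel

lemma clifford_anticomm (u v : ℂ ⊗[ℝ] GenTangent V) (φ : Forms V) :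
    clifford u (clifford v φ) + clifford v (clifford u φ) =
      (2 * (pairing (V := V)).baseChange ℂ u v) • φ := by
  induction u using TensorProduct.induction_on with
  | zero => simp
  | add x y hx hy =>
    simp only [map_add, LinearMap.add_apply, mul_add, add_smul, ← hx, ← hy]; abel
  | tmul z u =>
    induction v using TensorProduct.induction_on with
    | zero => simp
    | add x y hx hy =>
      simp only [map_add, LinearMap.add_apply, mul_add, add_smul, ← hx, ← hy]; abel
    | tmul w v =>
      simp only [clifford_tmul, map_smul, LinearMap.BilinForm.baseChange_tmul]
      rw [smul_comm w z, ← smul_add, ← smul_add, cliffordReal_anticomm, smul_smul, smul_smul]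
      congr 1
      rw [Complex.real_smul]
      push_cast
      ring

lemma exists_eq_tmul_add {U : Type*} [AddCommGroup U] [Module ℝ U] (u : ℂ ⊗[ℝ] U) :
    ∃ x y : U, u = (1 : ℂ) ⊗ₜ[ℝ] x + Complex.I ⊗ₜ[ℝ] y := by
  induction u using TensorProduct.induction_on with
  | zero => exact ⟨0, 0, by simp⟩
  | add a b ha hb =>
    obtain ⟨x, y, rfl⟩ := ha
    obtain ⟨x', y', rfl⟩ := hb
    exact ⟨x + x', y + y', by simp only [TensorProduct.tmul_add]; abel⟩
  | tmul z u =>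
    refine ⟨z.re • u, z.im • u, ?_⟩
    rw [← TensorProduct.smul_tmul, ← TensorProduct.smul_tmul, ← TensorProduct.add_tmul]
    congr 1
    simp

section

variable [FiniteDimensional ℝ V]

lemma pairing_nondegenerate {u : GenTangent V} (h : ∀ v, pairing u v = 0) : u = 0 := by
  refine Prod.ext ?_ ?_
  · refine (Module.forall_dual_apply_eq_zero_iff ℝ u.1).1 fun ξ => ?_
    simpa [pairing] using h (0, ξ)
  · refine LinearMap.ext fun X => ?_
    simpa [pairing] using h (X, 0)

lemma pairing_baseChange_nondegenerate {u : ℂ ⊗[ℝ] GenTangent V}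
    (h : ∀ v, (pairing (V := V)).baseChange ℂ u v = 0) : u = 0 := by
  obtain ⟨x, y, rfl⟩ := exists_eq_tmul_add u
  have key : ∀ v, pairing x v = 0 ∧ pairing y v = 0 := fun v => by
    have := h ((1 : ℂ) ⊗ₜ[ℝ] v)
    rw [map_add, LinearMap.add_apply, LinearMap.BilinForm.baseChange_tmul,
      LinearMap.BilinForm.baseChange_tmul] at this
    constructor
    · simpa using congrArg Complex.re this
    · simpa using congrArg Complex.im this
  rw [pairing_nondegenerate fun v => (key v).1, pairing_nondegenerate fun v => (key v).2]
  simp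

end

lemma pairing_baseChange_comm (u v : ℂ ⊗[ℝ] GenTangent V) :
    (pairing (V := V)).baseChange ℂ u v = (pairing (V := V)).baseChange ℂ v u := by
  have h : LinearMap.IsSymm (pairing (V := V)) := ⟨fun x y => by simp [pairing, add_comm]⟩
  exact (LinearMap.BilinForm.IsSymm.baseChange ℂ h).eq u v

variable {J : GenTangent V →ₗ[ℝ] GenTangent V}

lemma IsGenAlmostComplex.baseChange_sq (hJ : IsGenAlmostComplex J) (u : ℂ ⊗[ℝ] GenTangent V) :
    J.baseChange ℂ (J.baseChange ℂ u) = -u := by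
  induction u using TensorProduct.induction_on with
  | zero => simp
  | add x y hx hy => simp only [map_add, hx, hy, neg_add]
  | tmul z u => simp [hJ.1, TensorProduct.tmul_neg]

lemma IsGenAlmostComplex.baseChange_pairing (hJ : IsGenAlmostComplex J)
    (u v : ℂ ⊗[ℝ] GenTangent V) :
    (pairing (V := V)).baseChange ℂ (J.baseChange ℂ u) (J.baseChange ℂ v) =
      (pairing (V := V)).baseChange ℂ u v := by
  induction u using TensorProduct.induction_on with
  | zero => simp
  | add x y hx hy => simp only [map_add, LinearMap.add_apply, hx, hy]
  | tmul z u =>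
    induction v using TensorProduct.induction_on with
    | zero => simp
    | add x y hx hy => simp only [map_add, hx, hy]
    | tmul w v =>
      simp only [LinearMap.baseChange_tmul, LinearMap.BilinForm.baseChange_tmul, hJ.2]

lemma IsGenAlmostComplex.isotropic_eigenspace (hJ : IsGenAlmostComplex J) {z : ℂ}
    (hz : z * z = -1) : IsIsotropic (Module.End.eigenspace (J.baseChange ℂ) z) := by
  intro u hu v hv
  rw [Module.End.mem_eigenspace_iff] at hu hv
  have h := hJ.baseChange_pairing u v
  rw [hu, hv, map_smul, map_smul, LinearMap.smul_apply, smul_smul, hz, neg_one_smul] at h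
  have h2 : (2 : ℂ) * (pairing (V := V)).baseChange ℂ u v = 0 := by linear_combination -h
  simpa using h2

/-- The summands are the images of `u` under the spectral projections `(1 ∓ iJ)/2`. -/
lemma IsGenAlmostComplex.exists_add (hJ : IsGenAlmostComplex J) (u : ℂ ⊗[ℝ] GenTangent V) :
    ∃ l ∈ plusEigenspace J, ∃ l' ∈ Module.End.eigenspace (J.baseChange ℂ) (-Complex.I),
      u = l + l' := by
  refine ⟨(1 / 2 : ℂ) • (u - Complex.I • J.baseChange ℂ u), ?_,
    (1 / 2 : ℂ) • (u + Complex.I • J.baseChange ℂ u), ?_, ?_⟩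
  · rw [plusEigenspace, Module.End.mem_eigenspace_iff, map_smul, map_sub, map_smul,
      hJ.baseChange_sq]
    simp only [smul_sub, smul_neg, smul_smul]
    rw [show Complex.I * (1 / 2 * Complex.I) = -(1 / 2) by
      linear_combination (1 / 2 : ℂ) * Complex.I_mul_I, mul_comm Complex.I (1 / 2)]
    module
  · rw [Module.End.mem_eigenspace_iff, map_smul, map_add, map_smul, hJ.baseChange_sq]
    simp only [smul_add, smul_neg, smul_smul]
    rw [show -Complex.I * (1 / 2 * Complex.I) = 1 / 2 by
      linear_combination -(1 / 2 : ℂ) * Complex.I_mul_I]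
    module
  · module

/-- `J` is real, so it commutes with conjugation, while the eigenvalue gets conjugated. -/
lemma conjT_mem (w : ℂ ⊗[ℝ] GenTangent V) (hw : w ∈ plusEigenspace J) :
    conjT w ∈ Module.End.eigenspace (J.baseChange ℂ) (-Complex.I) := by
  have h1 : ∀ u : ℂ ⊗[ℝ] GenTangent V, J.baseChange ℂ (conjT u) = conjT (J.baseChange ℂ u) := by
    intro u
    induction u using TensorProduct.induction_on with
    | zero => simp
    | add x y hx hy => simp only [map_add, hx, hy]
    | tmul z u => simp [conjT]
  have h2 : ∀ (z : ℂ) (u : ℂ ⊗[ℝ] GenTangent V), conjT (z • u) = (starRingEnd ℂ z) • conjT u := by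
    intro z u
    induction u using TensorProduct.induction_on with
    | zero => simp
    | add x y hx hy => simp only [map_add, smul_add, hx, hy]
    | tmul w u => simp [conjT, TensorProduct.smul_tmul']
  rw [plusEigenspace, Module.End.mem_eigenspace_iff] at hw
  rw [Module.End.mem_eigenspace_iff, h1, hw, h2, Complex.conj_I]

section Spinor

lemma IsGenAlmostComplex.eq_zero_of_orthogonal [FiniteDimensional ℝ V] (hJ : IsGenAlmostComplex J)
    {u : ℂ ⊗[ℝ] GenTangent V}
    (h1 : ∀ v ∈ plusEigenspace J, (pairing (V := V)).baseChange ℂ u v = 0)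
    (h2 : ∀ v ∈ Module.End.eigenspace (J.baseChange ℂ) (-Complex.I),
      (pairing (V := V)).baseChange ℂ u v = 0) : u = 0 := by
  refine pairing_baseChange_nondegenerate fun v => ?_
  obtain ⟨l, hl, l', hl', rfl⟩ := hJ.exists_add v
  rw [map_add, h1 l hl, h2 l' hl', add_zero]

/-- Dual bases of the two eigenspaces of `J`. -/
lemma IsGenAlmostComplex.exists_dual_bases [FiniteDimensional ℝ V] (hJ : IsGenAlmostComplex J) :
    ∃ (ι : Type) (_ : Fintype ι) (_ : DecidableEq ι)
      (e : Basis ι ℂ (plusEigenspace J))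
      (f : Basis ι ℂ (Module.End.eigenspace (J.baseChange ℂ) (-Complex.I))),
      ∀ i j, 2 * (pairing (V := V)).baseChange ℂ (e i) (f j) = if i = j then 1 else 0 := by
  set L := plusEigenspace J
  set L' := Module.End.eigenspace (J.baseChange ℂ) (-Complex.I)
  -- The factor `2` is that of the Clifford relation. Both eigenspaces are isotropic and together
  -- they span, so nondegeneracy of the inner product makes `p` injective on either side, hence
  -- perfect.
  let p : L →ₗ[ℂ] L' →ₗ[ℂ] ℂ :=
    (((2 : ℂ) • (pairing (V := V)).baseChange ℂ).compl₁₂ L.subtype L'.subtype)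
  have hp : ∀ x y, p x y = 2 * (pairing (V := V)).baseChange ℂ x y := fun _ _ => rfl
  have hLL : IsIsotropic L := hJ.isotropic_eigenspace Complex.I_mul_I
  have hLL' : IsIsotropic L' := hJ.isotropic_eigenspace (by simp)
  have h1 : Function.Injective p := by
    rw [← LinearMap.ker_eq_bot, LinearMap.ker_eq_bot']
    intro x hx
    refine Subtype.ext (hJ.eq_zero_of_orthogonal (fun v hv => hLL _ x.2 _ hv) fun v hv => ?_)
    have := LinearMap.congr_fun hx ⟨v, hv⟩
    rw [hp] at this
    simpa using this
  have h2 : Function.Injective p.flip := by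
    rw [← LinearMap.ker_eq_bot, LinearMap.ker_eq_bot']
    intro x hx
    refine Subtype.ext (hJ.eq_zero_of_orthogonal (fun v hv => ?_) fun v hv => hLL' _ x.2 _ hv)
    have := LinearMap.congr_fun hx ⟨v, hv⟩
    rw [LinearMap.flip_apply, hp] at this
    rw [pairing_baseChange_comm]
    simpa using this
  have hpp : p.IsPerfPair := LinearMap.IsPerfPair.of_injective h1 h2
  let e := Module.finBasis ℂ L
  refine ⟨_, inferInstance, inferInstance, e, e.dualBasis.map p.flip.toPerfPair.symm, fun i j => ?_⟩
  rw [← hp, Basis.map_apply, ← LinearMap.flip_apply (f := p)]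
  have : p.flip (p.flip.toPerfPair.symm (e.dualBasis j)) = e.dualBasis j :=
    p.flip.toPerfPair.apply_symm_apply _
  rw [this, Basis.dualBasis_apply_self]

lemma coord_baseChange_dualBasis {ι : Type*} [Finite ι] [DecidableEq ι] (v : Basis ι ℝ V) (i : ι) :
    (v.dualBasis.baseChange ℂ).coord i = evalAt (v i) := by
  refine (v.dualBasis.baseChange ℂ).ext fun j => ?_
  rw [Basis.coord_apply, Basis.repr_self, Basis.baseChange_apply, evalAt_tmul,
    Basis.dualBasis_apply_self, Finsupp.single_apply]
  by_cases h : i = j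
  · simp [h]
  · simp [h, Ne.symm h]

/-- The spinors annihilated by the `+i`-eigenspace form a line. -/
lemma IsGenAlmostComplex.spinorLine_eq_span [FiniteDimensional ℝ V] (hJ : IsGenAlmostComplex J) {φ : Forms V}
    (hφ : φ ≠ 0) (hL : φ ∈ spinorLine J) : spinorLine J = Submodule.span ℂ {φ} := by
  obtain ⟨ι, _, _, e, f, hef⟩ := hJ.exists_dual_bases
  let L' := Module.End.eigenspace (J.baseChange ℂ) (-Complex.I)
  let a : ι → End ℂ (Forms V) := fun i => clifford (e i : ℂ ⊗[ℝ] GenTangent V)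
  let b : ι → End ℂ (Forms V) := fun i => clifford (f i : ℂ ⊗[ℝ] GenTangent V)
  have hab : ∀ i j, a i * b j + b j * a i = if i = j then 1 else 0 := by
    intro i j
    refine LinearMap.ext fun x => ?_
    refine (clifford_anticomm _ _ _).trans ?_
    rw [hef]
    split <;> simp
  have hbb : ∀ i j, b i * b j + b j * b i = 0 := by
    intro i j
    refine LinearMap.ext fun x => (clifford_anticomm _ _ _).trans ?_
    rw [hJ.isotropic_eigenspace (z := -Complex.I) (by simp) _ (f i).2 _ (f j).2]
    simp
  let S : Submodule ℂ (Forms V) := sInf {S | φ ∈ S ∧ ∀ i, ∀ x ∈ S, b i x ∈ S}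
  have hφS : φ ∈ S := Submodule.mem_sInf.2 fun T hT => hT.1
  have hbS : ∀ i, ∀ x ∈ S, b i x ∈ S := fun i x hx =>
    Submodule.mem_sInf.2 fun T hT => hT.2 i x (Submodule.mem_sInf.1 hx T hT)
  have haφ : ∀ ψ ∈ spinorLine J, ∀ i, a i ψ = 0 := fun ψ h i => h _ (e i).2
  have haS : ∀ i, ∀ x ∈ S, a i x ∈ S := by
    intro i x hx
    -- By `a i * b j = δ - b j * a i` this subspace is again stable under all `b j`, and it contains
    -- `φ`; minimality of `S` gives `S ≤ T`.
    let T : Submodule ℂ (Forms V) := S ⊓ S.comap (a i)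
    have hT : T ∈ {S : Submodule ℂ (Forms V) | φ ∈ S ∧ ∀ i, ∀ x ∈ S, b i x ∈ S} := by
      refine ⟨⟨hφS, ?_⟩, fun j y hy => ⟨hbS j y hy.1, ?_⟩⟩
      · change a i φ ∈ S
        rw [haφ φ hL i]
        exact zero_mem _
      · change a i (b j y) ∈ S
        have h : a i (b j y) = (if i = j then (1 : End ℂ (Forms V)) else 0) y - b j (a i y) := by
          rw [← hab i j]
          simp
        rw [h]
        refine sub_mem ?_ (hbS j _ hy.2)
        split
        exacts [hy.1, zero_mem _]
    exact (Submodule.mem_sInf.1 hx T hT).2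
  have hclS : ∀ w, ∀ x ∈ S, clifford w x ∈ S := by
    intro w x hx
    obtain ⟨l, hl, l', hl', rfl⟩ := hJ.exists_add w
    rw [map_add, LinearMap.add_apply]
    refine add_mem ?_ ?_
    · have h1 := congrArg (Submodule.subtype _) (e.sum_repr ⟨l, hl⟩)
      rw [map_sum] at h1
      change _ = l at h1
      rw [← h1, map_sum, LinearMap.sum_apply]
      refine Submodule.sum_mem _ fun i _ => ?_
      rw [map_smul, map_smul, LinearMap.smul_apply]
      exact S.smul_mem _ (haS i x hx)
    · have h1 := congrArg (Submodule.subtype _) (f.sum_repr ⟨l', hl'⟩)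
      rw [map_sum] at h1
      change _ = l' at h1
      rw [← h1, map_sum, LinearMap.sum_apply]
      refine Submodule.sum_mem _ fun i _ => ?_
      rw [map_smul, map_smul, LinearMap.smul_apply]
      exact S.smul_mem _ (hbS i x hx)
  have htop : S = ⊤ := by
    let v := Module.finBasis ℝ V
    refine ExteriorAlgebra.eq_top_of_stable (v.dualBasis.baseChange ℂ) hφ hφS
      (fun i x hx => ?_) fun i x hx => ?_
    · have h := hclS ((1 : ℂ) ⊗ₜ[ℝ] (v i, 0)) x hx
      rw [clifford_tmul, one_smul, cliffordReal_apply] at h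
      rw [coord_baseChange_dualBasis]
      simp only [oneForm, TensorProduct.tmul_zero, map_zero, zero_mul, add_zero] at h
      exact h
    · have h := hclS ((1 : ℂ) ⊗ₜ[ℝ] (0, v.dualBasis i)) x hx
      rw [clifford_tmul, one_smul, cliffordReal_apply] at h
      have h0 : interiorProd (0 : V) x = 0 := by
        have : evalAt (0 : V) = 0 := by ext; simp [evalAt]
        simp [interiorProd, this]
      rw [h0, zero_add] at h
      rwa [Basis.baseChange_apply]
  have hle : S ≤ Submodule.span ℂ {φ} ⊔ ⨆ i, LinearMap.range (b i) := by
    refine sInf_le ⟨Submodule.mem_sup_left (Submodule.mem_span_singleton_self φ), fun i x _ => ?_⟩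
    exact Submodule.mem_sup_right (Submodule.mem_iSup_of_mem i ⟨x, rfl⟩)
  refine le_antisymm (fun ψ hψ => ?_) ((Submodule.span_singleton_le_iff_mem _ _).2 hL)
  have hψS : ψ ∈ Submodule.span ℂ {φ} ⊔ ⨆ i, LinearMap.range (b i) := hle (htop ▸ trivial)
  obtain ⟨y, hy, z, hz, hyz⟩ := Submodule.mem_sup.1 hψS
  obtain ⟨c, rfl⟩ := Submodule.mem_span_singleton.1 hy
  obtain ⟨c', hc'⟩ := exists_eq_smul_of_annihilated hab hbb (haφ φ hL) (haφ ψ hψ)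
    ⟨c, by rw [← hyz, add_sub_cancel_left]; exact hz⟩
  exact Submodule.mem_span_singleton.2 ⟨c', hc'.symm⟩

/-- The anticommutator of two annihilators of `φ` is a scalar that kills `φ`. -/
lemma isIsotropic_nullSpace {φ : Forms V} (hφ : φ ≠ 0) : IsIsotropic (nullSpace φ) := by
  intro u hu v hv
  have hu' : clifford u φ = 0 := hu
  have hv' : clifford v φ = 0 := hv
  have h := clifford_anticomm u v φ
  rw [hu', hv', map_zero, map_zero, add_zero] at h
  simpa [hφ] using h.symm

/-- Maximality of `L` among isotropic subspaces. The `-i`-component of an element of `N` is again in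
`N`, so it is orthogonal to `L`; it is also orthogonal to its own eigenspace, hence zero. -/
lemma IsGenAlmostComplex.eq_plusEigenspace [FiniteDimensional ℝ V] (hJ : IsGenAlmostComplex J)
    {N : Submodule ℂ (ℂ ⊗[ℝ] GenTangent V)} (hN : IsIsotropic N) (h : plusEigenspace J ≤ N) :
    N = plusEigenspace J := by
  refine le_antisymm (fun u hu => ?_) h
  obtain ⟨l, hl, l', hl', rfl⟩ := hJ.exists_add u
  have hl'N : l' ∈ N := by simpa using sub_mem hu (h hl)
  have : l' = 0 := hJ.eq_zero_of_orthogonal (fun v hv => hN _ hl'N _ (h hv))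
    fun v hv => hJ.isotropic_eigenspace (z := -Complex.I) (by simp) _ hl' _ hv
  rwa [this, add_zero]

lemma IsGenAlmostComplex.nullSpace_eq [FiniteDimensional ℝ V] (hJ : IsGenAlmostComplex J) {φ : Forms V}
    (hφ : φ ≠ 0) (hL : φ ∈ spinorLine J) : nullSpace φ = plusEigenspace J :=
  hJ.eq_plusEigenspace (isIsotropic_nullSpace hφ) fun w hw => hL w hw

lemma IsGenAlmostComplex.isPureSpinor [FiniteDimensional ℝ V] (hJ : IsGenAlmostComplex J) {φ : Forms V}
    (hφ : φ ≠ 0) (hL : φ ∈ spinorLine J) : IsPureSpinor φ := by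
  refine ⟨isIsotropic_nullSpace hφ, fun N hN hle => ?_⟩
  rw [hJ.nullSpace_eq hφ hL] at hle ⊢
  exact hJ.eq_plusEigenspace hN hle

lemma eq_zero_of_conjT_mem {w : ℂ ⊗[ℝ] GenTangent V} (hw : w ∈ plusEigenspace J)
    (hw' : conjT w ∈ plusEigenspace J) : w = 0 := by
  have h1 := conjT_mem w hw
  rw [plusEigenspace, Module.End.mem_eigenspace_iff] at hw'
  rw [Module.End.mem_eigenspace_iff, hw', neg_smul, eq_neg_iff_add_eq_zero, ← two_smul ℂ,
    smul_smul, smul_eq_zero_iff_right (by simp)] at h1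
  have h2 : conjT (conjT w) = w := by
    clear hw hw' h1
    induction w using TensorProduct.induction_on with
    | zero => simp
    | add x y hx hy => simp only [map_add, hx, hy]
    | tmul z u => simp [conjT]
  rw [← h2, h1, map_zero]

/-- A form `φ` is annihilated by `L` as soon as `e · φ = i (J e) · φ` for real `e` in a spanning
set. -/
lemma mem_spinorLine_of_span {s : Set (GenTangent V)}
    (hs : Submodule.span ℝ s = ⊤) {φ : Forms V}
    (h : ∀ e ∈ s, cliffordReal e φ = Complex.I • cliffordReal (J e) φ) : φ ∈ spinorLine J := by
  have h1 : ∀ e : GenTangent V, cliffordReal e φ = Complex.I • cliffordReal (J e) φ := by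
    intro e
    have he : e ∈ Submodule.span ℝ s := hs ▸ trivial
    induction he using Submodule.span_induction with
    | mem x hx => exact h x hx
    | zero => simp
    | add x y _ _ hx hy => simp only [map_add, LinearMap.add_apply, hx, hy, smul_add]
    | smul c x _ hx => 
      simp only [map_smul, LinearMap.smul_apply, hx]
      rw [smul_comm]
  have h2 : ∀ w : ℂ ⊗[ℝ] GenTangent V,
      clifford w φ = Complex.I • clifford (J.baseChange ℂ w) φ := by
    intro w
    induction w using TensorProduct.induction_on with
    | zero => simp
    | add x y hx hy => simp only [map_add, LinearMap.add_apply, hx, hy, smul_add]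
    | tmul z u => rw [LinearMap.baseChange_tmul, clifford_tmul, clifford_tmul, h1, smul_comm]
  intro w hw
  rw [plusEigenspace, Module.End.mem_eigenspace_iff] at hw
  have h3 := h2 w
  -- On the `+i`-eigenspace the relation reads `w · φ = i · i (w · φ) = -(w · φ)`.
  rw [hw, map_smul, LinearMap.smul_apply, smul_smul, Complex.I_mul_I, neg_one_smul,
    eq_neg_iff_add_eq_zero, ← two_smul ℂ, smul_eq_zero_iff_right two_ne_zero] at h3
  exact h3

end Spinor

end GenCplx

/-! ### The explicit spinor: exponential of a two-form times a product of one-forms -/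

namespace ExteriorAlgebra

variable {K W : Type*} [Field K] [AddCommGroup W] [Module K W]

lemma commute_ι_mul_ι (a b : W) (x : ExteriorAlgebra K W) :
    Commute (ExteriorAlgebra.ι K a * ExteriorAlgebra.ι K b) x := by
  induction x using CliffordAlgebra.left_induction with
  | algebraMap r => exact (Algebra.commutes r _).symm
  | add x y hx hy => exact hx.add_right hy
  | ι_mul x m hx =>
    refine Commute.mul_right ?_ hx
    change _ * ExteriorAlgebra.ι K m = ExteriorAlgebra.ι K m * _
    rw [mul_assoc, ι_mul_ι_swap b m, mul_neg, ← mul_assoc, ι_mul_ι_swap a m, neg_mul, neg_neg,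
      mul_assoc]

lemma sq_ι_mul_ι (a b : W) :
    (ExteriorAlgebra.ι K a * ExteriorAlgebra.ι K b) ^ 2 = 0 := by
  rw [sq, ← mul_assoc, (commute_ι_mul_ι a b (ExteriorAlgebra.ι K a)).eq, ← mul_assoc,
    ExteriorAlgebra.ι_sq_zero, zero_mul, zero_mul]

lemma contr_prod_eq_zero {κ : Type*} (d : Dual K W) (Ω : κ → W) (l : List κ)
    (h : ∀ k ∈ l, d (Ω k) = 0) : contr d (l.map fun k => ExteriorAlgebra.ι K (Ω k)).prod = 0 := by
  induction l with
  | nil => exact CliffordAlgebra.contractLeft_one (0 : QuadraticForm K W) d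
  | cons k l ih =>
    rw [List.map_cons, List.prod_cons, contr_ι_mul, h k (by simp), zero_smul,
      ih fun j hj => h j (by simp [hj]), mul_zero, sub_zero]

lemma ι_mul_prod_eq_zero {κ : Type*} (Ω : κ → W) (l : List κ) {k : κ} (hk : k ∈ l) :
    ExteriorAlgebra.ι K (Ω k) * (l.map fun k => ExteriorAlgebra.ι K (Ω k)).prod = 0 := by
  induction l with
  | nil => simp at hk
  | cons j l ih =>
    rw [List.map_cons, List.prod_cons]
    rcases List.mem_cons.1 hk with rfl | hk
    · rw [← mul_assoc, ExteriorAlgebra.ι_sq_zero, zero_mul]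
    · rw [← mul_assoc, ι_mul_ι_swap, neg_mul, mul_assoc, ih hk, mul_zero, neg_zero]

end ExteriorAlgebra

/-- An operator satisfying the Leibniz rule at `ω`, applied to a truncated exponential. -/
lemma map_truncExp_mul {A : Type*} [Ring A] [Algebra ℂ A] (D : A →ₗ[ℂ] A) {ω θ : A}
    (hD : ∀ y, D (ω * y) = θ * y + ω * D y) (hc : Commute ω θ) (n : ℕ) (x : A) :
    D ((∑ k ∈ Finset.range (n + 1), ((Nat.factorial k : ℂ)⁻¹) • ω ^ k) * x) =
      θ * (∑ k ∈ Finset.range n, ((Nat.factorial k : ℂ)⁻¹) • ω ^ k) * x +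
        (∑ k ∈ Finset.range (n + 1), ((Nat.factorial k : ℂ)⁻¹) • ω ^ k) * D x := by
  have hpow : ∀ (m : ℕ) (y : A), D (ω ^ (m + 1) * y) =
      ((m + 1 : ℕ) : ℂ) • (θ * ω ^ m * y) + ω ^ (m + 1) * D y := by
    intro m
    induction m with
    | zero => intro y; simp [hD]
    | succ m ih =>
      intro y
      rw [pow_succ' ω (m + 1), mul_assoc, hD, ih]
      have h1 : ω * (θ * ω ^ m * y) = θ * ω ^ (m + 1) * y := by
        rw [← mul_assoc, ← mul_assoc, hc.eq, mul_assoc θ, ← pow_succ']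
      rw [mul_add, mul_smul_comm, h1, Nat.cast_add (m + 1) 1, add_smul, Nat.cast_one, one_smul,
        ← mul_assoc, ← mul_assoc]
      abel
  induction n with
  | zero => simp
  | succ n ih =>
    rw [Finset.sum_range_succ, add_mul, map_add, ih, smul_mul_assoc, map_smul, hpow,
      Finset.sum_range_succ _ n]
    have h2 : ((Nat.factorial (n + 1) : ℂ)⁻¹) * ((n + 1 : ℕ) : ℂ) = ((Nat.factorial n : ℂ)⁻¹) := by
      rw [Nat.factorial_succ]
      push_cast
      have : (n + 1 : ℂ) ≠ 0 := by exact_mod_cast Nat.succ_ne_zero n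
      field_simp
    rw [smul_add, smul_smul, h2]
    simp only [add_mul, mul_add, smul_mul_assoc, mul_smul_comm]
    abel

namespace GenCplx

variable {V κ : Type*} [AddCommGroup V] [Module ℝ V]
variable (B : Basis (κ ⊕ κ) ℝ V)

/-- The two-form `∑ t_k ξ_k ∧ η_k` in a basis made of pairs. -/
def pairForm (s : Finset κ) (t : κ → ℂ) : Forms V :=
  ∑ k ∈ s, t k • (oneForm (B.coord (.inl k)) * oneForm (B.coord (.inr k)))

/-- The interior product of a functional with `pairForm`. -/
def pairContr (s : Finset κ) (t : κ → ℂ) (d : Dual ℂ (ℂ ⊗[ℝ] Dual ℝ V)) : Forms V :=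
  ∑ k ∈ s, t k • (d (1 ⊗ₜ[ℝ] B.coord (.inl k)) • oneForm (B.coord (.inr k)) -
    d (1 ⊗ₜ[ℝ] B.coord (.inr k)) • oneForm (B.coord (.inl k)))

variable {B} {s : Finset κ} {t : κ → ℂ} {Ω : κ → ℂ ⊗[ℝ] Dual ℝ V} {l : List κ}

lemma commute_pairForm (x : Forms V) : Commute (pairForm B s t) x :=
  Commute.sum_left _ _ _ fun _ _ => (ExteriorAlgebra.commute_ι_mul_ι _ _ x).smul_left _

/-- The form is a sum of `s.card` commuting terms of square zero. -/
lemma pairForm_pow (n : ℕ) (hn : s.card < n) : pairForm B s t ^ n = 0 := by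
  classical
  have key : pairForm B s t ^ (s.card + 1) = 0 := by
    clear hn
    induction s using Finset.induction_on with
    | empty => simp [pairForm]
    | insert k s hk ih =>
      have h : pairForm B (insert k s) t =
          t k • (oneForm (B.coord (.inl k)) * oneForm (B.coord (.inr k))) + pairForm B s t := by
        rw [pairForm, Finset.sum_insert hk, pairForm]
      rw [h, Finset.card_insert_of_notMem hk]
      refine Commute.add_pow_eq_zero_of_add_le_succ_of_pow_eq_zero (m := 2) (n := s.card + 1)
        (commute_pairForm _).symm ?_ ih (by omega)
      rw [smul_pow, oneForm, oneForm, ExteriorAlgebra.sq_ι_mul_ι, smul_zero]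
  rw [← Nat.sub_add_cancel (Nat.succ_le_of_lt hn), pow_add, key, mul_zero]

lemma contr_pairForm_mul (d : Dual ℂ (ℂ ⊗[ℝ] Dual ℝ V)) (x : Forms V) :
    ExteriorAlgebra.contr d (pairForm B s t * x) =
      pairContr B s t d * x + pairForm B s t * ExteriorAlgebra.contr d x := by
  simp only [pairForm, pairContr, Finset.sum_mul, map_sum, ← Finset.sum_add_distrib]
  refine Finset.sum_congr rfl fun k _ => ?_
  rw [smul_mul_assoc, map_smul, smul_mul_assoc, smul_mul_assoc, ← smul_add, mul_assoc, oneForm,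
    oneForm, ExteriorAlgebra.contr_ι_mul, ExteriorAlgebra.contr_ι_mul, sub_mul, mul_sub,
    smul_mul_assoc, smul_mul_assoc, mul_smul_comm, mul_assoc]
  congr 1
  abel

/-- The component of degree zero is `1`. -/
lemma formExp_pairForm_ne_zero : formExp (pairForm B s t) ≠ 0 := by
  intro h
  have h1 := congrArg (ExteriorAlgebra.algebraMapInv (R := ℂ) (M := ℂ ⊗[ℝ] Dual ℝ V)) h
  have h2 : ExteriorAlgebra.algebraMapInv (pairForm B s t) = 0 := by
    simp [pairForm, oneForm, ExteriorAlgebra.algebraMapInv]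
  rw [formExp, map_sum, Finset.sum_range_succ', Finset.sum_eq_zero] at h1
  · simp at h1
  · intro k _
    rw [map_smul, map_pow, h2, zero_pow (Nat.succ_ne_zero k), smul_zero]

/-- A complex form in the span of one pair. -/
lemma evalAt_eq_zero_of_mem_span {k : κ} {w : ℂ ⊗[ℝ] Dual ℝ V}
    (hw : w ∈ Submodule.span ℂ {(1 : ℂ) ⊗ₜ[ℝ] B.coord (.inl k), (1 : ℂ) ⊗ₜ[ℝ] B.coord (.inr k)})
    {i : κ ⊕ κ} (h1 : i ≠ .inl k) (h2 : i ≠ .inr k) : evalAt (B i) w = 0 := by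
  obtain ⟨x, y, rfl⟩ := Submodule.mem_span_pair.1 hw
  simp [h1, h2]

lemma eq_zero_of_mem_span {k : κ} {w : ℂ ⊗[ℝ] Dual ℝ V}
    (hw : w ∈ Submodule.span ℂ {(1 : ℂ) ⊗ₜ[ℝ] B.coord (.inl k), (1 : ℂ) ⊗ₜ[ℝ] B.coord (.inr k)})
    (h1 : evalAt (B (.inl k)) w = 0) (h2 : evalAt (B (.inr k)) w = 0) : w = 0 := by
  obtain ⟨x, y, rfl⟩ := Submodule.mem_span_pair.1 hw
  simp at h1 h2
  simp [h1, h2]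

/-- Both members of a pair are scaled by the same sign, so their wedge product is invariant and the
exponential is fixed; each factor `Ω k` contributes its own sign. -/
lemma pullback_spinor {f : V →ₗ[ℝ] V} {σ : κ → ℝ} (hσ : ∀ k, σ k * σ k = 1)
    (h1 : ∀ k, f.dualMap (B.coord (.inl k)) = σ k • B.coord (.inl k))
    (h2 : ∀ k, f.dualMap (B.coord (.inr k)) = σ k • B.coord (.inr k))
    (hmem : ∀ k ∈ l, Ω k ∈ Submodule.span ℂ
      {(1 : ℂ) ⊗ₜ[ℝ] B.coord (.inl k), (1 : ℂ) ⊗ₜ[ℝ] B.coord (.inr k)}) :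
    pullback f (formExp (pairForm B s t) * (l.map fun k => ExteriorAlgebra.ι ℂ (Ω k)).prod) =
      ((l.map fun k => (σ k : ℂ)).prod) •
        (formExp (pairForm B s t) * (l.map fun k => ExteriorAlgebra.ι ℂ (Ω k)).prod) := by
  have hsm : ∀ (r : ℝ) (ξ : Dual ℝ V), (1 : ℂ) ⊗ₜ[ℝ] (r • ξ) = (r : ℂ) • ((1 : ℂ) ⊗ₜ[ℝ] ξ) := by
    intro r ξ
    rw [TensorProduct.tmul_smul, TensorProduct.smul_tmul', TensorProduct.smul_tmul']
    simp
  set g := ExteriorAlgebra.map (f.dualMap.baseChange ℂ) with hg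
  have ho : ∀ (r : ℝ) (ξ : Dual ℝ V), f.dualMap ξ = r • ξ →
      g (oneForm ξ) = (r : ℂ) • oneForm ξ := by
    intro r ξ h
    rw [hg, oneForm, ExteriorAlgebra.map_apply_ι, LinearMap.baseChange_tmul, h, hsm, map_smul]
  have hp : g (pairForm B s t) = pairForm B s t := by
    rw [pairForm, map_sum]
    refine Finset.sum_congr rfl fun k _ => ?_
    rw [map_smul, map_mul, ho _ _ (h1 k), ho _ _ (h2 k), smul_mul_smul_comm, ← Complex.ofReal_mul,
      hσ, Complex.ofReal_one, one_smul]
  have he : g (formExp (pairForm B s t)) = formExp (pairForm B s t) := by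
    rw [formExp, map_sum]
    exact Finset.sum_congr rfl fun k _ => by rw [map_smul, map_pow, hp]
  change g _ = _
  rw [map_mul, he, ← mul_smul_comm]
  congr 1
  induction l with
  | nil => simp
  | cons k l ih =>
    have hk : g (ExteriorAlgebra.ι ℂ (Ω k)) = (σ k : ℂ) • ExteriorAlgebra.ι ℂ (Ω k) := by
      obtain ⟨x, y, hxy⟩ := Submodule.mem_span_pair.1 (hmem k (by simp))
      rw [hg, ExteriorAlgebra.map_apply_ι, ← map_smul, ← hxy, map_add, map_smul, map_smul,
        LinearMap.baseChange_tmul, LinearMap.baseChange_tmul, h1, h2, hsm, hsm, smul_add,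
        smul_comm x, smul_comm y]
    rw [List.map_cons, List.map_cons, List.prod_cons, List.prod_cons, map_mul, hk,
      ih fun j hj => hmem j (by simp [hj]), smul_mul_smul_comm]

lemma ι_mul_spinor {k : κ} (hk : k ∈ l) :
    ExteriorAlgebra.ι ℂ (Ω k) * (formExp (pairForm B s t) *
        (l.map fun k => ExteriorAlgebra.ι ℂ (Ω k)).prod) = 0 := by
  have h : Commute (formExp (pairForm B s t)) (ExteriorAlgebra.ι ℂ (Ω k)) :=
    Commute.sum_left _ _ _ fun _ _ => ((commute_pairForm _).pow_left _).smul_left _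
  rw [← mul_assoc, ← h.eq, mul_assoc, ExteriorAlgebra.ι_mul_prod_eq_zero Ω l hk, mul_zero]

variable [Fintype κ]

lemma contr_formExp_mul (d : Dual ℂ (ℂ ⊗[ℝ] Dual ℝ V)) (x : Forms V) :
    ExteriorAlgebra.contr d (formExp (pairForm B s t) * x) =
      pairContr B s t d * (formExp (pairForm B s t) * x) +
        formExp (pairForm B s t) * ExteriorAlgebra.contr d x := by
  have h := map_truncExp_mul (ExteriorAlgebra.contr d) (contr_pairForm_mul (B := B) (s := s)
    (t := t) d) (commute_pairForm _) (finrank ℝ V) x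
  rw [formExp, h, ← mul_assoc]
  congr 2
  rw [Finset.sum_range_succ]
  -- Differentiating the truncated exponential loses its top term, of exponent `finrank ℝ V = 2
  -- |κ|`. For nonempty `s` this exponent exceeds `s.card` and the term is zero; for empty `s` the
  -- factor `pairContr` is zero.
  rcases s.eq_empty_or_nonempty with rfl | hs
  · simp [pairContr]
  · have hfin : finrank ℝ V = Fintype.card κ + Fintype.card κ := by
      rw [finrank_eq_card_basis B, Fintype.card_sum]
    have h1 : s.card ≤ Fintype.card κ := Finset.card_le_univ s
    have h2 := hs.card_pos
    rw [pairForm_pow (finrank ℝ V) (by omega), smul_zero, add_zero]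

lemma contr_spinor (d : Dual ℂ (ℂ ⊗[ℝ] Dual ℝ V)) (hd : ∀ k ∈ l, d (Ω k) = 0) :
    ExteriorAlgebra.contr d (formExp (pairForm B s t) *
        (l.map fun k => ExteriorAlgebra.ι ℂ (Ω k)).prod) =
      pairContr B s t d * (formExp (pairForm B s t) *
        (l.map fun k => ExteriorAlgebra.ι ℂ (Ω k)).prod) := by
  rw [contr_formExp_mul, ExteriorAlgebra.contr_prod_eq_zero d Ω l hd, mul_zero, add_zero]

/-- Induction on the one-form factors: contracting with a basis vector of the pair `k` on which `Ω
k` does not vanish removes `Ω k` up to a nonzero scalar and touches neither the exponential nor the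
other factors. In the end the exponential alone remains. -/
lemma spinor_ne_zero (hl : l.Nodup) (hdisj : ∀ k ∈ l, k ∉ s)
    (hmem : ∀ k ∈ l, Ω k ∈ Submodule.span ℂ
      {(1 : ℂ) ⊗ₜ[ℝ] B.coord (.inl k), (1 : ℂ) ⊗ₜ[ℝ] B.coord (.inr k)})
    (hne : ∀ k ∈ l, Ω k ≠ 0) :
    formExp (pairForm B s t) * (l.map fun k => ExteriorAlgebra.ι ℂ (Ω k)).prod ≠ 0 := by
  induction l with
  | nil => simpa using formExp_pairForm_ne_zero
  | cons k l ih =>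
    rw [List.nodup_cons] at hl
    have ih' := ih hl.2 (fun j hj => hdisj j (by simp [hj])) (fun j hj => hmem j (by simp [hj]))
      fun j hj => hne j (by simp [hj])
    obtain ⟨i, hi, hi0⟩ : ∃ i : κ ⊕ κ, (i = .inl k ∨ i = .inr k) ∧ evalAt (B i) (Ω k) ≠ 0 := by
      by_contra! h
      exact hne k (by simp) (eq_zero_of_mem_span (hmem k (by simp)) (h _ (Or.inl rfl))
        (h _ (Or.inr rfl)))
    have hother : ∀ j, j ≠ k → i ≠ .inl j ∧ i ≠ .inr j := by
      rintro j hj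
      rcases hi with rfl | rfl <;> simp [hj.symm]
    intro h0
    have h := congrArg (ExteriorAlgebra.contr (evalAt (B i))) h0
    have hpc : pairContr B s t (evalAt (B i)) = 0 := by
      refine Finset.sum_eq_zero fun j hj => ?_
      have hjk : j ≠ k := by rintro rfl; exact hdisj _ (by simp) hj
      simp [(hother j hjk).1, (hother j hjk).2]
    rw [map_zero, contr_formExp_mul, hpc, zero_mul, zero_add, List.map_cons, List.prod_cons,
      ExteriorAlgebra.contr_ι_mul, ExteriorAlgebra.contr_prod_eq_zero, mul_zero, sub_zero,
      mul_smul_comm, smul_eq_zero_iff_right hi0] at h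
    · exact ih' h
    · intro j hj
      have hjk : j ≠ k := by rintro rfl; exact hl.1 hj
      exact evalAt_eq_zero_of_mem_span (hmem j (by simp [hj])) (hother j hjk).1 (hother j hjk).2

variable {J : GenTangent V →ₗ[ℝ] GenTangent V}

/-- The explicit spinor is annihilated by the `+i`-eigenspace of `J`. -/
lemma spinor_mem_spinorLine {a x y p c : κ → ℝ}
    (hl : ∀ k, k ∈ l ↔ k ∉ s)
    (hnc : ∀ k ∈ s, a k ^ 2 = x k * y k - 1 ∧
      J (B (.inl k), 0) = (a k • B (.inl k), y k • B.coord (.inr k)) ∧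
      J (B (.inr k), 0) = (a k • B (.inr k), -y k • B.coord (.inl k)) ∧
      J (0, B.coord (.inl k)) = (x k • B (.inr k), -a k • B.coord (.inl k)) ∧
      J (0, B.coord (.inr k)) = (-x k • B (.inl k), -a k • B.coord (.inr k)))
    (hc : ∀ k ∉ s, c k ≠ 0 ∧
      J (B (.inl k), 0) = (p k • B (.inl k) + c k • B (.inr k), 0) ∧
      J (B (.inr k), 0) = (-((1 + p k ^ 2) / c k) • B (.inl k) - p k • B (.inr k), 0) ∧
      J (0, B.coord (.inl k)) =
        (0, -p k • B.coord (.inl k) + ((1 + p k ^ 2) / c k) • B.coord (.inr k)) ∧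
      J (0, B.coord (.inr k)) = (0, -c k • B.coord (.inl k) + p k • B.coord (.inr k)))
    {z : κ → ℂ}
    (hΩ : ∀ k ∉ s, z k ≠ 0 ∧ Ω k = z k • (-(c k : ℂ) • ((1 : ℂ) ⊗ₜ[ℝ] B.coord (.inl k)) +
          ((p k : ℂ) + Complex.I) • ((1 : ℂ) ⊗ₜ[ℝ] B.coord (.inr k))))
    (ht : ∀ k ∈ s, t k = (-(a k / x k) : ℝ) + Complex.I * (1 / x k : ℝ)) :
    formExp (pairForm B s t) * (l.map fun k => ExteriorAlgebra.ι ℂ (Ω k)).prod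
      ∈ spinorLine J := by
  classical
  set φ := formExp (pairForm B s t) * (l.map fun k => ExteriorAlgebra.ι ℂ (Ω k)).prod with hφ
  have hspan : Submodule.span ℝ
      ((Set.range fun i => ((B i, 0) : GenTangent V)) ∪
        Set.range fun i => ((0, B.coord i) : GenTangent V)) = ⊤ := by
    rw [eq_top_iff]
    rintro ⟨v, ξ⟩ -
    have h1 : ((v, ξ) : GenTangent V) = ∑ i, B.repr v i • ((B i, 0) : GenTangent V) +
        ∑ i, ξ (B i) • ((0, B.coord i) : GenTangent V) := by
      refine Prod.ext ?_ ?_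
      · simp [Prod.fst_sum, B.sum_repr, -Fintype.sum_sum_type]
      · refine B.ext fun j => ?_
        simp [Prod.snd_sum, -Fintype.sum_sum_type]
    rw [h1]
    refine add_mem (Submodule.sum_mem _ fun i _ => Submodule.smul_mem _ _ ?_)
      (Submodule.sum_mem _ fun i _ => Submodule.smul_mem _ _ ?_)
    · exact Submodule.subset_span (Or.inl ⟨i, rfl⟩)
    · exact Submodule.subset_span (Or.inr ⟨i, rfl⟩)
  have hsp : ∀ k ∉ s, Ω k ∈ Submodule.span ℂ
      {(1 : ℂ) ⊗ₜ[ℝ] B.coord (.inl k), (1 : ℂ) ⊗ₜ[ℝ] B.coord (.inr k)} := by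
    intro k hk
    rw [(hΩ k hk).2]
    exact Submodule.smul_mem _ _ (Submodule.mem_span_pair.2 ⟨_, _, rfl⟩)
  have hz : interiorProd (0 : V) φ = 0 := by
    have : evalAt (0 : V) = 0 := by ext; simp [evalAt]
    simp [interiorProd, this]
  have hv : ∀ X : V, cliffordReal (X, 0) φ = interiorProd X φ := by
    intro X; simp [cliffordReal_apply, oneForm]
  have hf : ∀ ξ : Dual ℝ V, cliffordReal (0, ξ) φ = oneForm ξ * φ := by
    intro ξ; simp [cliffordReal_apply, hz]
  have hsplit : ∀ (X : V) (ξ : Dual ℝ V),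
      cliffordReal (X, ξ) φ = interiorProd X φ + oneForm ξ * φ := fun _ _ => rfl
  have hI : ∀ (X : V), interiorProd X φ = ExteriorAlgebra.contr (evalAt X) φ := fun _ => rfl
  have hadd : ∀ X Y : V, interiorProd (X + Y) φ = interiorProd X φ + interiorProd Y φ := by
    intro X Y; rw [← hv, ← hv, ← hv, ← LinearMap.add_apply, ← map_add]; simp
  have hsmul : ∀ (r : ℝ) (X : V), interiorProd (r • X) φ = (r : ℂ) • interiorProd X φ := by
    intro r X
    rw [← hv, ← hv, Complex.coe_smul, ← LinearMap.smul_apply, ← map_smul]; simp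
  have hoadd : ∀ ξ η : Dual ℝ V, (oneForm (ξ + η) : Forms V) = oneForm ξ + oneForm η := by
    intro ξ η; simp [oneForm, TensorProduct.tmul_add]
  have hosmul : ∀ (r : ℝ) (ξ : Dual ℝ V), (oneForm (r • ξ) : Forms V) = (r : ℂ) • oneForm ξ := by
    intro r ξ
    rw [oneForm, oneForm, ← map_smul, TensorProduct.tmul_smul, TensorProduct.smul_tmul',
      TensorProduct.smul_tmul']
    simp
  have hinl : ∀ k ∈ s, interiorProd (B (.inl k)) φ = t k • (oneForm (B.coord (.inr k)) * φ) := by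
    intro k hk
    rw [hI, hφ, contr_spinor, pairContr, Finset.sum_eq_single k]
    · simp
    · intro j _ hj
      simp [hj.symm]
    · exact fun h => absurd hk h
    · intro j hj
      have hjk : k ≠ j := by rintro rfl; exact (hl k).1 hj hk
      exact evalAt_eq_zero_of_mem_span (hsp j ((hl j).1 hj)) (by simpa using hjk) (by simp)
  have hinr : ∀ k ∈ s, interiorProd (B (.inr k)) φ = -(t k • (oneForm (B.coord (.inl k)) * φ)) := by
    intro k hk
    rw [hI, hφ, contr_spinor, pairContr, Finset.sum_eq_single k]
    · simp
    · intro j _ hj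
      simp [hj.symm]
    · exact fun h => absurd hk h
    · intro j hj
      have hjk : k ≠ j := by rintro rfl; exact (hl k).1 hj hk
      exact evalAt_eq_zero_of_mem_span (hsp j ((hl j).1 hj)) (by simp) (by simpa using hjk)
  have hcv : ∀ k ∉ s, interiorProd (B (.inr k)) φ =
      (-(((p k : ℂ) + Complex.I) / c k)) • interiorProd (B (.inl k)) φ := by
    intro k hk
    have hc0 : (c k : ℂ) ≠ 0 := by exact_mod_cast (hc k hk).1
    -- This combination kills `Ω k`, and it vanishes on all other pairs, so its contraction kills
    -- the spinor. It expresses one interior product through the other.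
    let d : Dual ℂ (ℂ ⊗[ℝ] Dual ℝ V) := evalAt (B (.inr k)) +
      (((p k : ℂ) + Complex.I) / c k) • evalAt (B (.inl k))
    have hd : ExteriorAlgebra.contr d φ = 0 := by
      rw [hφ, contr_spinor, pairContr, Finset.sum_eq_zero, zero_mul]
      · intro j hj
        have hjk : k ≠ j := by rintro rfl; exact hk hj
        simp [d, hjk]
      · intro j hj
        by_cases hjk : k = j
        · subst hjk
          rw [(hΩ k hk).2]
          simp [d]
          field_simp
          ring
        · change evalAt (B (.inr k)) (Ω j) +
            (((p k : ℂ) + Complex.I) / c k) • evalAt (B (.inl k)) (Ω j) = 0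
          rw [evalAt_eq_zero_of_mem_span (hsp j ((hl j).1 hj)) (by simp) (by simpa using hjk),
            evalAt_eq_zero_of_mem_span (hsp j ((hl j).1 hj)) (by simpa using hjk) (by simp)]
          simp
    rw [ExteriorAlgebra.contr, map_add, map_smul] at hd
    rw [neg_smul, ← add_eq_zero_iff_eq_neg]
    exact hd
  have hcf : ∀ k ∉ s, oneForm (B.coord (.inl k)) * φ =
      (((p k : ℂ) + Complex.I) / c k) • (oneForm (B.coord (.inr k)) * φ) := by
    intro k hk
    have hc0 : (c k : ℂ) ≠ 0 := by exact_mod_cast (hc k hk).1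
    have h := ι_mul_spinor (B := B) (s := s) (t := t) (Ω := Ω) ((hl k).2 hk)
    rw [← hφ, (hΩ k hk).2, map_smul, smul_mul_assoc, smul_eq_zero_iff_right (hΩ k hk).1, map_add,
      map_smul, map_smul, add_mul, smul_mul_assoc, smul_mul_assoc, neg_smul, neg_add_eq_zero] at h
    rw [div_eq_inv_mul, mul_smul, eq_inv_smul_iff₀ hc0]
    exact h
  refine mem_spinorLine_of_span hspan ?_
  have hII := Complex.I_mul_I
  -- Eight cases: four kinds of basis element, each of noncomplex or complex type. The relations
  -- above leave a scalar identity over one generator, which follows from `i² = -1` and, in the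
  -- noncomplex case on vectors, from `a² = x y - 1`; that equation also forces `x ≠ 0`.
  rintro _ (⟨i | i, rfl⟩ | ⟨i | i, rfl⟩) <;> by_cases hk : i ∈ s
  all_goals dsimp only
  · obtain ⟨h0, h1, -, -, -⟩ := hnc i hk
    have hx : (x i : ℂ) ≠ 0 := by
      intro h; rw [Complex.ofReal_eq_zero.1 h] at h0; nlinarith [sq_nonneg (a i)]
    have h0' : (a i : ℂ) ^ 2 = x i * y i - 1 := by exact_mod_cast h0
    rw [h1, hv, hsplit, hsmul, hosmul, hinl i hk, ht i hk]
    push_cast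
    rw [smul_mul_assoc]
    match_scalars
    field_simp
    linear_combination Complex.I * h0' - (a i : ℂ) * hII
  · obtain ⟨hc0, h1, -, -, -⟩ := hc i hk
    have hc0 : (c i : ℂ) ≠ 0 := by exact_mod_cast hc0
    rw [h1, hv, hv, hadd, hsmul, hsmul, hcv i hk]
    match_scalars
    field_simp
    linear_combination hII
  · obtain ⟨h0, -, h1, -, -⟩ := hnc i hk
    have hx : (x i : ℂ) ≠ 0 := by
      intro h; rw [Complex.ofReal_eq_zero.1 h] at h0; nlinarith [sq_nonneg (a i)]
    have h0' : (a i : ℂ) ^ 2 = x i * y i - 1 := by exact_mod_cast h0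
    rw [h1, hv, hsplit, hsmul, hosmul, hinr i hk, ht i hk]
    push_cast
    rw [smul_mul_assoc]
    match_scalars
    field_simp
    linear_combination (-Complex.I) * h0' + (a i : ℂ) * hII
  · obtain ⟨hc0, -, h1, -, -⟩ := hc i hk
    have hc0 : (c i : ℂ) ≠ 0 := by exact_mod_cast hc0
    rw [h1, hv, hv, sub_eq_add_neg, ← neg_smul, hadd, hsmul, hsmul, hcv i hk]
    push_cast
    match_scalars
    field_simp
    linear_combination -(p i : ℂ) * hII
  · obtain ⟨h0, -, -, h1, -⟩ := hnc i hk
    have hx : (x i : ℂ) ≠ 0 := by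
      intro h; rw [Complex.ofReal_eq_zero.1 h] at h0; nlinarith [sq_nonneg (a i)]
    rw [h1, hf, hsplit, hsmul, hosmul, hinr i hk, ht i hk]
    push_cast
    rw [smul_mul_assoc]
    match_scalars
    field_simp
    linear_combination hII
  · obtain ⟨hc0, -, -, h1, -⟩ := hc i hk
    have hc0 : (c i : ℂ) ≠ 0 := by exact_mod_cast hc0
    rw [h1, hf, hf, hoadd, hosmul, hosmul, add_mul, smul_mul_assoc, smul_mul_assoc, hcf i hk]
    push_cast
    match_scalars
    field_simp
    linear_combination (p i : ℂ) * hII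
  · obtain ⟨h0, -, -, -, h1⟩ := hnc i hk
    have hx : (x i : ℂ) ≠ 0 := by
      intro h; rw [Complex.ofReal_eq_zero.1 h] at h0; nlinarith [sq_nonneg (a i)]
    rw [h1, hf, hsplit, hsmul, hosmul, hinl i hk, ht i hk]
    push_cast
    rw [smul_mul_assoc]
    match_scalars
    field_simp
    linear_combination hII
  · obtain ⟨hc0, -, -, -, h1⟩ := hc i hk
    have hc0 : (c i : ℂ) ≠ 0 := by exact_mod_cast hc0
    rw [h1, hf, hf, hoadd, hosmul, hosmul, add_mul, smul_mul_assoc, smul_mul_assoc, hcf i hk]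
    push_cast
    match_scalars
    field_simp
    linear_combination hII

end GenCplx

/-! ### Exponentials of endomorphisms -/

section EndExp

variable {V : Type*} [AddCommGroup V] [Module ℝ V] [FiniteDimensional ℝ V] {f : V →ₗ[ℝ] V}

/-- Testing against functionals reduces statements on `endExp` to real power series; a norm is
needed on matrices only. -/
lemma hasSum_endExp (f : V →ₗ[ℝ] V) (l : Dual ℝ V) (v : V) :
    HasSum (fun n : ℕ => ((n.factorial : ℝ)⁻¹) * l ((f ^ n) v)) (l (endExp f v)) := by
  let _ : NormedRing (Matrix (Fin (finrank ℝ V)) (Fin (finrank ℝ V)) ℝ) :=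
    Matrix.linftyOpNormedRing
  let _ : NormedAlgebra ℝ (Matrix (Fin (finrank ℝ V)) (Fin (finrank ℝ V)) ℝ) :=
    Matrix.linftyOpNormedAlgebra
  set b := finBasis ℝ V
  let T : Matrix (Fin (finrank ℝ V)) (Fin (finrank ℝ V)) ℝ →ₗ[ℝ] ℝ :=
    l ∘ₗ LinearMap.applyₗ v ∘ₗ (Matrix.toLin b b).toLinearMap
  have h := NormedSpace.exp_series_hasSum_exp' (𝕂 := ℝ) (LinearMap.toMatrix b b f)
  have h2 := h.map T (LinearMap.continuous_of_finiteDimensional T)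
  refine Eq.mpr ?_ h2
  congr 1
  funext n
  change _ = l (Matrix.toLin b b ((n.factorial : ℝ)⁻¹ • (LinearMap.toMatrix b b f) ^ n) v)
  have h3 : (LinearMap.toMatrix b b f) ^ n = LinearMap.toMatrix b b (f ^ n) :=
    (map_pow (LinearMap.toMatrixAlgEquiv b) f n).symm
  rw [h3, map_smul, Matrix.toLin_toMatrix]
  simp

lemma eq_of_forall_dual {x y : V} (h : ∀ l : Dual ℝ V, l x = l y) : x = y := by
  rw [← sub_eq_zero]
  refine (Module.forall_dual_apply_eq_zero_iff ℝ _).1 fun l => ?_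
  rw [map_sub, h, sub_self]

lemma endExp_mem {U : Submodule ℝ V} (hU : ∀ x ∈ U, f x ∈ U) {v : V} (hv : v ∈ U) :
    endExp f v ∈ U := by
  by_contra hn
  obtain ⟨l, hl, hlU⟩ := Submodule.exists_le_ker_of_notMem hn
  have hpow : ∀ n : ℕ, (f ^ n) v ∈ U := by
    intro n
    induction n with
    | zero => simpa using hv
    | succ n ih => rw [pow_succ']; exact hU _ ih
  have h := hasSum_endExp f l v
  have h0 : (fun n : ℕ => ((n.factorial : ℝ)⁻¹) * l ((f ^ n) v)) = fun _ => 0 := by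
    funext n
    rw [LinearMap.mem_ker.1 (hlU (hpow n)), mul_zero]
  rw [h0] at h
  exact hl (h.unique hasSum_zero)

lemma map_endExp {T : V →ₗ[ℝ] V} (hT : ∀ x, T (f x) = f (T x)) (v : V) :
    T (endExp f v) = endExp f (T v) := by
  refine eq_of_forall_dual fun l => ?_
  have hpow : ∀ n : ℕ, T ((f ^ n) v) = (f ^ n) (T v) := by
    intro n
    induction n with
    | zero => simp
    | succ n ih => rw [pow_succ', Module.End.mul_apply, hT, ih, Module.End.mul_apply]
  have h1 := hasSum_endExp f (l ∘ₗ T) v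
  have h2 := hasSum_endExp f l (T v)
  simp only [LinearMap.comp_apply, hpow] at h1
  exact h1.unique h2

lemma endExp_apply_of_eq_zero {v : V} (h : f v = 0) : endExp f v = v := by
  refine eq_of_forall_dual fun l => ?_
  refine (hasSum_endExp f l v).unique ?_
  convert hasSum_single (f := fun n : ℕ => ((n.factorial : ℝ)⁻¹) * l ((f ^ n) v)) 0 ?_ using 1
  · simp
  · intro n hn
    obtain ⟨m, rfl⟩ := Nat.exists_eq_succ_of_ne_zero hn
    simp [pow_succ, h]

/-- On the span of `v` and `f v` the operator generates a rotation: the even powers sum to the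
cosine and the odd ones to the sine. -/
lemma endExp_apply_of_sq {v : V} {c : ℝ} (hc : c ≠ 0) (h : f (f v) = -(c ^ 2) • v) :
    endExp f v = Real.cos c • v + (Real.sin c / c) • f v := by
  refine eq_of_forall_dual fun l => ?_
  refine (hasSum_endExp f l v).unique ?_
  have hev : ∀ (n : ℕ), (f ^ (2 * n)) v = ((-1) ^ n * c ^ (2 * n)) • v := by
    intro n
    induction n with
    | zero => simp
    | succ n ih =>
      rw [show 2 * (n + 1) = 2 + 2 * n by ring, pow_add, Module.End.mul_apply, ih, map_smul, pow_two,
        Module.End.mul_apply, h, smul_smul]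
      congr 1
      ring
  rw [map_add, map_smul, map_smul]
  refine HasSum.even_add_odd ?_ ?_
  · have h1 := (Real.hasSum_cos c).mul_right (l v)
    refine Eq.mpr ?_ h1
    congr 1
    funext n
    rw [hev, map_smul, smul_eq_mul]
    ring
  · have h1 := ((Real.hasSum_sin c).div_const c).mul_right (l (f v))
    refine Eq.mpr ?_ h1
    congr 1
    funext n
    rw [pow_succ' f, Module.End.mul_apply, hev, map_smul, map_smul, smul_eq_mul]
    field_simp
    ring

end EndExp

/-! ### The group `K` and the characters of `M` on root spaces -/

namespace RealFlag

open LieAlgebra LieAlgebra.IsKilling GenCplx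

variable {𝔤 : Type*} [LieRing 𝔤] [LieAlgebra ℝ 𝔤] [FiniteDimensional ℝ 𝔤]

section GroupK

variable {θ : 𝔤 ≃ₗ⁅ℝ⁆ 𝔤} {g : 𝔤 ≃ₗ⁅ℝ⁆ 𝔤}

lemma groupK_induction {p : (𝔤 ≃ₗ⁅ℝ⁆ 𝔤) → Prop}
    (hexp : ∀ (g : 𝔤 ≃ₗ⁅ℝ⁆ 𝔤) (X : 𝔤), θ X = X → (∀ x, g x = endExp (ad ℝ 𝔤 X) x) → p g)
    (hone : p (LieEquiv.refl)) (hmul : ∀ g h : 𝔤 ≃ₗ⁅ℝ⁆ 𝔤, p g → p h → p (h.trans g))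
    (hinv : ∀ g : 𝔤 ≃ₗ⁅ℝ⁆ 𝔤, p g → p g.symm) (hg : g ∈ groupK θ) : p g := by
  induction hg using Subgroup.closure_induction with
  | mem g hg =>
    obtain ⟨X, hX, h⟩ := hg
    exact hexp g X hX fun x => LinearMap.congr_fun h x
  | one => exact hone
  | mul g h _ _ h1 h2 => exact hmul g h h1 h2
  | inv g _ h => exact hinv g h

/-- For a generator `exp(ad X)` with `θ X = X`, the automorphism `θ` commutes with `ad X`, hence
with the exponential. -/
lemma groupK_comm (hg : g ∈ groupK θ) (x : 𝔤) : g (θ x) = θ (g x) := by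
  revert x
  refine groupK_induction (θ := θ) (p := fun g => ∀ x, g (θ x) = θ (g x)) ?_ ?_ ?_ ?_ hg
  · intro g X hX h x
    rw [h, h]
    refine (map_endExp (T := ((θ : 𝔤 →ₗ⁅ℝ⁆ 𝔤) : 𝔤 →ₗ[ℝ] 𝔤)) (fun y => ?_) x).symm
    change θ ⁅X, y⁆ = ⁅X, θ y⁆
    rw [LieEquiv.map_lie, hX]
  · exact fun x => rfl
  · intro g h hg hh x
    simp only [LieEquiv.trans_apply, hh, hg]
  · intro g hg x
    apply g.injective
    change g (g.symm (θ x)) = g (θ (g.symm x))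
    rw [hg, LieEquiv.apply_symm_apply, LieEquiv.apply_symm_apply]

/-- A subspace stable under `ad 𝔨` is stable under `K`. -/
lemma groupK_mem {U : Submodule ℝ 𝔤} (hU : ∀ X, θ X = X → ∀ x ∈ U, ⁅X, x⁆ ∈ U)
    (hg : g ∈ groupK θ) {x : 𝔤} (hx : x ∈ U) : g x ∈ U := by
  revert x
  refine groupK_induction (θ := θ) (p := fun g => ∀ {x}, x ∈ U → g x ∈ U) ?_ ?_ ?_ ?_ hg
  · intro g X hX h x hx
    rw [h]
    exact endExp_mem (f := ad ℝ 𝔤 X) (hU X hX) hx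
  · exact fun hx => hx
  · intro g h hg hh x hx
    exact hg (hh hx)
  · intro g hg x hx
    -- For inverses: `g U ≤ U` is an equality by dimension.
    have h1 : U.map (g.toLinearEquiv : 𝔤 →ₗ[ℝ] 𝔤) ≤ U := by
      rintro _ ⟨y, hy, rfl⟩
      exact hg hy
    have h2 := Submodule.eq_of_le_of_finrank_eq h1 (LinearEquiv.finrank_map_eq g.toLinearEquiv U)
    rw [← h2] at hx
    obtain ⟨y, hy, rfl⟩ := hx
    have : g.symm (g y) = y := g.symm_apply_apply y
    change g.symm (g y) ∈ U
    rwa [this]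

/-- `K` fixes the vectors centralized by `𝔨`. -/
lemma groupK_fix {z : 𝔤} (hz : ∀ X, θ X = X → ⁅X, z⁆ = 0) (hg : g ∈ groupK θ) : g z = z := by
  refine groupK_induction (θ := θ) (p := fun g => g z = z) ?_ rfl ?_ ?_ hg
  · intro g X hX h
    rw [h]
    exact endExp_apply_of_eq_zero (f := ad ℝ 𝔤 X) (hz X hX)
  · intro g h hg hh
    rw [LieEquiv.trans_apply, hh, hg]
  · intro g hg
    conv_lhs => rw [← hg]
    exact g.symm_apply_apply z

end GroupK

variable [IsKilling ℝ 𝔤]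
variable {𝔞 : LieSubalgebra ℝ 𝔤} [𝔞.IsCartanSubalgebra] [IsTriangularizable ℝ 𝔞 𝔤]
variable {θ : 𝔤 ≃ₗ⁅ℝ⁆ 𝔤}

lemma mem_rootSpace_iff {f : 𝔞 → ℝ} {x : 𝔤} :
    x ∈ rootSpace 𝔞 f ↔ ∀ h : 𝔞, ⁅(h : 𝔤), x⁆ = f h • x := by
  refine ⟨fun hx h => lie_eq_smul_of_mem_rootSpace hx h, fun hx => ?_⟩
  apply weightSpace_le_genWeightSpace
  rw [mem_weightSpace]
  exact hx

lemma rootSpace_eq_bot {f : 𝔞 → ℝ} (hf : ∀ γ : Weight ℝ 𝔞 𝔤, (γ : 𝔞 → ℝ) ≠ f) :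
    rootSpace 𝔞 f = ⊥ := by
  by_contra h
  exact hf ⟨f, h⟩ rfl

lemma linearMap_ext_rootSpace {W : Type*} [AddCommGroup W] [Module ℝ W] {F G : 𝔤 →ₗ[ℝ] W}
    (h : ∀ (γ : Weight ℝ 𝔞 𝔤), ∀ x ∈ rootSpace 𝔞 γ, F x = G x) : F = G := by
  have h1 : (⨆ γ : Weight ℝ 𝔞 𝔤, (rootSpace 𝔞 γ).toSubmodule) = ⊤ := by
    rw [← LieSubmodule.iSup_toSubmodule, iSup_genWeightSpace_eq_top' ℝ 𝔞 𝔤]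
    rfl
  have h2 : (⨆ γ : Weight ℝ 𝔞 𝔤, (rootSpace 𝔞 γ).toSubmodule) ≤ LinearMap.eqLocus F G :=
    iSup_le fun γ x hx => h γ x hx
  refine LinearMap.ext fun x => ?_
  exact h2 (h1 ▸ Submodule.mem_top)

lemma mem_cartan_of_mem_rootSpace_zero {x : 𝔤} (hx : x ∈ rootSpace 𝔞 (0 : 𝔞 → ℝ)) : x ∈ 𝔞 := by
  rw [rootSpace_zero_eq] at hx
  exact hx

lemma IsCartanInvolution.map_mem (hθ : IsCartanInvolution 𝔞 θ) {f : 𝔞 → ℝ} {x : 𝔤}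
    (hx : x ∈ rootSpace 𝔞 f) : θ x ∈ rootSpace 𝔞 (-f) := by
  rw [mem_rootSpace_iff] at hx ⊢
  intro h
  have h1 : θ ⁅(h : 𝔤), x⁆ = ⁅θ (h : 𝔤), θ x⁆ := LieEquiv.map_lie _ _ _
  rw [hx h, hθ.on_cartan _ h.2, neg_lie] at h1
  have h2 : θ (f h • x) = f h • θ x := map_smul (θ : 𝔤 →ₗ⁅ℝ⁆ 𝔤) _ _
  rw [h2] at h1
  rw [Pi.neg_apply, neg_smul, h1, neg_neg]

/-- `m` acts on the root space of `f` by the scalar `s`. -/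
def ActsBy (m : 𝔤 ≃ₗ⁅ℝ⁆ 𝔤) (f : 𝔞 → ℝ) (s : ℝ) : Prop := ∀ x ∈ rootSpace 𝔞 f, m x = s • x

lemma exists_ne_zero (α : Weight ℝ 𝔞 𝔤) : ∃ x ∈ rootSpace 𝔞 α, x ≠ 0 :=
  α.exists_ne_zero

lemma exists_eq_smul {α : Weight ℝ 𝔞 𝔤} (hα : α.IsNonZero) {x y : 𝔤} (hx : x ∈ rootSpace 𝔞 α)
    (hx0 : x ≠ 0) (hy : y ∈ rootSpace 𝔞 α) : ∃ c : ℝ, y = c • x := by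
  have h := finrank_rootSpace_eq_one α hα
  obtain ⟨c, hc⟩ := (finrank_eq_one_iff_of_nonzero' (⟨x, hx⟩ : rootSpace 𝔞 α)
    (fun h => hx0 (congrArg Subtype.val h))).1 h ⟨y, hy⟩
  exact ⟨c, (congrArg Subtype.val hc).symm⟩

lemma ActsBy.unique {m : 𝔤 ≃ₗ⁅ℝ⁆ 𝔤} {α : Weight ℝ 𝔞 𝔤} {s t : ℝ} (hs : ActsBy m α s)
    (ht : ActsBy m α t) : s = t := by
  obtain ⟨x, hx, hx0⟩ := exists_ne_zero α
  exact smul_left_injective ℝ hx0 ((hs x hx).symm.trans (ht x hx))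

/-- The root space is a line, so `m` is a scalar `s` on it. Since `m` commutes with `θ` and
preserves the Killing form, `s² ⟨x, θ x⟩ = ⟨x, θ x⟩`, and `⟨x, θ x⟩ < 0`. -/
lemma exists_actsBy (hθ : IsCartanInvolution 𝔞 θ) {m : 𝔤 ≃ₗ⁅ℝ⁆ 𝔤} (hm : m ∈ groupM 𝔞 θ)
    {α : Weight ℝ 𝔞 𝔤} (hα : α.IsNonZero) : ∃ s : ℝ, s * s = 1 ∧ ActsBy m α s := by
  obtain ⟨x, hx, hx0⟩ := exists_ne_zero α
  obtain ⟨s, hs⟩ := exists_eq_smul hα hx hx0 (groupM_map_rootSub hm α x hx)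
  refine ⟨s, ?_, fun y hy => ?_⟩
  · have h1 : killingForm ℝ 𝔤 (m x) (m (θ x)) = killingForm ℝ 𝔤 x (θ x) :=
      LieAlgebra.killingForm_of_equiv_apply m x (θ x)
    rw [groupK_comm hm.1, hs] at h1
    have h2 : θ (s • x) = s • θ x := map_smul (θ : 𝔤 →ₗ⁅ℝ⁆ 𝔤) _ _
    rw [h2, map_smul, map_smul, LinearMap.smul_apply, smul_smul, smul_eq_mul] at h1
    have h3 := hθ.neg_def x hx0
    exact mul_right_cancel₀ h3.ne (by rw [h1, one_mul])
  · obtain ⟨c, rfl⟩ := exists_eq_smul hα hx hx0 hy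
    have h2 : m (c • x) = c • m x := map_smul (m : 𝔤 →ₗ⁅ℝ⁆ 𝔤) _ _
    rw [h2, hs, smul_comm]

lemma ActsBy.neg (hθ : IsCartanInvolution 𝔞 θ) {m : 𝔤 ≃ₗ⁅ℝ⁆ 𝔤} (hm : m ∈ groupM 𝔞 θ)
    {f : 𝔞 → ℝ} {s : ℝ} (hs : ActsBy m f s) : ActsBy m (-f) s := by
  intro x hx
  have h1 := hs (θ x) (by simpa using hθ.map_mem hx)
  rw [groupK_comm hm.1] at h1
  have h2 : θ (s • x) = s • θ x := map_smul (θ : 𝔤 →ₗ⁅ℝ⁆ 𝔤) _ _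
  rw [← h2] at h1
  exact θ.injective h1

lemma killingForm_pos (hθ : IsCartanInvolution 𝔞 θ) {h : 𝔤} (hh : h ∈ 𝔞) (h0 : h ≠ 0) :
    0 < killingForm ℝ 𝔤 h h := by
  have := hθ.neg_def h h0
  rw [hθ.on_cartan h hh, map_neg] at this
  linarith

/-- In any triple `h, e, f` one has `θ e = c f`. Here `2⟨e, f⟩ = ⟨h, h⟩ > 0` and `⟨e, θ e⟩ < 0`, so
`c < 0`, and dividing `e` by `√(-c)` turns `f` into `-θ e`. -/
lemma exists_sl2Triple (hθ : IsCartanInvolution 𝔞 θ) {α : Weight ℝ 𝔞 𝔤} (hα : α.IsNonZero) :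
    ∃ e ∈ rootSpace 𝔞 α, IsSl2Triple (coroot α : 𝔤) e (-θ e) := by
  obtain ⟨h, e, f, ht, he, hf⟩ := exists_isSl2Triple_of_weight_isNonZero hα
  obtain rfl := ht.h_eq_coroot hα he hf
  have hnα : (-α).IsNonZero := hα.neg
  obtain ⟨c, hc⟩ := exists_eq_smul hnα (x := f) (y := θ e) (by simpa using hf) ht.f_ne_zero
    (by simpa using hθ.map_mem he)
  have h1 := hθ.neg_def e ht.e_ne_zero
  have h2 : 2 * killingForm ℝ 𝔤 e f = killingForm ℝ 𝔤 (coroot α : 𝔤) (coroot α : 𝔤) := by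
    have h3 := LieModule.traceForm_apply_lie_apply ℝ 𝔤 𝔤 (coroot α : 𝔤) e f
    rw [ht.lie_e_f, ht.lie_h_e_nsmul, map_nsmul, LinearMap.smul_apply] at h3
    rw [killingForm, ← h3, two_nsmul, two_mul]
  have h4 := killingForm_pos hθ (coroot α).2 ht.h_ne_zero
  rw [hc, map_smul, smul_eq_mul] at h1
  have hc0 : c < 0 := by
    by_contra hn
    push Not at hn
    nlinarith
  have hr : 0 < Real.sqrt (-c) := Real.sqrt_pos.2 (by linarith)
  have hr2 : Real.sqrt (-c) * Real.sqrt (-c) = -c := Real.mul_self_sqrt (by linarith)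
  set r := Real.sqrt (-c)
  have hθe : θ (r⁻¹ • e) = (r⁻¹ * c) • f := by
    have : θ (r⁻¹ • e) = r⁻¹ • θ e := map_smul (θ : 𝔤 →ₗ⁅ℝ⁆ 𝔤) _ _
    rw [this, hc, smul_smul]
  refine ⟨r⁻¹ • e, (rootSpace 𝔞 α).smul_mem _ he, ht.h_ne_zero, ?_, ?_, ?_⟩
  · rw [hθe, lie_neg, smul_lie, lie_smul, ht.lie_e_f, smul_smul, ← neg_smul]
    have : -(r⁻¹ * (r⁻¹ * c)) = 1 := by
      field_simp
      nlinarith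
    rw [this, one_smul]
  · rw [lie_smul, ht.lie_h_e_nsmul, smul_comm]
  · rw [hθe, lie_neg, lie_smul, ht.lie_h_f_nsmul, smul_neg, smul_neg, smul_comm]

/-- If `⟨β, α^∨⟩ < 0` then `[𝔤_α, 𝔤_β] ≠ 0`. -/
lemma lie_ne_zero_of_neg (hθ : IsCartanInvolution 𝔞 θ) {α β : Weight ℝ 𝔞 𝔤} (hα : α.IsNonZero)
    (h : β (coroot α) < 0) : ∃ e ∈ rootSpace 𝔞 α, ∃ x ∈ rootSpace 𝔞 β, ⁅e, x⁆ ≠ 0 := by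
  obtain ⟨e, he, ht⟩ := exists_sl2Triple hθ hα
  obtain ⟨x, hx, hx0⟩ := exists_ne_zero β
  refine ⟨e, he, x, hx, fun h0 => ?_⟩
  -- If `e` killed `x`, then `x` would be a highest weight vector, and its weight would be a natural
  -- number.
  have hp : ht.HasPrimitiveVectorWith x (β (coroot α)) :=
    ⟨hx0, lie_eq_smul_of_mem_rootSpace hx _, h0⟩
  obtain ⟨n, hn⟩ := hp.exists_nat
  rw [hn] at h
  exact absurd h (by simp)

/-- The negative pairing guarantees a nonzero bracket, which spans the line `𝔤_γ`; `m` is an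
automorphism. -/
lemma ActsBy.add (hθ : IsCartanInvolution 𝔞 θ) {m : 𝔤 ≃ₗ⁅ℝ⁆ 𝔤} {α β γ : Weight ℝ 𝔞 𝔤}
    (hα : α.IsNonZero) (hγ : γ.IsNonZero) (h : β (coroot α) < 0)
    (hsum : (γ : 𝔞 → ℝ) = α + β) {s t : ℝ} (hs : ActsBy m α s) (ht : ActsBy m β t) :
    ActsBy m γ (s * t) := by
  obtain ⟨e, he, x, hx, h0⟩ := lie_ne_zero_of_neg hθ hα h
  have hmem : ⁅e, x⁆ ∈ rootSpace 𝔞 γ := by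
    rw [hsum]
    exact lie_mem_genWeightSpace_of_mem_genWeightSpace he hx
  intro y hy
  obtain ⟨c, rfl⟩ := exists_eq_smul hγ hmem h0 hy
  have h2 : m (c • ⁅e, x⁆) = c • m ⁅e, x⁆ := map_smul (m : 𝔤 →ₗ⁅ℝ⁆ 𝔤) _ _
  rw [h2, LieEquiv.map_lie, hs e he, ht x hx, smul_lie, lie_smul]
  simp only [smul_smul]
  congr 1
  ring

end RealFlag

/-! ### Long roots and the elements `exp(π ad(e + θ e))` of `M` -/

namespace RealFlag

open LieAlgebra LieAlgebra.IsKilling GenCplx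

variable {𝔤 : Type*} [LieRing 𝔤] [LieAlgebra ℝ 𝔤] [FiniteDimensional ℝ 𝔤]
variable [IsKilling ℝ 𝔤]
variable {𝔞 : LieSubalgebra ℝ 𝔤} [𝔞.IsCartanSubalgebra] [IsTriangularizable ℝ 𝔞 𝔤]
variable {θ : 𝔤 ≃ₗ⁅ℝ⁆ 𝔤}

/-- A root all of whose strings through other roots have length at most two. -/
def IsLong (α : Weight ℝ 𝔞 𝔤) : Prop :=
  ∀ β : Weight ℝ 𝔞 𝔤, (β : 𝔞 → ℝ) = α ∨ (β : 𝔞 → ℝ) = -α ∨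
    β (coroot α) = 0 ∨ β (coroot α) = 1 ∨ β (coroot α) = -1

variable {α β : Weight ℝ 𝔞 𝔤} {e x : 𝔤}

/-- Source of the vanishing brackets below: there the weight of the bracket pairs to `2` or `3` with
the coroot of `α` and is not `±α`, so it is not a weight. -/
lemma IsLong.rootSpace_eq_bot (hl : IsLong α) {f : 𝔞 → ℝ} (h1 : f ≠ α) (h2 : f ≠ -α)
    (h3 : f (coroot α) ≠ 0) (h4 : f (coroot α) ≠ 1) (h5 : f (coroot α) ≠ -1) :
    rootSpace 𝔞 f = ⊥ := by
  refine RealFlag.rootSpace_eq_bot fun γ hγ => ?_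
  rw [← hγ] at h1 h2 h3 h4 h5
  rcases hl γ with h | h | h | h | h <;> contradiction

lemma lie_mem_add {f g : 𝔞 → ℝ} {x y : 𝔤} (hx : x ∈ rootSpace 𝔞 f) (hy : y ∈ rootSpace 𝔞 g) :
    ⁅x, y⁆ ∈ rootSpace 𝔞 (f + g) :=
  lie_mem_genWeightSpace_of_mem_genWeightSpace hx hy

lemma eq_zero_of_mem_bot {f : 𝔞 → ℝ} (h : rootSpace 𝔞 f = ⊥) (hx : x ∈ rootSpace 𝔞 f) : x = 0 := by
  rw [h] at hx
  exact (LieSubmodule.mem_bot x).1 hx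

lemma IsLong.lie_eq_zero_of_zero (hα : α.IsNonZero) (hl : IsLong α) (hβ : β.IsNonZero)
    (h : β (coroot α) = 0) (he : e ∈ rootSpace 𝔞 α) (hx : x ∈ rootSpace 𝔞 β) : ⁅e, x⁆ = 0 := by
  have h2 := root_apply_coroot hα
  have hval : ((α : 𝔞 → ℝ) + β) (coroot α) = 2 := by rw [Pi.add_apply, h, h2, add_zero]
  refine eq_zero_of_mem_bot (hl.rootSpace_eq_bot ?_ ?_ ?_ ?_ ?_) (lie_mem_add he hx)
  · intro h0
    exact hβ (by simpa using h0)
  · intro h0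
    have := congrFun h0 (coroot α)
    rw [hval, Pi.neg_apply, h2] at this
    norm_num at this
  all_goals rw [hval]; norm_num

lemma IsLong.lie_eq_zero_of_one (hα : α.IsNonZero) (hl : IsLong α)
    (h : β (coroot α) = 1) (he : e ∈ rootSpace 𝔞 α) (hx : x ∈ rootSpace 𝔞 β) : ⁅e, x⁆ = 0 := by
  have h2 := root_apply_coroot hα
  have hval : ((α : 𝔞 → ℝ) + β) (coroot α) = 3 := by
    rw [Pi.add_apply, h, h2]; norm_num
  refine eq_zero_of_mem_bot (hl.rootSpace_eq_bot ?_ ?_ ?_ ?_ ?_) (lie_mem_add he hx)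
  · intro h0
    have := congrFun h0 (coroot α)
    rw [hval, h2] at this
    norm_num at this
  · intro h0
    have := congrFun h0 (coroot α)
    rw [hval, Pi.neg_apply, h2] at this
    norm_num at this
  all_goals rw [hval]; norm_num

lemma IsLong.lie_lie_eq_zero_of_neg_one (hα : α.IsNonZero) (hl : IsLong α)
    (h : β (coroot α) = -1) (he : e ∈ rootSpace 𝔞 α) (hx : x ∈ rootSpace 𝔞 β) :
    ⁅e, ⁅e, x⁆⁆ = 0 := by
  have h2 := root_apply_coroot hα
  have hval : ((α : 𝔞 → ℝ) + (α + β)) (coroot α) = 3 := by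
    rw [Pi.add_apply, Pi.add_apply, h, h2]; norm_num
  refine eq_zero_of_mem_bot (hl.rootSpace_eq_bot ?_ ?_ ?_ ?_ ?_) (lie_mem_add he (lie_mem_add he hx))
  · intro h0
    have := congrFun h0 (coroot α)
    rw [hval, h2] at this
    norm_num at this
  · intro h0
    have := congrFun h0 (coroot α)
    rw [hval, Pi.neg_apply, h2] at this
    norm_num at this
  all_goals rw [hval]; norm_num

lemma IsLong.neg (hl : IsLong α) : IsLong (-α) := by
  intro β
  have h1 : β (coroot (-α)) = -β (coroot α) := by
    rw [coroot_neg]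
    exact map_neg (Weight.toLinear ℝ 𝔞 𝔤 β) _
  rw [h1, Weight.coe_neg, neg_neg, neg_eq_zero]
  rcases hl β with h | h | h | h | h
  · exact Or.inr (Or.inl h)
  · exact Or.inl h
  · exact Or.inr (Or.inr (Or.inl h))
  · exact Or.inr (Or.inr (Or.inr (Or.inr (by rw [h]))))
  · exact Or.inr (Or.inr (Or.inr (Or.inl (by rw [h, neg_neg]))))

lemma apply_coroot_neg : β (coroot (-α)) = -β (coroot α) := by
  rw [coroot_neg]
  exact map_neg (Weight.toLinear ℝ 𝔞 𝔤 β) _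

lemma lie_lie_of_sl2 (ht : IsSl2Triple (coroot α : 𝔤) e (-θ e)) (x : 𝔤) :
    ⁅e, ⁅θ e, x⁆⁆ = ⁅θ e, ⁅e, x⁆⁆ - ⁅(coroot α : 𝔤), x⁆ := by
  have h := ht.lie_e_f
  rw [lie_neg, neg_eq_iff_eq_neg] at h
  rw [leibniz_lie, h, neg_lie]
  abel

section Triple

variable (hθ : IsCartanInvolution 𝔞 θ) (hα : α.IsNonZero) (hl : IsLong α)
  (he : e ∈ rootSpace 𝔞 α) (ht : IsSl2Triple (coroot α : 𝔤) e (-θ e))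

include hθ hα hl he in
lemma lie_compact_of_zero (hβ : β.IsNonZero) (h : β (coroot α) = 0) (hx : x ∈ rootSpace 𝔞 β) :
    ⁅e + θ e, x⁆ = 0 := by
  have h1 := hl.lie_eq_zero_of_zero hα hβ h he hx
  have h2 := hl.neg.lie_eq_zero_of_zero hα.neg hβ (by rw [apply_coroot_neg, h, neg_zero])
    (hθ.map_mem he) hx
  rw [add_lie, h1, h2, add_zero]

include hθ hα hl he ht in
-- The string through `β` has length two, so `x` generates a two-dimensional representation of the
-- sl2-triple, where `e - f` has square `-1`.
lemma lie_lie_compact_of_one (h : β (coroot α) = 1 ∨ β (coroot α) = -1)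
    (hx : x ∈ rootSpace 𝔞 β) : ⁅e + θ e, ⁅e + θ e, x⁆⁆ = -x := by
  have hcx : ⁅(coroot α : 𝔤), x⁆ = β (coroot α) • x := lie_eq_smul_of_mem_rootSpace hx _
  have hll := lie_lie_of_sl2 ht x
  rcases h with h | h
  · have h1 := hl.lie_eq_zero_of_one hα h he hx
    have h2 := hl.neg.lie_lie_eq_zero_of_neg_one hα.neg (by rw [apply_coroot_neg, h])
      (hθ.map_mem he) hx
    rw [h1, lie_zero, zero_sub, hcx, h, one_smul] at hll
    rw [add_lie, add_lie, h1, zero_add, h2, hll, add_zero]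
  · have h1 := hl.neg.lie_eq_zero_of_one hα.neg (by rw [apply_coroot_neg, h, neg_neg])
      (hθ.map_mem he) hx
    have h2 := hl.lie_lie_eq_zero_of_neg_one hα h he hx
    rw [h1, lie_zero, hcx, h, neg_one_smul, sub_neg_eq_add] at hll
    rw [add_lie, add_lie, h1, add_zero, h2, zero_add]
    exact eq_neg_of_add_eq_zero_left hll.symm

include hθ he in
lemma lie_compact_cartan (x : 𝔞) : ⁅e + θ e, (x : 𝔤)⁆ = -(α x) • (e - θ e) := by
  have h1 : ⁅(x : 𝔤), e⁆ = α x • e := lie_eq_smul_of_mem_rootSpace he x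
  have h2 : ⁅(x : 𝔤), θ e⁆ = (-α x) • θ e := lie_eq_smul_of_mem_rootSpace (hθ.map_mem he) x
  rw [← lie_skew, lie_add, h1, h2]
  module

include ht in
lemma lie_compact_sub : ⁅e + θ e, e - θ e⁆ = (2 : ℝ) • (coroot α : 𝔤) := by
  have h := ht.lie_e_f
  rw [lie_neg, neg_eq_iff_eq_neg] at h
  have h' : ⁅θ e, e⁆ = (coroot α : 𝔤) := by rw [← lie_skew, h, neg_neg]
  rw [add_lie, lie_sub, lie_sub, lie_self, lie_self, h, h']
  module

include hθ hα hl he ht in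
/-- `exp (π ad (e + θ e))` acts on root spaces by the sign `(-1)^⟨f, α^∨⟩`. -/
lemma endExp_compact (γ : Weight ℝ 𝔞 𝔤) (hx : x ∈ rootSpace 𝔞 γ) :
    endExp (ad ℝ 𝔤 (Real.pi • (e + θ e))) x = Real.cos (γ (coroot α) * Real.pi) • x := by
  have had : ∀ y, ad ℝ 𝔤 (Real.pi • (e + θ e)) y = Real.pi • ⁅e + θ e, y⁆ := by
    intro y; rw [ad_apply, smul_lie]
  have h2 := root_apply_coroot hα
  -- In the adjoint representation of the triple, `e + θ e` rotates the plane of `e - θ e` and the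
  -- coroot with frequency `2`, so time `π` is a full turn there; on a string of length two it is a
  -- half turn.
  have hfour : ∀ y : 𝔤, ⁅e + θ e, ⁅e + θ e, y⁆⁆ = (-4 : ℝ) • y →
      endExp (ad ℝ 𝔤 (Real.pi • (e + θ e))) y = y := by
    intro y hy
    rw [endExp_apply_of_sq (c := 2 * Real.pi) (by positivity), Real.cos_two_pi, Real.sin_two_pi]
    · simp
    · rw [had, had, lie_smul, hy, smul_smul, smul_smul]
      congr 1
      ring
  have hsub : ⁅e + θ e, ⁅e + θ e, e - θ e⁆⁆ = (-4 : ℝ) • (e - θ e) := by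
    rw [lie_compact_sub ht, lie_smul, lie_compact_cartan hθ he, smul_smul, h2]
    norm_num
  have hhalf : ∀ T : 𝔤 →ₗ[ℝ] 𝔤, T (e + θ e) = e + θ e → T (e - θ e) = e - θ e →
      T e = e ∧ T (θ e) = θ e := by
    intro T h1 h2
    rw [map_add] at h1
    rw [map_sub] at h2
    constructor
    · have : (2 : ℝ) • T e = (2 : ℝ) • e := by
        rw [two_smul, two_smul]
        calc T e + T e = (T e + T (θ e)) + (T e - T (θ e)) := by abel
          _ = e + e := by rw [h1, h2]; abel
      exact smul_right_injective _ (two_ne_zero (α := ℝ)) this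
    · have : (2 : ℝ) • T (θ e) = (2 : ℝ) • θ e := by
        rw [two_smul, two_smul]
        calc T (θ e) + T (θ e) = (T e + T (θ e)) - (T e - T (θ e)) := by abel
          _ = θ e + θ e := by rw [h1, h2]; abel
      exact smul_right_injective _ (two_ne_zero (α := ℝ)) this
  have hplus : endExp (ad ℝ 𝔤 (Real.pi • (e + θ e))) (e + θ e) = e + θ e :=
    endExp_apply_of_eq_zero (by rw [had, lie_self, smul_zero])
  have hminus := hfour _ hsub
  by_cases hγ : γ.IsNonZero
  · rcases hl γ with h | h | h | h | h
    · obtain ⟨c, rfl⟩ := exists_eq_smul hα he ht.e_ne_zero (h ▸ hx)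
      rw [map_smul, (hhalf _ hplus hminus).1, h, h2, Real.cos_two_pi, one_smul]
    · have hx' : x ∈ rootSpace 𝔞 (-α : Weight ℝ 𝔞 𝔤) := by rw [Weight.coe_neg]; exact h ▸ hx
      have hne : θ e ≠ 0 := fun h0 => ht.f_ne_zero (by rw [h0, neg_zero])
      obtain ⟨c, rfl⟩ := exists_eq_smul hα.neg (hθ.map_mem he) hne hx'
      rw [map_smul, (hhalf _ hplus hminus).2, h, Pi.neg_apply, h2, neg_mul, Real.cos_neg, Real.cos_two_pi, one_smul]
    · rw [endExp_apply_of_eq_zero, h, zero_mul, Real.cos_zero, one_smul]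
      rw [had, lie_compact_of_zero hθ hα hl he hγ h hx, smul_zero]
    all_goals
      rw [endExp_apply_of_sq (c := Real.pi) Real.pi_ne_zero, Real.cos_pi, Real.sin_pi, h]
      · simp
      · rw [had, had, lie_smul, lie_lie_compact_of_one hθ hα hl he ht (by simp [h]) hx]
        module
  · have hγ0 : (γ : 𝔞 → ℝ) = 0 := not_not.1 hγ
    rw [hγ0] at hx ⊢
    have hxa := mem_cartan_of_mem_rootSpace_zero hx
    set a : 𝔞 := ⟨x, hxa⟩ with ha
    have hxa' : x = (a : 𝔤) := rfl
    -- Split `𝔞` into the line of the coroot, where `hfour` applies, and the kernel of `α`, which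
    -- commutes with `e + θ e`.
    have h4 : x = (α a / 2) • (coroot α : 𝔤) + ((a - (α a / 2) • coroot α : 𝔞) : 𝔤) := by
      rw [hxa']; simp
    have h5 : α (a - (α a / 2) • coroot α) = 0 := by
      have h6 : α (a - (α a / 2) • coroot α) = α a - (α a / 2) * α (coroot α) := by
        change Weight.toLinear ℝ 𝔞 𝔤 α _ = _
        rw [map_sub, map_smul]
        rfl
      rw [h6, h2]; ring
    have h7 : endExp (ad ℝ 𝔤 (Real.pi • (e + θ e))) (coroot α : 𝔤) = coroot α := by
      refine hfour _ ?_
      rw [lie_compact_cartan hθ he, lie_smul, lie_compact_sub ht, h2, smul_smul]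
      norm_num
    have h8 : endExp (ad ℝ 𝔤 (Real.pi • (e + θ e))) ((a - (α a / 2) • coroot α : 𝔞) : 𝔤) =
        ((a - (α a / 2) • coroot α : 𝔞) : 𝔤) := by
      refine endExp_apply_of_eq_zero ?_
      rw [had, lie_compact_cartan hθ he, h5, neg_zero, zero_smul, smul_zero]
    rw [Pi.zero_apply, zero_mul, Real.cos_zero, one_smul]
    conv_lhs => rw [h4]
    rw [map_add, map_smul, h7, h8, ← h4]

lemma exists_int (γ α : Weight ℝ 𝔞 𝔤) : ∃ n : ℤ, γ (coroot α) = n :=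
  ⟨_, apply_coroot_eq_cast α γ⟩

include hθ hα hl he ht in
/-- The element of `M` attached to a long root. -/
lemma exists_mem_groupM : ∃ σ ∈ groupM 𝔞 θ, ∀ (γ : Weight ℝ 𝔞 𝔤), ∀ x ∈ rootSpace 𝔞 γ,
    σ x = Real.cos (γ (coroot α) * Real.pi) • x := by
  set S := endExp (ad ℝ 𝔤 (Real.pi • (e + θ e))) with hS
  have hSx : ∀ (γ : Weight ℝ 𝔞 𝔤), ∀ x ∈ rootSpace 𝔞 γ,
      S x = Real.cos (γ (coroot α) * Real.pi) • x :=
    fun γ x hx => endExp_compact hθ hα hl he ht γ hx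
  have hinv : ∀ x, S (S x) = x := by
    intro x
    have : S ∘ₗ S = LinearMap.id := by
      refine linearMap_ext_rootSpace (𝔞 := 𝔞) fun γ x hx => ?_
      rw [LinearMap.comp_apply, hSx γ x hx, map_smul, hSx γ x hx, smul_smul, LinearMap.id_apply]
      obtain ⟨n, hn⟩ := exists_int γ α
      have h1 := Real.sin_sq_add_cos_sq (γ (coroot α) * Real.pi)
      rw [hn, Real.sin_int_mul_pi] at h1
      rw [hn, ← sq, show Real.cos (n * Real.pi) ^ 2 = 1 by linarith, one_smul]
    exact LinearMap.congr_fun this x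
  -- The signs are multiplicative in the weight because pairings with coroots are integers; the
  -- identity is extended from root spaces in one argument at a time.
  have hlie : ∀ x y, S ⁅x, y⁆ = ⁅S x, S y⁆ := by
    have h1 : ∀ (γ : Weight ℝ 𝔞 𝔤), ∀ x ∈ rootSpace 𝔞 γ, ∀ y, S ⁅x, y⁆ = ⁅S x, S y⁆ := by
      intro γ x hx
      have : S ∘ₗ ad ℝ 𝔤 x = ad ℝ 𝔤 (S x) ∘ₗ S := by
        refine linearMap_ext_rootSpace (𝔞 := 𝔞) fun δ y hy => ?_
        change S ⁅x, y⁆ = ⁅S x, S y⁆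
        rw [hSx γ x hx, hSx δ y hy, smul_lie, lie_smul, smul_smul]
        have hxy := lie_mem_add hx hy
        by_cases hb : rootSpace 𝔞 ((γ : 𝔞 → ℝ) + δ) = ⊥
        · rw [eq_zero_of_mem_bot hb hxy, map_zero, smul_zero]
        · rw [hSx ⟨_, hb⟩ _ hxy]
          congr 1
          change Real.cos ((γ (coroot α) + δ (coroot α)) * Real.pi) = _
          obtain ⟨n, hn⟩ := exists_int γ α
          rw [add_mul, Real.cos_add, hn, Real.sin_int_mul_pi, zero_mul, sub_zero]
      exact fun y => LinearMap.congr_fun this y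
    intro x y
    have : S ∘ₗ ad ℝ 𝔤 x = ad ℝ 𝔤 (S x) ∘ₗ S := by
      refine linearMap_ext_rootSpace (𝔞 := 𝔞) fun δ y hy => ?_
      change S ⁅x, y⁆ = ⁅S x, S y⁆
      rw [← lie_skew, map_neg, h1 δ y hy, lie_skew]
    exact LinearMap.congr_fun this y
  let σ : 𝔤 ≃ₗ⁅ℝ⁆ 𝔤 :=
    { S with
      map_lie' := fun {x y} => hlie x y
      invFun := S
      left_inv := hinv
      right_inv := hinv }
  refine ⟨σ, ⟨Subgroup.subset_closure ⟨Real.pi • (e + θ e), ?_, ?_⟩, fun h hh => ?_⟩,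
    fun γ x hx => hSx γ x hx⟩
  · have h1 : θ (Real.pi • (e + θ e)) = Real.pi • θ (e + θ e) :=
      map_smul (θ : 𝔤 →ₗ⁅ℝ⁆ 𝔤) _ _
    have h2 : θ (e + θ e) = θ e + θ (θ e) := map_add (θ : 𝔤 →ₗ⁅ℝ⁆ 𝔤) _ _
    rw [h1, h2, hθ.involutive, add_comm]
  · rfl
  · change S h = h
    by_cases hh0 : h = 0
    · rw [hh0, map_zero]
    have hmem : h ∈ rootSpace 𝔞 (0 : 𝔞 → ℝ) := by
      rw [rootSpace_zero_eq]
      exact hh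
    have hb : rootSpace 𝔞 (0 : 𝔞 → ℝ) ≠ ⊥ := fun hb => hh0 (eq_zero_of_mem_bot hb hmem)
    have := hSx ⟨0, hb⟩ h hmem
    rw [this]
    change Real.cos ((0 : ℝ) * Real.pi) • h = h
    rw [zero_mul, Real.cos_zero, one_smul]

end Triple

end RealFlag

/-! ### An invariant subspace of `𝔨` obtained from two commuting elements -/

/-- Let `𝔨` be the fixed points of `θ`, graded by an involution `σ`, and let `Y₁, Y₂` be commuting
elements that centralize the even part and act on the odd part with square `-1`. Then some subspace
stable under `ad 𝔨` contains `Y₁ + Y₂` and is centralized by `Y₁ - Y₂`. -/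
lemma exists_stable_of_sq_eq {𝔤 : Type*} [LieRing 𝔤] [LieAlgebra ℝ 𝔤] {θ σ : 𝔤 →ₗ⁅ℝ⁆ 𝔤}
    (hσσ : ∀ x, σ (σ x) = x) (hσθ : ∀ x, σ (θ x) = θ (σ x))
    {Y₁ Y₂ : 𝔤} (h1 : θ Y₁ = Y₁) (h2 : θ Y₂ = Y₂) (h12 : ⁅Y₁, Y₂⁆ = 0)
    (s1 : σ Y₁ = Y₁) (s2 : σ Y₂ = Y₂)
    (even1 : ∀ x, θ x = x → σ x = x → ⁅Y₁, x⁆ = 0) (even2 : ∀ x, θ x = x → σ x = x → ⁅Y₂, x⁆ = 0)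
    (odd1 : ∀ x, σ x = -x → ⁅Y₁, ⁅Y₁, x⁆⁆ = -x) (odd2 : ∀ x, σ x = -x → ⁅Y₂, ⁅Y₂, x⁆⁆ = -x) :
    ∃ U : Submodule ℝ 𝔤, (∀ X, θ X = X → ∀ x ∈ U, ⁅X, x⁆ ∈ U) ∧ Y₁ + Y₂ ∈ U ∧
      ∀ x ∈ U, ⁅Y₁ - Y₂, x⁆ = 0 := by
  set Z := Y₁ + Y₂ with hZ
  have hZθ : θ Z = Z := by rw [hZ, map_add, h1, h2]
  have hZσ : σ Z = Z := by rw [hZ, map_add, s1, s2]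
  have hcomm : ∀ x : 𝔤, ⁅Y₁, ⁅Y₂, x⁆⁆ = ⁅Y₂, ⁅Y₁, x⁆⁆ := by
    intro x; rw [leibniz_lie, h12, zero_lie, zero_add]
  have hZ0 : ∀ x : 𝔤, θ x = x → σ x = x → ⁅Z, x⁆ = 0 := by
    intro x hx hx'; rw [hZ, add_lie, even1 x hx hx', even2 x hx hx', add_zero]
  -- the odd part of `𝔨`
  let W : 𝔤 → Prop := fun x => θ x = x ∧ σ x = -x
  have hW0 : ∀ {k w : 𝔤}, θ k = k → σ k = k → W w → W ⁅k, w⁆ := by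
    intro k w hk hk' hw
    exact ⟨by rw [LieHom.map_lie, hk, hw.1], by rw [LieHom.map_lie, hk', hw.2, lie_neg]⟩
  have hWW : ∀ {w w' : 𝔤}, W w → W w' → θ ⁅w, w'⁆ = ⁅w, w'⁆ ∧ σ ⁅w, w'⁆ = ⁅w, w'⁆ := by
    intro w w' hw hw'
    exact ⟨by rw [LieHom.map_lie, hw.1, hw'.1],
      by rw [LieHom.map_lie, hw.2, hw'.2, neg_lie, lie_neg, neg_neg]⟩
  have hZW : ∀ {w : 𝔤}, W w → W ⁅Z, w⁆ := fun hw => hW0 hZθ hZσ hw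
  -- On the odd part `ad Y₁` and `ad Y₂` are commuting complex structures, so `Z` acts as zero where
  -- they are opposite and as twice `ad Y₁` where they agree.
  have hZ3 : ∀ {w : 𝔤}, W w → ⁅Z, ⁅Z, ⁅Z, w⁆⁆⁆ = -((4 : ℝ) • ⁅Z, w⁆) := by
    intro w hw
    have a1 := odd1 w hw.2
    have a2 := odd2 w hw.2
    have b : ⁅Y₁, ⁅Y₁, ⁅Y₂, w⁆⁆⁆ = -⁅Y₂, w⁆ := by rw [hcomm w, hcomm, a1, lie_neg]
    have c : ⁅Y₂, ⁅Y₂, ⁅Y₁, w⁆⁆⁆ = -⁅Y₁, w⁆ := by rw [← hcomm w, ← hcomm, a2, lie_neg]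
    have d : ⁅Y₂, ⁅Y₁, ⁅Y₂, w⁆⁆⁆ = -⁅Y₁, w⁆ := by rw [hcomm, c]
    have f : ⁅Y₂, ⁅Y₁, ⁅Y₁, w⁆⁆⁆ = -⁅Y₂, w⁆ := by rw [a1, lie_neg]
    have g : ⁅Y₁, ⁅Y₂, ⁅Y₂, w⁆⁆⁆ = -⁅Y₁, w⁆ := by rw [a2, lie_neg]
    have i : ⁅Y₁, ⁅Y₁, ⁅Y₁, w⁆⁆⁆ = -⁅Y₁, w⁆ := by rw [a1, lie_neg]
    have j : ⁅Y₂, ⁅Y₂, ⁅Y₂, w⁆⁆⁆ = -⁅Y₂, w⁆ := by rw [a2, lie_neg]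
    have k : ⁅Y₁, ⁅Y₂, ⁅Y₁, w⁆⁆⁆ = -⁅Y₂, w⁆ := by rw [← hcomm w, b]
    simp only [hZ, add_lie, lie_add, b, c, d, f, g, i, j, k]
    module
  have hsplit : ∀ {w : 𝔤}, W w → ∃ w' v, W w' ∧ W v ∧ ⁅Z, w'⁆ = 0 ∧ w = w' + ⁅Z, v⁆ := by
    intro w hw
    have hv : W (-((1 / 4 : ℝ) • ⁅Z, w⁆)) := by
      obtain ⟨ha, hb⟩ := hZW hw
      exact ⟨by rw [map_neg, map_smul, ha], by rw [map_neg, map_smul, hb, smul_neg]⟩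
    have hZv := hZW hv
    -- By `hZ3`, `1 + (ad Z)²/4` is the projection of the odd part onto the kernel of `ad Z`, along
    -- its image.
    refine ⟨w - ⁅Z, -((1 / 4 : ℝ) • ⁅Z, w⁆)⁆, -((1 / 4 : ℝ) • ⁅Z, w⁆), ⟨?_, ?_⟩, hv, ?_, by abel⟩
    · rw [map_sub, hw.1, hZv.1]
    · rw [map_sub, hw.2, hZv.2]; abel
    · rw [lie_sub, lie_neg, lie_neg, lie_smul, lie_smul, hZ3 hw]
      module
  -- Kernel and image of `ad Z` on the odd part commute: `⁅w', w⁆` is even, hence centralized by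
  -- `Z`, and the Jacobi identity moves `Z` onto `w`.
  have hkill : ∀ {w' w : 𝔤}, W w' → ⁅Z, w'⁆ = 0 → W w → ⁅w', ⁅Z, w⁆⁆ = 0 := by
    intro w' w hw' h0 hw
    have h3 := leibniz_lie Z w' w
    obtain ⟨h4, h5⟩ := hWW hw' hw
    rw [h0, zero_lie, zero_add, hZ0 _ h4 h5] at h3
    exact h3.symm
  have hkZ : ∀ {k w : 𝔤}, θ k = k → σ k = k → ⁅k, ⁅Z, w⁆⁆ = ⁅Z, ⁅k, w⁆⁆ := by
    intro k w hk hk'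
    rw [leibniz_lie Z k w, hZ0 k hk hk', zero_lie, zero_add]
  -- Everything generated by `Z` under `ad 𝔨`: by `hsplit` and `hkill` only the image part of an odd
  -- element acts on `⁅Z, w⁆`, so brackets of two such elements already close up.
  let s : Set 𝔤 := {Z} ∪ ({x | ∃ w, W w ∧ x = ⁅Z, w⁆} ∪
    {x | ∃ w w', W w ∧ W w' ∧ x = ⁅⁅Z, w⁆, ⁅Z, w'⁆⁆})
  let U := Submodule.span ℝ s
  have hU1 : Z ∈ U := Submodule.subset_span (Or.inl rfl)
  have hU2 : ∀ {w : 𝔤}, W w → ⁅Z, w⁆ ∈ U := fun hw => Submodule.subset_span (Or.inr (Or.inl ⟨_, hw, rfl⟩))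
  have hU3 : ∀ {w w' : 𝔤}, W w → W w' → ⁅⁅Z, w⁆, ⁅Z, w'⁆⁆ ∈ U := fun hw hw' =>
    Submodule.subset_span (Or.inr (Or.inr ⟨_, _, hw, hw', rfl⟩))
  have hstab0 : ∀ k, θ k = k → σ k = k → ∀ x ∈ U, ⁅k, x⁆ ∈ U := by
    intro k hk hk' x hx
    induction hx using Submodule.span_induction with
    | mem x hx =>
      rcases hx with rfl | ⟨w, hw, rfl⟩ | ⟨w, w', hw, hw', rfl⟩
      · rw [← lie_skew, hZ0 k hk hk', neg_zero]; exact zero_mem _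
      · rw [hkZ hk hk']; exact hU2 (hW0 hk hk' hw)
      · rw [leibniz_lie, hkZ hk hk', hkZ hk hk']
        exact add_mem (hU3 (hW0 hk hk' hw) hw') (hU3 hw (hW0 hk hk' hw'))
    | zero => rw [lie_zero]; exact zero_mem _
    | add x y _ _ hx hy => rw [lie_add]; exact add_mem hx hy
    | smul c x _ hx => rw [lie_smul]; exact U.smul_mem c hx
  have hodd : ∀ {X w : 𝔤}, W X → W w → ∃ v, W v ∧ ⁅X, ⁅Z, w⁆⁆ = ⁅⁅Z, v⁆, ⁅Z, w⁆⁆ := by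
    intro X w hX hw
    obtain ⟨w', v, hw', hv, h0, rfl⟩ := hsplit hX
    exact ⟨v, hv, by rw [add_lie, hkill hw' h0 hw, zero_add]⟩
  have hstab1 : ∀ X, W X → ∀ x ∈ U, ⁅X, x⁆ ∈ U := by
    intro X hX x hx
    induction hx using Submodule.span_induction with
    | mem x hx =>
      rcases hx with rfl | ⟨w, hw, rfl⟩ | ⟨w, w', hw, hw', rfl⟩
      · rw [← lie_skew]; exact neg_mem (hU2 hX)
      · obtain ⟨v, hv, h⟩ := hodd hX hw
        rw [h]; exact hU3 hv hw
      · obtain ⟨v, hv, h⟩ := hodd hX hw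
        obtain ⟨v', hv', h'⟩ := hodd hX hw'
        rw [leibniz_lie, h, h']
        obtain ⟨a1, a2⟩ := hWW (hZW hv) (hZW hw)
        obtain ⟨b1, b2⟩ := hWW (hZW hv') (hZW hw')
        refine add_mem (hstab0 _ a1 a2 _ (hU2 hw')) ?_
        rw [← lie_skew]
        exact neg_mem (hstab0 _ b1 b2 _ (hU2 hw))
    | zero => rw [lie_zero]; exact zero_mem _
    | add x y _ _ hx hy => rw [lie_add]; exact add_mem hx hy
    | smul c x _ hx => rw [lie_smul]; exact U.smul_mem c hx
  have hEw : ∀ {w : 𝔤}, W w → ⁅Y₁ - Y₂, ⁅Z, w⁆⁆ = 0 := by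
    intro w hw
    simp only [hZ, add_lie, lie_add, sub_lie, odd1 w hw.2, odd2 w hw.2, hcomm w]
    abel
  refine ⟨U, fun X hX x hx => ?_, hU1, fun x hx => ?_⟩
  · have h3 : X = (1 / 2 : ℝ) • (X + σ X) + (1 / 2 : ℝ) • (X - σ X) := by module
    rw [h3, add_lie, smul_lie, smul_lie]
    refine add_mem (U.smul_mem _ (hstab0 _ ?_ ?_ x hx)) (U.smul_mem _ (hstab1 _ ⟨?_, ?_⟩ x hx))
    · rw [map_add, ← hσθ, hX]
    · rw [map_add, hσσ, add_comm]
    · rw [map_sub, ← hσθ, hX]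
    · rw [map_sub, hσσ, neg_sub]
  · induction hx using Submodule.span_induction with
    | mem x hx =>
      rcases hx with rfl | ⟨w, hw, rfl⟩ | ⟨w, w', hw, hw', rfl⟩
      · have : ⁅Y₂, Y₁⁆ = 0 := by rw [← lie_skew, h12, neg_zero]
        rw [hZ, sub_lie, lie_add, lie_add, lie_self, lie_self, h12, this]; simp
      · exact hEw hw
      · rw [leibniz_lie, hEw hw, hEw hw', zero_lie, lie_zero, add_zero]
    | zero => rw [lie_zero]
    | add x y _ _ hx hy => rw [lie_add, hx, hy, add_zero]
    | smul c x _ hx => rw [lie_smul, hx, smul_zero]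

/-! ### Comparing characters of long roots -/

namespace RealFlag

open LieAlgebra LieAlgebra.IsKilling GenCplx

variable {𝔤 : Type*} [LieRing 𝔤] [LieAlgebra ℝ 𝔤] [FiniteDimensional ℝ 𝔤]
variable [IsKilling ℝ 𝔤]
variable {𝔞 : LieSubalgebra ℝ 𝔤} [𝔞.IsCartanSubalgebra] [IsTriangularizable ℝ 𝔞 𝔤]
variable {θ : 𝔤 ≃ₗ⁅ℝ⁆ 𝔤}

/-- The characters of `M` on the root spaces of `f` and `g` agree. -/
def CharEq (𝔞 : LieSubalgebra ℝ 𝔤) [𝔞.IsCartanSubalgebra] (θ : 𝔤 ≃ₗ⁅ℝ⁆ 𝔤) (f g : 𝔞 → ℝ) : Prop :=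
  ∀ m ∈ groupM 𝔞 θ, ∀ s, ActsBy m f s → ActsBy m g s

variable {α β : Weight ℝ 𝔞 𝔤}

/-- The tool to tell characters apart: evaluate both on the element of `M` attached to `γ`. -/
lemma CharEq.cos_eq (hθ : IsCartanInvolution 𝔞 θ) {γ : Weight ℝ 𝔞 𝔤} (hγ : γ.IsNonZero)
    (hl : IsLong γ) (h : CharEq 𝔞 θ α β) :
    Real.cos (α (coroot γ) * Real.pi) = Real.cos (β (coroot γ) * Real.pi) := by
  obtain ⟨e, he, ht⟩ := exists_sl2Triple hθ hγ
  obtain ⟨σ, hσ, hs⟩ := exists_mem_groupM hθ hγ hl he ht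
  exact ActsBy.unique (h σ hσ _ (hs α)) (hs β)

lemma IsCartanInvolution.add_map_fixed (hθ : IsCartanInvolution 𝔞 θ) (x : 𝔤) :
    θ (x + θ x) = x + θ x := by
  have h2 : θ (x + θ x) = θ x + θ (θ x) := map_add (θ : 𝔤 →ₗ⁅ℝ⁆ 𝔤) _ _
  rw [h2, hθ.involutive, add_comm]

/-- A pair of orthogonal long roots such that every other root is orthogonal to both or has pairing
`±1` with both. -/
structure IsLongPair (α β : Weight ℝ 𝔞 𝔤) : Prop where
  nonzero₁ : α.IsNonZero
  nonzero₂ : β.IsNonZero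
  long₁ : IsLong α
  long₂ : IsLong β
  orth : β (coroot α) = 0
  cases : ∀ γ : Weight ℝ 𝔞 𝔤, γ.IsNonZero →
    (γ : 𝔞 → ℝ) = α ∨ (γ : 𝔞 → ℝ) = -α ∨ (γ : 𝔞 → ℝ) = β ∨ (γ : 𝔞 → ℝ) = -β ∨
      (γ (coroot α) = 0 ∧ γ (coroot β) = 0) ∨
      ((γ (coroot α) = 1 ∨ γ (coroot α) = -1) ∧ (γ (coroot β) = 1 ∨ γ (coroot β) = -1))

/-- The data attached to a pair of long roots: the elements `Y = e + θ e` of `𝔨` and the grading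
involution. -/
structure PairData (θ : 𝔤 ≃ₗ⁅ℝ⁆ 𝔤) (α β : Weight ℝ 𝔞 𝔤) (e₁ e₂ : 𝔤) (σ : 𝔤 ≃ₗ⁅ℝ⁆ 𝔤) : Prop where
  mem₁ : e₁ ∈ rootSpace 𝔞 α
  mem₂ : e₂ ∈ rootSpace 𝔞 β
  triple₁ : IsSl2Triple (coroot α : 𝔤) e₁ (-θ e₁)
  triple₂ : IsSl2Triple (coroot β : 𝔤) e₂ (-θ e₂)
  sigma_mem : σ ∈ groupM 𝔞 θ
  sigma : ∀ (γ : Weight ℝ 𝔞 𝔤), ∀ x ∈ rootSpace 𝔞 γ,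
    σ x = Real.cos (γ (coroot α) * Real.pi) • x

lemma exists_pairData (hθ : IsCartanInvolution 𝔞 θ) (h : IsLongPair α β) :
    ∃ e₁ e₂ σ, PairData θ α β e₁ e₂ σ := by
  obtain ⟨e, he, ht⟩ := exists_sl2Triple hθ h.nonzero₁
  obtain ⟨e', he', ht'⟩ := exists_sl2Triple hθ h.nonzero₂
  obtain ⟨σ, hσ, hs⟩ := exists_mem_groupM hθ h.nonzero₁ h.long₁ he ht
  exact ⟨e, e', σ, he, he', ht, ht', hσ, hs⟩

section PairData

variable {e₁ e₂ : 𝔤} {σ : 𝔤 ≃ₗ⁅ℝ⁆ 𝔤} (hθ : IsCartanInvolution 𝔞 θ) (h : IsLongPair α β)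
  (d : PairData θ α β e₁ e₂ σ)

include hθ h d

lemma PairData.lie_eq_zero : ⁅e₁ + θ e₁, e₂ + θ e₂⁆ = 0 := by
  rw [lie_add, lie_compact_of_zero hθ h.nonzero₁ h.long₁ d.mem₁ h.nonzero₂ h.orth d.mem₂,
    lie_compact_of_zero hθ h.nonzero₁ h.long₁ d.mem₁ h.nonzero₂.neg
      (show (-β) (coroot α) = 0 by rw [Weight.coe_neg, Pi.neg_apply, h.orth, neg_zero])
      (hθ.map_mem d.mem₂), add_zero]

lemma PairData.sigma_sigma (x : 𝔤) : σ (σ x) = x := by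
  have h1 : ((σ : 𝔤 →ₗ⁅ℝ⁆ 𝔤) : 𝔤 →ₗ[ℝ] 𝔤) ∘ₗ ((σ : 𝔤 →ₗ⁅ℝ⁆ 𝔤) : 𝔤 →ₗ[ℝ] 𝔤) = LinearMap.id := by
    refine linearMap_ext_rootSpace (𝔞 := 𝔞) fun γ x hx => ?_
    change σ (σ x) = x
    have h2 : σ (Real.cos (γ (coroot α) * Real.pi) • x) =
      Real.cos (γ (coroot α) * Real.pi) • σ x := map_smul (σ : 𝔤 →ₗ⁅ℝ⁆ 𝔤) _ _
    rw [d.sigma γ x hx, h2, d.sigma γ x hx, smul_smul]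
    obtain ⟨n, hn⟩ := exists_int γ α
    have h1 := Real.sin_sq_add_cos_sq (γ (coroot α) * Real.pi)
    rw [hn, Real.sin_int_mul_pi] at h1
    rw [hn, ← sq, show Real.cos (n * Real.pi) ^ 2 = 1 by linarith, one_smul]
  exact LinearMap.congr_fun h1 x

lemma PairData.sigma_compact₁ : σ (e₁ + θ e₁) = e₁ + θ e₁ := by
  have h2 : σ (e₁ + θ e₁) = σ e₁ + σ (θ e₁) := map_add (σ : 𝔤 →ₗ⁅ℝ⁆ 𝔤) _ _
  have hc := root_apply_coroot h.nonzero₁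
  rw [h2, d.sigma α e₁ d.mem₁, d.sigma (-α) _ (hθ.map_mem d.mem₁), Weight.coe_neg, Pi.neg_apply, hc,
    neg_mul, Real.cos_neg, Real.cos_two_pi, one_smul, one_smul]

lemma PairData.sigma_compact₂ : σ (e₂ + θ e₂) = e₂ + θ e₂ := by
  have h2 : σ (e₂ + θ e₂) = σ e₂ + σ (θ e₂) := map_add (σ : 𝔤 →ₗ⁅ℝ⁆ 𝔤) _ _
  rw [h2, d.sigma β e₂ d.mem₂, d.sigma (-β) _ (hθ.map_mem d.mem₂), Weight.coe_neg, Pi.neg_apply,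
    h.orth, neg_mul, Real.cos_neg, zero_mul, Real.cos_zero, one_smul, one_smul]

/-- The even part of `𝔨` is spanned by `Y_α`, `Y_β` and the elements coming from roots orthogonal to
both; `Y_α` and `Y_β` commute with all of these. -/
lemma PairData.lie_even {x : 𝔤} (hx : θ x = x) (hx' : σ x = x) :
    ⁅e₁ + θ e₁, x⁆ = 0 ∧ ⁅e₂ + θ e₂, x⁆ = 0 := by
  have hl := d.lie_eq_zero hθ h
  have hl' : ⁅e₂ + θ e₂, e₁ + θ e₁⁆ = 0 := by rw [← lie_skew, hl, neg_zero]
  have key : ∀ (γ : Weight ℝ 𝔞 𝔤), ∀ x ∈ rootSpace 𝔞 γ,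
      ⁅e₁ + θ e₁, (x + σ x) + θ (x + σ x)⁆ = 0 ∧ ⁅e₂ + θ e₂, (x + σ x) + θ (x + σ x)⁆ = 0 := by
    intro γ x hx
    have hsx : x + σ x = (1 + Real.cos (γ (coroot α) * Real.pi)) • x := by
      rw [d.sigma γ x hx, add_smul, one_smul]
    have hθs : ∀ c : ℝ, θ (c • x) = c • θ x := fun c => map_smul (θ : 𝔤 →ₗ⁅ℝ⁆ 𝔤) _ _
    rw [hsx, hθs, ← smul_add, lie_smul, lie_smul]
    by_cases hγ : γ.IsNonZero
    · rcases h.cases γ hγ with h1 | h1 | h1 | h1 | ⟨h1, h2⟩ | ⟨h1, -⟩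
      · obtain ⟨c, rfl⟩ := exists_eq_smul h.nonzero₁ d.mem₁ d.triple₁.e_ne_zero (h1 ▸ hx)
        have : θ (c • e₁) = c • θ e₁ := map_smul (θ : 𝔤 →ₗ⁅ℝ⁆ 𝔤) _ _
        rw [this, ← smul_add, lie_smul, lie_smul, lie_self, hl']
        simp
      · have hne : θ e₁ ≠ 0 := fun h0 => d.triple₁.f_ne_zero (by rw [h0, neg_zero])
        obtain ⟨c, rfl⟩ := exists_eq_smul h.nonzero₁.neg (hθ.map_mem d.mem₁) hne
          (by rw [Weight.coe_neg]; exact h1 ▸ hx)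
        have : θ (c • θ e₁) = c • θ (θ e₁) := map_smul (θ : 𝔤 →ₗ⁅ℝ⁆ 𝔤) _ _
        rw [this, hθ.involutive, ← smul_add, add_comm (θ e₁) e₁, lie_smul, lie_smul, lie_self, hl']
        simp
      · obtain ⟨c, rfl⟩ := exists_eq_smul h.nonzero₂ d.mem₂ d.triple₂.e_ne_zero (h1 ▸ hx)
        have : θ (c • e₂) = c • θ e₂ := map_smul (θ : 𝔤 →ₗ⁅ℝ⁆ 𝔤) _ _
        rw [this, ← smul_add, lie_smul, lie_smul, lie_self, hl]
        simp
      · have hne : θ e₂ ≠ 0 := fun h0 => d.triple₂.f_ne_zero (by rw [h0, neg_zero])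
        obtain ⟨c, rfl⟩ := exists_eq_smul h.nonzero₂.neg (hθ.map_mem d.mem₂) hne
          (by rw [Weight.coe_neg]; exact h1 ▸ hx)
        have : θ (c • θ e₂) = c • θ (θ e₂) := map_smul (θ : 𝔤 →ₗ⁅ℝ⁆ 𝔤) _ _
        rw [this, hθ.involutive, ← smul_add, add_comm (θ e₂) e₂, lie_smul, lie_smul, lie_self, hl]
        simp
      · have hn : ∀ δ : Weight ℝ 𝔞 𝔤, γ (coroot δ) = 0 → (-γ) (coroot δ) = 0 := by
          intro δ hδ; rw [Weight.coe_neg, Pi.neg_apply, hδ, neg_zero]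
        rw [lie_add, lie_add,
          lie_compact_of_zero hθ h.nonzero₁ h.long₁ d.mem₁ hγ h1 hx,
          lie_compact_of_zero hθ h.nonzero₁ h.long₁ d.mem₁ hγ.neg (hn α h1) (hθ.map_mem hx),
          lie_compact_of_zero hθ h.nonzero₂ h.long₂ d.mem₂ hγ h2 hx,
          lie_compact_of_zero hθ h.nonzero₂ h.long₂ d.mem₂ hγ.neg (hn β h2) (hθ.map_mem hx)]
        simp
      · have : Real.cos (γ (coroot α) * Real.pi) = -1 := by
          rcases h1 with h1 | h1 <;> simp [h1]
        rw [this]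
        simp
    · have hγ0 : (γ : 𝔞 → ℝ) = 0 := not_not.1 hγ
      rw [hγ0] at hx
      rw [hθ.on_cartan x (mem_cartan_of_mem_rootSpace_zero hx)]
      simp
  -- `(1 + θ)(1 + σ)` maps onto the even part of `𝔨` and is multiplication by `4` there, so checking
  -- on root spaces is enough.
  have lin : ∀ z : 𝔤, (∀ (γ : Weight ℝ 𝔞 𝔤), ∀ x ∈ rootSpace 𝔞 γ,
      ⁅z, (x + σ x) + θ (x + σ x)⁆ = 0) → ⁅z, x⁆ = 0 := by
    intro z hz
    let T : 𝔤 →ₗ[ℝ] 𝔤 := ad ℝ 𝔤 z ∘ₗ (LinearMap.id + ((θ : 𝔤 →ₗ⁅ℝ⁆ 𝔤) : 𝔤 →ₗ[ℝ] 𝔤)) ∘ₗ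
      (LinearMap.id + ((σ : 𝔤 →ₗ⁅ℝ⁆ 𝔤) : 𝔤 →ₗ[ℝ] 𝔤))
    have hT : T = 0 := linearMap_ext_rootSpace (𝔞 := 𝔞) fun γ x hx => hz γ x hx
    have h3 : ⁅z, (x + σ x) + θ (x + σ x)⁆ = 0 := LinearMap.congr_fun hT x
    have h4 : θ (x + x) = θ x + θ x := map_add (θ : 𝔤 →ₗ⁅ℝ⁆ 𝔤) _ _
    rw [hx', h4, hx, show x + x + (x + x) = (4 : ℝ) • x by module, lie_smul] at h3
    exact (smul_eq_zero_iff_right (by norm_num)).1 h3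
  exact ⟨lin _ fun γ x hx => (key γ x hx).1, lin _ fun γ x hx => (key γ x hx).2⟩

lemma PairData.lie_lie_odd {x : 𝔤} (hx : σ x = -x) :
    ⁅e₁ + θ e₁, ⁅e₁ + θ e₁, x⁆⁆ = -x ∧ ⁅e₂ + θ e₂, ⁅e₂ + θ e₂, x⁆⁆ = -x := by
  have key : ∀ (γ : Weight ℝ 𝔞 𝔤), ∀ x ∈ rootSpace 𝔞 γ,
      ⁅e₁ + θ e₁, ⁅e₁ + θ e₁, x - σ x⁆⁆ = -(x - σ x) ∧
      ⁅e₂ + θ e₂, ⁅e₂ + θ e₂, x - σ x⁆⁆ = -(x - σ x) := by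
    intro γ x hx
    have h2 := root_apply_coroot h.nonzero₁
    by_cases hc : γ (coroot α) = 1 ∨ γ (coroot α) = -1
    · have hγ : γ.IsNonZero := by
        intro h0
        have h0' : (γ : 𝔞 → ℝ) = 0 := h0
        rw [h0'] at hc
        norm_num at hc
      have hcb : γ (coroot β) = 1 ∨ γ (coroot β) = -1 := by
        rcases h.cases γ hγ with h1 | h1 | h1 | h1 | ⟨h1, -⟩ | ⟨-, h1⟩
        · rw [h1, h2] at hc; norm_num at hc
        · rw [h1, Pi.neg_apply, h2] at hc; norm_num at hc
        · rw [h1, h.orth] at hc; norm_num at hc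
        · rw [h1, Pi.neg_apply, h.orth] at hc; norm_num at hc
        · rw [h1] at hc; norm_num at hc
        · exact h1
      have hs : x - σ x = (2 : ℝ) • x := by
        rw [d.sigma γ x hx]
        have : Real.cos (γ (coroot α) * Real.pi) = -1 := by
          rcases hc with h1 | h1 <;> simp [h1]
        rw [this]; module
      rw [hs, lie_smul, lie_smul, lie_smul, lie_smul,
        lie_lie_compact_of_one hθ h.nonzero₁ h.long₁ d.mem₁ d.triple₁ hc hx,
        lie_lie_compact_of_one hθ h.nonzero₂ h.long₂ d.mem₂ d.triple₂ hcb hx, smul_neg]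
      exact ⟨rfl, rfl⟩
    · have hcos : Real.cos (γ (coroot α) * Real.pi) = 1 := by
        by_cases hγ : γ.IsNonZero
        · rcases h.cases γ hγ with h1 | h1 | h1 | h1 | ⟨h1, -⟩ | ⟨h1, -⟩
          · rw [h1, h2, Real.cos_two_pi]
          · rw [h1, Pi.neg_apply, h2, neg_mul, Real.cos_neg, Real.cos_two_pi]
          · rw [h1, h.orth]; simp
          · rw [h1, Pi.neg_apply, h.orth]; simp
          · rw [h1]; simp
          · exact absurd h1 hc
        · have h0' : (γ : 𝔞 → ℝ) = 0 := not_not.1 hγ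
          rw [h0']; simp
      rw [d.sigma γ x hx, hcos, one_smul, sub_self]
      simp
  have lin : ∀ z : 𝔤, (∀ (γ : Weight ℝ 𝔞 𝔤), ∀ x ∈ rootSpace 𝔞 γ,
      ⁅z, ⁅z, x - σ x⁆⁆ = -(x - σ x)) → ⁅z, ⁅z, x⁆⁆ = -x := by
    intro z hz
    let R : 𝔤 →ₗ[ℝ] 𝔤 := LinearMap.id - ((σ : 𝔤 →ₗ⁅ℝ⁆ 𝔤) : 𝔤 →ₗ[ℝ] 𝔤)
    have hT : ad ℝ 𝔤 z ∘ₗ ad ℝ 𝔤 z ∘ₗ R = -R :=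
      linearMap_ext_rootSpace (𝔞 := 𝔞) fun γ x hx => hz γ x hx
    have h3 : ⁅z, ⁅z, x - σ x⁆⁆ = -(x - σ x) := LinearMap.congr_fun hT x
    rw [hx, sub_neg_eq_add, ← two_smul ℝ, lie_smul, lie_smul, ← smul_neg] at h3
    exact smul_right_injective _ (two_ne_zero (α := ℝ)) h3
  exact ⟨lin _ fun γ x hx => (key γ x hx).1, lin _ fun γ x hx => (key γ x hx).2⟩

/-- `M` acts by the same character on the root spaces of a pair of long roots. -/
lemma PairData.charEq {γ : Weight ℝ 𝔞 𝔤} (hγ : γ (coroot α) = 1 ∨ γ (coroot α) = -1) :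
    CharEq 𝔞 θ α β := by
  intro m hm s hs
  obtain ⟨t, ht, htβ⟩ := exists_actsBy hθ hm h.nonzero₂
  suffices s = t by rwa [this]
  have hss : s * s = 1 := by
    obtain ⟨s', hs', hs''⟩ := exists_actsBy hθ hm h.nonzero₁
    rwa [hs.unique hs'']
  by_contra hst
  have hts : t = -s := by
    have h3 : (s - t) * (s + t) = 0 := by linear_combination hss - ht
    rcases mul_eq_zero.1 h3 with h3 | h3
    · exact absurd (sub_eq_zero.1 h3) hst
    · linarith
  set Y₁ := e₁ + θ e₁ with hY1
  set Y₂ := e₂ + θ e₂ with hY2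
  have hmadd : ∀ x y, m (x + y) = m x + m y := map_add (m : 𝔤 →ₗ⁅ℝ⁆ 𝔤)
  have hmY1 : m Y₁ = s • Y₁ := by
    rw [hY1, hmadd, hs _ d.mem₁, (hs.neg hθ hm) _ (hθ.map_mem d.mem₁), smul_add]
  have hmY2 : m Y₂ = -s • Y₂ := by
    rw [hY2, hmadd, htβ _ d.mem₂, (htβ.neg hθ hm) _ (hθ.map_mem d.mem₂), hts, smul_add]
  have hθ1 : θ Y₁ = Y₁ := hθ.add_map_fixed e₁
  have hθ2 : θ Y₂ = Y₂ := hθ.add_map_fixed e₂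
  -- an odd element of `𝔨`
  obtain ⟨x, hx, hx0⟩ := exists_ne_zero γ
  have hsx : σ x = -x := by
    rw [d.sigma γ x hx]
    have : Real.cos (γ (coroot α) * Real.pi) = -1 := by
      rcases hγ with h1 | h1 <;> simp [h1]
    rw [this, neg_one_smul]
  set w := x + θ x with hw
  have hθw : θ w = w := hθ.add_map_fixed x
  have hσw : σ w = -w := by
    have h3 : σ (x + θ x) = σ x + σ (θ x) := map_add (σ : 𝔤 →ₗ⁅ℝ⁆ 𝔤) _ _
    have h4 : θ (-x) = -θ x := map_neg (θ : 𝔤 →ₗ⁅ℝ⁆ 𝔤) _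
    rw [hw, h3, groupK_comm d.sigma_mem.1, hsx, h4, neg_add]
  have hw0 : w ≠ 0 := by
    intro h0
    have h3 : ⁅(coroot α : 𝔤), w⁆ = γ (coroot α) • x - γ (coroot α) • θ x := by
      have e1 : ⁅(coroot α : 𝔤), x⁆ = γ (coroot α) • x := lie_eq_smul_of_mem_rootSpace hx _
      have e2 : ⁅(coroot α : 𝔤), θ x⁆ = (-γ) (coroot α) • θ x :=
        lie_eq_smul_of_mem_rootSpace (hθ.map_mem hx) _
      rw [hw, lie_add, e1, e2, Weight.coe_neg, Pi.neg_apply, neg_smul, sub_eq_add_neg]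
    rw [h0, lie_zero, ← smul_sub] at h3
    have h4 : x - θ x = 0 := by
      refine (smul_eq_zero_iff_right ?_).1 h3.symm
      rcases hγ with h1 | h1 <;> rw [h1] <;> norm_num
    have h5 : (2 : ℝ) • x = 0 := by
      rw [show (2 : ℝ) • x = (x + θ x) + (x - θ x) by module, ← hw, h0, h4, add_zero]
    exact hx0 ((smul_eq_zero_iff_right (two_ne_zero)).1 h5)
  have hodd := d.lie_lie_odd hθ h hσw
  -- With opposite signs, `m` maps `Y₁ + Y` to `s(Y₁ - Y)`, so the `K`-stable subspace `U` contains
  -- `Y₁`, and then `w = -⁅Y₁, ⁅Y₁, w⁆⁆`; but `Y₁ - Y` centralizes `U`. Taking `Y = Y₂` and `Y =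
  -- -Y₂` gives `⁅Y₁, w⁆ = 0`, which is absurd.
  have main : ∀ Y : 𝔤, (Y = Y₂ ∨ Y = -Y₂) → ⁅Y₁ - Y, w⁆ = 0 := by
    intro Y hY
    have hθY : θ Y = Y := by
      rcases hY with rfl | rfl
      · exact hθ2
      · exact (map_neg (θ : 𝔤 →ₗ⁅ℝ⁆ 𝔤) Y₂).trans (congrArg _ hθ2)
    have hσY : σ Y = Y := by
      rcases hY with rfl | rfl
      · exact d.sigma_compact₂ hθ h
      · exact (map_neg (σ : 𝔤 →ₗ⁅ℝ⁆ 𝔤) Y₂).trans (congrArg _ (d.sigma_compact₂ hθ h))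
    have hl := d.lie_eq_zero hθ h
    obtain ⟨U, hU, hZ, hcent⟩ := exists_stable_of_sq_eq (θ := (θ : 𝔤 →ₗ⁅ℝ⁆ 𝔤))
      (σ := (σ : 𝔤 →ₗ⁅ℝ⁆ 𝔤)) (Y₁ := Y₁) (Y₂ := Y) (d.sigma_sigma hθ h)
      (fun x => groupK_comm d.sigma_mem.1 x) hθ1 hθY
      (by rcases hY with rfl | rfl
          · exact hl
          · rw [lie_neg, hl, neg_zero]) (d.sigma_compact₁ hθ h) hσY
      (fun x hx hx' => (d.lie_even hθ h hx hx').1)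
      (fun x hx hx' => by
        have := (d.lie_even hθ h hx hx').2
        rcases hY with rfl | rfl
        · exact this
        · rw [neg_lie, this, neg_zero])
      (fun x hx => (d.lie_lie_odd hθ h hx).1)
      (fun x hx => by
        have := (d.lie_lie_odd hθ h hx).2
        rcases hY with rfl | rfl
        · exact this
        · rw [neg_lie, neg_lie, lie_neg, neg_neg, this])
    have hmY : m Y = -s • Y := by
      rcases hY with rfl | rfl
      · exact hmY2
      · refine (map_neg (m : 𝔤 →ₗ⁅ℝ⁆ 𝔤) Y₂).trans ?_
        rw [smul_neg]
        exact congrArg _ hmY2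
    have h3 := groupK_mem hU hm.1 hZ
    rw [hmadd, hmY1, hmY] at h3
    have h4 : Y₁ ∈ U := by
      have h5 := add_mem hZ (U.smul_mem s h3)
      rw [smul_add, smul_smul, smul_smul, mul_neg, hss] at h5
      have h6 : Y₁ = (1 / 2 : ℝ) • (Y₁ + Y + ((1 : ℝ) • Y₁ + (-1 : ℝ) • Y)) := by module
      rw [h6]
      exact U.smul_mem _ h5
    have h5 : ⁅Y₁, w⁆ ∈ U := by
      rw [← lie_skew]
      exact neg_mem (hU w hθw _ h4)
    have h6 : w ∈ U := by
      have := hU Y₁ hθ1 _ h5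
      rw [hodd.1] at this
      simpa using neg_mem this
    exact hcent w h6
  have h3 := main Y₂ (Or.inl rfl)
  have h4 := main (-Y₂) (Or.inr rfl)
  rw [sub_lie] at h3
  rw [sub_neg_eq_add, add_lie] at h4
  have h5 : ⁅Y₁, w⁆ = 0 := by
    have : (2 : ℝ) • ⁅Y₁, w⁆ = 0 := by
      rw [show (2 : ℝ) • ⁅Y₁, w⁆ = (⁅Y₁, w⁆ - ⁅Y₂, w⁆) + (⁅Y₁, w⁆ + ⁅Y₂, w⁆) by module, h3, h4,
        add_zero]
    exact (smul_eq_zero_iff_right (two_ne_zero)).1 this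
  have h6 := hodd.1
  rw [h5, lie_zero] at h6
  exact hw0 (neg_eq_zero.1 h6.symm)

end PairData

lemma IsLongPair.charEq (hθ : IsCartanInvolution 𝔞 θ) (h : IsLongPair α β) {γ : Weight ℝ 𝔞 𝔤}
    (hγ : γ (coroot α) = 1 ∨ γ (coroot α) = -1) : CharEq 𝔞 θ α β := by
  obtain ⟨e₁, e₂, σ, d⟩ := exists_pairData hθ h
  exact d.charEq hθ h hγ

end RealFlag

/-! ### A central element of `𝔨` in the situation of `B₂` -/

namespace RealFlag

open LieAlgebra LieAlgebra.IsKilling GenCplx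

variable {𝔤 : Type*} [LieRing 𝔤] [LieAlgebra ℝ 𝔤] [FiniteDimensional ℝ 𝔤]
variable [IsKilling ℝ 𝔤]
variable {𝔞 : LieSubalgebra ℝ 𝔤} [𝔞.IsCartanSubalgebra] [IsTriangularizable ℝ 𝔞 𝔤]
variable {θ : 𝔤 ≃ₗ⁅ℝ⁆ 𝔤} {α β : Weight ℝ 𝔞 𝔤}

/-- If `2γ = α + β` for a pair of long roots `α, β` and all other roots are `±γ, ±(γ - α)`, then
`𝔨` has a central element `Y_α ± Y_β`, and `M` acts trivially on `𝔤_α`. -/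
lemma IsLongPair.actsBy_one (hθ : IsCartanInvolution 𝔞 θ) (h : IsLongPair α β)
    {γ δ : Weight ℝ 𝔞 𝔤} (hγα : γ (coroot α) = 1) (hγβ : γ (coroot β) = 1)
    (hδ : (δ : 𝔞 → ℝ) = γ - α) (hsum : (γ : 𝔞 → ℝ) - α = -(γ - β))
    (hall : ∀ ε : Weight ℝ 𝔞 𝔤, ε.IsNonZero →
      ((ε : 𝔞 → ℝ) = α ∨ (ε : 𝔞 → ℝ) = -α ∨ (ε : 𝔞 → ℝ) = β ∨ (ε : 𝔞 → ℝ) = -β) ∨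
      (ε : 𝔞 → ℝ) = γ ∨ (ε : 𝔞 → ℝ) = -γ ∨ (ε : 𝔞 → ℝ) = δ ∨ (ε : 𝔞 → ℝ) = -δ)
    {m : 𝔤 ≃ₗ⁅ℝ⁆ 𝔤} (hm : m ∈ groupM 𝔞 θ) : ActsBy m α 1 := by
  have hce := h.charEq hθ (Or.inl hγα)
  obtain ⟨s, hss, hs⟩ := exists_actsBy hθ hm h.nonzero₁
  suffices s = 1 by rwa [this] at hs
  have hsβ := hce m hm s hs
  obtain ⟨e₁, e₂, σ, d⟩ := exists_pairData hθ h
  have hγ0 : γ.IsNonZero := by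
    intro h0
    have h0' : (γ : 𝔞 → ℝ) = 0 := h0
    rw [h0'] at hγα
    norm_num at hγα
  have h2 := root_apply_coroot h.nonzero₁
  have hδ0 : δ.IsNonZero := by
    intro h0
    have h0' : (δ : 𝔞 → ℝ) = 0 := h0
    have := congrFun (hδ.symm.trans h0') (coroot α)
    rw [Pi.sub_apply, hγα, h2, Pi.zero_apply] at this
    norm_num at this
  have hmadd : ∀ x y, m (x + y) = m x + m y := map_add (m : 𝔤 →ₗ⁅ℝ⁆ 𝔤)
  have hmsmul : ∀ (c : ℝ) x, m (c • x) = c • m x := map_smul (m : 𝔤 →ₗ⁅ℝ⁆ 𝔤)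
  have hθadd : ∀ x y, θ (x + y) = θ x + θ y := map_add (θ : 𝔤 →ₗ⁅ℝ⁆ 𝔤)
  have hθsmul : ∀ (c : ℝ) x, θ (c • x) = c • θ x := map_smul (θ : 𝔤 →ₗ⁅ℝ⁆ 𝔤)
  have hθ1 : θ (e₁ + θ e₁) = e₁ + θ e₁ := hθ.add_map_fixed e₁
  have hθ2 : θ (e₂ + θ e₂) = e₂ + θ e₂ := hθ.add_map_fixed e₂
  obtain ⟨x, hx, hx0⟩ := exists_ne_zero γ
  have hσodd : ∀ {ε : Weight ℝ 𝔞 𝔤} {x : 𝔤}, x ∈ rootSpace 𝔞 ε → ε (coroot α) = 1 →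
      σ x = -x := by
    intro ε x hx hε
    rw [d.sigma ε x hx, hε, one_mul, Real.cos_pi, neg_one_smul]
  have hσadd : ∀ x y, σ (x + y) = σ x + σ y := map_add (σ : 𝔤 →ₗ⁅ℝ⁆ 𝔤)
  have hσw : σ (x + θ x) = -(x + θ x) := by
    have h4 : θ (-x) = -θ x := map_neg (θ : 𝔤 →ₗ⁅ℝ⁆ 𝔤) _
    rw [hσadd, groupK_comm d.sigma_mem.1, hσodd hx hγα, h4, neg_add]
  have hodd := d.lie_lie_odd hθ h hσw
  have hoddx := d.lie_lie_odd hθ h (hσodd hx hγα)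
  have hl := d.lie_eq_zero hθ h
  -- the two steps from `γ` to `-γ`
  have hβx : ⁅e₂ + θ e₂, x⁆ = ⁅θ e₂, x⁆ := by
    rw [add_lie, h.long₂.lie_eq_zero_of_one h.nonzero₂ hγβ d.mem₂ hx, zero_add]
  have hαx : ⁅e₁ + θ e₁, x⁆ = ⁅θ e₁, x⁆ := by
    rw [add_lie, h.long₁.lie_eq_zero_of_one h.nonzero₁ hγα d.mem₁ hx, zero_add]
  have hβx' : ⁅θ e₂, x⁆ ∈ rootSpace 𝔞 (-δ : Weight ℝ 𝔞 𝔤) := by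
    have := lie_mem_add (hθ.map_mem d.mem₂) hx
    rwa [show (-(β : 𝔞 → ℝ)) + γ = (-δ : Weight ℝ 𝔞 𝔤) by
      rw [Weight.coe_neg, hδ, hsum]; ring] at this
  have hαx' : ⁅θ e₁, x⁆ ∈ rootSpace 𝔞 δ := by
    have := lie_mem_add (hθ.map_mem d.mem₁) hx
    rwa [show (-(α : 𝔞 → ℝ)) + γ = δ by rw [hδ]; ring] at this
  have hδα : (-δ) (coroot α) = 1 := by
    rw [Weight.coe_neg, hδ, Pi.neg_apply, Pi.sub_apply, hγα, h2]; norm_num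
  -- Only the lowering parts act: `θ e₂` leads from `γ` to `γ - β = -δ`, and `θ e₁` from there to
  -- `-γ`.
  have hABx : ∃ c : ℝ, ⁅e₁ + θ e₁, ⁅e₂ + θ e₂, x⁆⁆ = c • θ x := by
    have hθx0 : θ x ≠ 0 := fun h0 => hx0 (by
      rw [← hθ.involutive x, h0]; exact map_zero (θ : 𝔤 →ₗ⁅ℝ⁆ 𝔤))
    refine exists_eq_smul hγ0.neg (hθ.map_mem hx) hθx0 ?_
    rw [hβx, add_lie, h.long₁.lie_eq_zero_of_one h.nonzero₁ hδα d.mem₁ hβx', zero_add]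
    have := lie_mem_add (hθ.map_mem d.mem₁) hβx'
    rwa [show (-(α : 𝔞 → ℝ)) + (-δ : Weight ℝ 𝔞 𝔤) = (-γ : Weight ℝ 𝔞 𝔤) by
      rw [Weight.coe_neg, Weight.coe_neg, hδ]; ring] at this
  obtain ⟨c, hc⟩ := hABx
  have hcw : ⁅e₁ + θ e₁, ⁅e₂ + θ e₂, x + θ x⁆⁆ = c • (x + θ x) := by
    have h3 : ⁅e₁ + θ e₁, ⁅e₂ + θ e₂, θ x⁆⁆ = c • x := by
      have := congrArg θ hc
      rwa [LieEquiv.map_lie, LieEquiv.map_lie, hθ1, hθ2, hθsmul, hθ.involutive] at this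
    rw [lie_add, lie_add, hc, h3, smul_add, add_comm]
  set w := x + θ x with hw
  have hw0 : w ≠ 0 := by
    intro h0
    have e1 : ⁅(coroot α : 𝔤), x⁆ = γ (coroot α) • x := lie_eq_smul_of_mem_rootSpace hx _
    have e2 : ⁅(coroot α : 𝔤), θ x⁆ = (-γ) (coroot α) • θ x :=
      lie_eq_smul_of_mem_rootSpace (hθ.map_mem hx) _
    have h3 : ⁅(coroot α : 𝔤), w⁆ = x - θ x := by
      rw [hw, lie_add, e1, e2, Weight.coe_neg, Pi.neg_apply, hγα, one_smul, neg_one_smul,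
        sub_eq_add_neg]
    rw [h0, lie_zero] at h3
    have h5 : (2 : ℝ) • x = 0 := by
      rw [show (2 : ℝ) • x = (x + θ x) + (x - θ x) by module, ← hw, h0, ← h3, add_zero]
    exact hx0 ((smul_eq_zero_iff_right (two_ne_zero)).1 h5)
  set Y₁ := e₁ + θ e₁ with hY1
  set Y₂ := e₂ + θ e₂ with hY2
  have hcomm : ∀ y : 𝔤, ⁅Y₁, ⁅Y₂, y⁆⁆ = ⁅Y₂, ⁅Y₁, y⁆⁆ := by
    intro y; rw [leibniz_lie, hl, zero_lie, zero_add]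
  have hB : ⁅Y₂, w⁆ = -(c • ⁅Y₁, w⁆) := by
    have h3 : ⁅Y₁, ⁅Y₁, ⁅Y₂, w⁆⁆⁆ = -⁅Y₂, w⁆ := by rw [hcomm w, hcomm, hodd.1, lie_neg]
    rw [hcw, lie_smul] at h3
    rw [h3, neg_neg]
  have hcc : c * c = 1 := by
    have h3 : ⁅Y₂, ⁅Y₂, w⁆⁆ = -(c * c) • w := by
      rw [hB, lie_neg, lie_smul, ← hcomm, hcw, smul_smul, neg_smul]
    rw [hodd.2] at h3
    have h4 : (c * c - 1) • w = 0 := by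
      rw [show (c * c - 1) • w = -w - -(c * c) • w by module, h3, sub_self]
    rcases smul_eq_zero.1 h4 with h4 | h4
    · linarith
    · exact absurd h4 hw0
  -- Since `Y₁Y₂ w = c w` with `c = ±1`, `Y₂ w = -c Y₁ w`, so this `Z` kills `w` and `⁅Y₁, w⁆`,
  -- which span the odd part of `𝔨`. It also kills the even part, so it is central and fixed by `K`,
  -- while `m Z = s Z`.
  set Z := Y₁ + c • Y₂ with hZ
  have hZw : ⁅Z, w⁆ = 0 := by
    rw [hZ, add_lie, smul_lie, hB, smul_neg, smul_smul, hcc, one_smul, add_neg_cancel]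
  have hZv : ⁅Z, ⁅Y₁, w⁆⁆ = 0 := by
    have : ⁅Z, Y₁⁆ = 0 := by
      rw [hZ, add_lie, smul_lie, lie_self, ← lie_skew, hl]; simp
    rw [leibniz_lie, this, hZw, zero_lie, lie_zero, add_zero]
  have hv : ⁅Y₁, w⁆ = ⁅θ e₁, x⁆ + θ ⁅θ e₁, x⁆ := by
    rw [hw, lie_add, hαx]
    congr 1
    have := congrArg θ hαx
    rwa [LieEquiv.map_lie, hθ1] at this
  have hv0 : ⁅θ e₁, x⁆ ≠ 0 := by
    intro h0
    have := hoddx.1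
    rw [hαx, h0, lie_zero] at this
    exact hx0 (neg_eq_zero.1 this.symm)
  -- `Z` is central in `𝔨`
  have hcone : ∀ {ε η : Weight ℝ 𝔞 𝔤} {u y : 𝔤}, η.IsNonZero → u ∈ rootSpace 𝔞 η → u ≠ 0 →
      ⁅Z, u + θ u⁆ = 0 → ((ε : 𝔞 → ℝ) = η ∨ (ε : 𝔞 → ℝ) = -η) → y ∈ rootSpace 𝔞 ε →
      ⁅Z, y + θ y⁆ = 0 := by
    intro ε η u y hη hu hu0 hZu hε hy
    rcases hε with hε | hε
    · obtain ⟨k, rfl⟩ := exists_eq_smul hη hu hu0 (hε ▸ hy)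
      rw [hθsmul, ← smul_add, lie_smul, hZu, smul_zero]
    · have hθy : θ y ∈ rootSpace 𝔞 η := by
        have := hθ.map_mem hy
        rwa [hε, neg_neg] at this
      obtain ⟨k, hk⟩ := exists_eq_smul hη hu hu0 hθy
      rw [← hθ.involutive y, hk, hθsmul, hθsmul, hθ.involutive, ← smul_add, add_comm, lie_smul, hZu,
        smul_zero]
  have hcent : ∀ X, θ X = X → ⁅X, Z⁆ = 0 := by
    intro X hX
    let T : 𝔤 →ₗ[ℝ] 𝔤 := ad ℝ 𝔤 Z ∘ₗ (LinearMap.id + ((θ : 𝔤 →ₗ⁅ℝ⁆ 𝔤) : 𝔤 →ₗ[ℝ] 𝔤)) ∘ₗ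
      (LinearMap.id - ((σ : 𝔤 →ₗ⁅ℝ⁆ 𝔤) : 𝔤 →ₗ[ℝ] 𝔤))
    have hT : T = 0 := by
      refine linearMap_ext_rootSpace (𝔞 := 𝔞) fun ε y hy => ?_
      change ⁅Z, (y - σ y) + θ (y - σ y)⁆ = 0
      have hsy : y - σ y = (1 - Real.cos (ε (coroot α) * Real.pi)) • y := by
        rw [d.sigma ε y hy, sub_smul, one_smul]
      by_cases hε : ε.IsNonZero
      · rcases hall ε hε with h1 | h1
        · have : Real.cos (ε (coroot α) * Real.pi) = 1 := by
            rcases h1 with h1 | h1 | h1 | h1 <;> simp [h1, h2, h.orth]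
          rw [hsy, this, sub_self, zero_smul]
          exact (congrArg _ ((zero_add _).trans (map_zero (θ : 𝔤 →ₗ⁅ℝ⁆ 𝔤)))).trans (lie_zero _)
        · rw [hsy, hθsmul, ← smul_add, lie_smul]
          rcases or_assoc.2 h1 with h1 | h1
          · rw [hcone hγ0 hx hx0 hZw h1 hy, smul_zero]
          · rw [hcone hδ0 hαx' hv0 (hv ▸ hZv) h1 hy, smul_zero]
      · have hε' : (ε : 𝔞 → ℝ) = 0 := not_not.1 hε
        have : Real.cos (ε (coroot α) * Real.pi) = 1 := by simp [hε']
        rw [hsy, this, sub_self, zero_smul]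
        exact (congrArg _ ((zero_add _).trans (map_zero (θ : 𝔤 →ₗ⁅ℝ⁆ 𝔤)))).trans (lie_zero _)
    have h3 : ⁅Z, (X - σ X) + θ (X - σ X)⁆ = 0 := LinearMap.congr_fun hT X
    have h4 : θ (X - σ X) = X - σ X := by
      have : θ (X - σ X) = θ X - θ (σ X) := map_sub (θ : 𝔤 →ₗ⁅ℝ⁆ 𝔤) _ _
      rw [this, ← groupK_comm d.sigma_mem.1, hX]
    have h5 := d.lie_even hθ h (x := X + σ X)
      (by rw [hθadd, ← groupK_comm d.sigma_mem.1, hX])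
      (by rw [hσadd, d.sigma_sigma hθ h, add_comm])
    have h6 : ⁅Z, X + σ X⁆ = 0 := by
      rw [hZ, add_lie, smul_lie, h5.1, h5.2, smul_zero, add_zero]
    rw [h4, ← two_smul ℝ, lie_smul] at h3
    have h7 := (smul_eq_zero_iff_right (two_ne_zero)).1 h3
    rw [← lie_skew, neg_eq_zero]
    have h8 : (2 : ℝ) • ⁅Z, X⁆ = 0 := by
      rw [← lie_smul, show (2 : ℝ) • X = (X + σ X) + (X - σ X) by module, lie_add, h6, h7, add_zero]
    exact (smul_eq_zero_iff_right (two_ne_zero)).1 h8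
  have hfix := groupK_fix hcent hm.1
  have hmY1 : m Y₁ = s • Y₁ := by
    rw [hY1, hmadd, hs _ d.mem₁, (hs.neg hθ hm) _ (hθ.map_mem d.mem₁), smul_add]
  have hmY2 : m Y₂ = s • Y₂ := by
    rw [hY2, hmadd, hsβ _ d.mem₂, (hsβ.neg hθ hm) _ (hθ.map_mem d.mem₂), smul_add]
  rw [hZ, hmadd, hmsmul, hmY1, hmY2, smul_comm, ← smul_add, ← hZ] at hfix
  have hZ0 : Z ≠ 0 := by
    intro h0
    have a1 : ⁅(coroot α : 𝔤), e₁⁆ = α (coroot α) • e₁ := lie_eq_smul_of_mem_rootSpace d.mem₁ _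
    have a2 : ⁅(coroot α : 𝔤), θ e₁⁆ = (-α) (coroot α) • θ e₁ :=
      lie_eq_smul_of_mem_rootSpace (hθ.map_mem d.mem₁) _
    have b1 : ⁅(coroot α : 𝔤), e₂⁆ = β (coroot α) • e₂ := lie_eq_smul_of_mem_rootSpace d.mem₂ _
    have b2 : ⁅(coroot α : 𝔤), θ e₂⁆ = (-β) (coroot α) • θ e₂ :=
      lie_eq_smul_of_mem_rootSpace (hθ.map_mem d.mem₂) _
    rw [Weight.coe_neg, Pi.neg_apply, h2] at a2
    rw [Weight.coe_neg, Pi.neg_apply, h.orth, neg_zero, zero_smul] at b2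
    rw [h2] at a1
    rw [h.orth, zero_smul] at b1
    -- With `H` the action of the coroot, `H² + 2H` kills its eigenvalues `0` and `-2` and isolates
    -- the component `e₁` of `Z`.
    have h3 : ⁅(coroot α : 𝔤), ⁅(coroot α : 𝔤), Z⁆⁆ + (2 : ℝ) • ⁅(coroot α : 𝔤), Z⁆ = (8 : ℝ) • e₁ := by
      simp only [hZ, hY1, hY2, lie_add, lie_smul, a1, a2, b1, b2, add_zero, smul_zero]
      module
    rw [h0, lie_zero, lie_zero, smul_zero, add_zero] at h3
    exact d.triple₁.e_ne_zero ((smul_eq_zero_iff_right (by norm_num)).1 h3.symm)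
  have h9 : (s - 1) • Z = 0 := by rw [sub_smul, hfix, one_smul, sub_self]
  rcases smul_eq_zero.1 h9 with h9 | h9
  · linarith
  · exact absurd h9 hZ0

end RealFlag

/-! ### Coordinates on root systems and partners of roots -/

namespace RealFlag

open LieAlgebra LieAlgebra.IsKilling GenCplx

variable {𝔤 : Type*} [LieRing 𝔤] [LieAlgebra ℝ 𝔤] [FiniteDimensional ℝ 𝔤]
variable [IsKilling ℝ 𝔤]
variable {𝔞 : LieSubalgebra ℝ 𝔤} [𝔞.IsCartanSubalgebra] [IsTriangularizable ℝ 𝔞 𝔤]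
variable {θ : 𝔤 ≃ₗ⁅ℝ⁆ 𝔤} {α β γ δ : Weight ℝ 𝔞 𝔤}

lemma exists_dual_vectors {ι : Type*} [DecidableEq ι] {l : ι → Dual ℝ 𝔞}
    (hl : LinearIndependent ℝ l) : ∃ x : ι → 𝔞, ∀ i j, l i (x j) = if i = j then 1 else 0 := by
  obtain ⟨G, hG⟩ := LinearMap.exists_leftInverse_of_injective (Finsupp.linearCombination ℝ l)
    (LinearMap.ker_eq_bot.2 hl)
  refine ⟨fun j => (evalEquiv ℝ 𝔞).symm (Finsupp.lapply j ∘ₗ G), fun i j => ?_⟩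
  have h1 := LinearMap.congr_fun hG (Finsupp.single i 1)
  simp only [LinearMap.comp_apply, Finsupp.linearCombination_single, one_smul,
    LinearMap.id_apply] at h1
  rw [← Dual.eval_apply, ← evalEquiv_toLinearMap]
  simp [h1, Finsupp.single_apply]

lemma exists_weight_iff {f : Dual ℝ 𝔞} :
    f ∈ Set.range (rootSystem 𝔞).root ↔ ∃ γ : Weight ℝ 𝔞 𝔤, γ.IsNonZero ∧ ∀ h, γ h = f h := by
  constructor
  · rintro ⟨γ, rfl⟩
    exact ⟨γ.1, LieSubalgebra.isNonZero_coe_root γ, fun h => by simp⟩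
  · rintro ⟨γ, hγ, h⟩
    refine ⟨⟨γ, by simpa using hγ⟩, ?_⟩
    ext y
    simp [h]

/-- The coroot is determined by its reflection preserving the roots. -/
lemma coroot_eq_of_reflection (hα : α.IsNonZero) {y : 𝔞} (h2 : α y = 2)
    (hy : ∀ γ : Weight ℝ 𝔞 𝔤, γ.IsNonZero →
      ∃ δ : Weight ℝ 𝔞 𝔤, δ.IsNonZero ∧ ∀ h, δ h = γ h - γ y * α h) : coroot α = y := by
  have hspan : Submodule.span ℝ (Set.range (rootSystem 𝔞).root) = ⊤ :=
    RootPairing.IsRootSystem.span_root_eq_top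
  have hmaps : ∀ y : 𝔞, (∀ γ : Weight ℝ 𝔞 𝔤, γ.IsNonZero →
      ∃ δ : Weight ℝ 𝔞 𝔤, δ.IsNonZero ∧ ∀ h, δ h = γ h - γ y * α h) →
      Set.MapsTo (preReflection (Weight.toLinear ℝ 𝔞 𝔤 α) (Dual.eval ℝ 𝔞 y))
        (Set.range (rootSystem 𝔞).root) (Set.range (rootSystem 𝔞).root) := by
    intro y hy f hf
    obtain ⟨γ, hγ, h⟩ := exists_weight_iff.1 hf
    obtain ⟨δ, hδ, h'⟩ := hy γ hγ
    refine exists_weight_iff.2 ⟨δ, hδ, fun z => ?_⟩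
    rw [h', preReflection_apply, LinearMap.sub_apply, LinearMap.smul_apply, Dual.eval_apply, ← h,
      ← h, smul_eq_mul, Weight.toLinear_apply]
  have := Module.Dual.eq_of_preReflection_mapsTo (R := ℝ) (x := Weight.toLinear ℝ 𝔞 𝔤 α)
    (Set.finite_range (rootSystem 𝔞).root) hspan (f := Dual.eval ℝ 𝔞 (coroot α))
    (g := Dual.eval ℝ 𝔞 y) (root_apply_coroot hα)
    (hmaps _ fun γ hγ => ⟨reflectRoot α γ, reflectRoot_isNonZero α γ hγ, fun h => rfl⟩) h2 (hmaps y hy)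
  exact eval_apply_injective ℝ this

/-- The root `β` represents the only other pair of opposite roots with the character of `α`. -/
structure IsPartner (θ : 𝔤 ≃ₗ⁅ℝ⁆ 𝔤) (α β : Weight ℝ 𝔞 𝔤) : Prop where
  nonzero : β.IsNonZero
  ne : β ≠ α
  ne_neg : β ≠ -α
  charEq : CharEq 𝔞 θ α β
  unique : ∀ γ : Weight ℝ 𝔞 𝔤, γ.IsNonZero → CharEq 𝔞 θ α γ → γ = α ∨ γ = -α ∨ γ = β ∨ γ = -β

/-! ### Root systems of type `D` -/

/-- The root `γ` is `u l_p + v l_q` with signs `u`, `v`. -/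
structure IsSigned {n : ℕ} (l : Fin n → Dual ℝ 𝔞) (γ : Weight ℝ 𝔞 𝔤) (p q : Fin n) (u v : ℝ) :
    Prop where
  ne : p ≠ q
  left : u = 1 ∨ u = -1
  right : v = 1 ∨ v = -1
  eq : ∀ h, γ h = u * l p h + v * l q h

/-- The roots are the combinations `± l_p ± l_q`, and the `l_p` have a dual family `x`. -/
structure IsSignedSystem {n : ℕ} (l : Fin n → Dual ℝ 𝔞) (x : Fin n → 𝔞) : Prop where
  dual : ∀ i j, l i (x j) = if i = j then 1 else 0
  exists_signed : ∀ γ : Weight ℝ 𝔞 𝔤, γ.IsNonZero → ∃ p q u v, IsSigned l γ p q u v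
  exists_weight : ∀ p q (u v : ℝ), p ≠ q → (u = 1 ∨ u = -1) → (v = 1 ∨ v = -1) →
    ∃ γ : Weight ℝ 𝔞 𝔤, γ.IsNonZero ∧ IsSigned l γ p q u v

section Signed

variable {n : ℕ} {l : Fin n → Dual ℝ 𝔞} {x : Fin n → 𝔞} {p q r : Fin n} {u v u' v' : ℝ}

lemma IsSigned.symm (h : IsSigned l γ p q u v) : IsSigned l γ q p v u :=
  ⟨h.ne.symm, h.right, h.left, fun y => by rw [h.eq, add_comm]⟩

lemma IsSigned.neg (h : IsSigned l γ p q u v) : IsSigned l (-γ) p q (-u) (-v) :=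
  ⟨h.ne, by rcases h.left with h | h <;> simp [h], by rcases h.right with h | h <;> simp [h],
    fun y => by rw [Weight.coe_neg, Pi.neg_apply, h.eq]; ring⟩

lemma IsSigned.ext (h : IsSigned l γ p q u v) (h' : IsSigned l δ p q u v) : γ = δ :=
  DFunLike.ext _ _ fun y => by rw [h.eq, h'.eq]

variable (S : IsSignedSystem l x)

include S

lemma IsSigned.apply_left (h : IsSigned l γ p q u v) : γ (x p) = u := by
  rw [h.eq, S.dual, S.dual, if_pos rfl, if_neg h.ne.symm]; ring

lemma IsSigned.apply_right (h : IsSigned l γ p q u v) : γ (x q) = v := h.symm.apply_left S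

lemma IsSigned.apply_other (h : IsSigned l γ p q u v) (hp : r ≠ p) (hq : r ≠ q) : γ (x r) = 0 := by
  rw [h.eq, S.dual, S.dual, if_neg hp.symm, if_neg hq.symm]; ring

/-- The reflection built from the candidate exchanges `l_p` and `l_q` up to a common sign `-(uv)`
and fixes the others, so it preserves the roots; this identifies the coroot. -/
lemma IsSigned.coroot_eq (hγ : γ.IsNonZero) (h : IsSigned l γ p q u v) :
    coroot γ = u • x p + v • x q := by
  have huu : u * u = 1 := by rcases h.left with h | h <;> simp [h]
  have hvv : v * v = 1 := by rcases h.right with h | h <;> simp [h]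
  have happ : ∀ δ : Weight ℝ 𝔞 𝔤, ∀ y z : 𝔞, ∀ a b : ℝ, δ (a • y + b • z) = a * δ y + b * δ z := by
    intro δ y z a b
    have := map_add (Weight.toLinear ℝ 𝔞 𝔤 δ) (a • y) (b • z)
    rwa [map_smul, map_smul] at this
  refine coroot_eq_of_reflection hγ ?_ fun δ hδ => ?_
  · rw [happ, h.apply_left S, h.apply_right S, huu, hvv]; norm_num
  obtain ⟨p', q', u', v', h'⟩ := S.exists_signed δ hδ
  -- the reflection permutes the `l_k` up to sign
  have hrefl : ∀ k, ∃ ε : ℝ, (ε = 1 ∨ ε = -1) ∧ ∀ y, l k y - (u * l k (x p) + v * l k (x q)) *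
      (u * l p y + v * l q y) = ε * l (Equiv.swap p q k) y := by
    intro k
    have huv : -(u * v) = 1 ∨ -(u * v) = -1 := by
      rcases h.left with h1 | h1 <;> rcases h.right with h2 | h2 <;> simp [h1, h2]
    by_cases hp : k = p
    · subst hp
      refine ⟨-(u * v), huv, fun y => ?_⟩
      rw [Equiv.swap_apply_left, S.dual, S.dual, if_pos rfl, if_neg h.ne]
      linear_combination (-l k y) * huu
    by_cases hq : k = q
    · subst hq
      refine ⟨-(u * v), huv, fun y => ?_⟩
      rw [Equiv.swap_apply_right, S.dual, S.dual, if_pos rfl, if_neg h.ne.symm]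
      linear_combination (-l k y) * hvv
    · refine ⟨1, Or.inl rfl, fun y => ?_⟩
      rw [Equiv.swap_apply_of_ne_of_ne hp hq, S.dual, S.dual, if_neg hp, if_neg hq]
      ring
  obtain ⟨ε, hε, e1⟩ := hrefl p'
  obtain ⟨η, hη, e2⟩ := hrefl q'
  have hmul : ∀ a b : ℝ, (a = 1 ∨ a = -1) → (b = 1 ∨ b = -1) → (a * b = 1 ∨ a * b = -1) := by
    rintro a b (rfl | rfl) (rfl | rfl) <;> norm_num
  obtain ⟨κ, hκ, hk⟩ := S.exists_weight (Equiv.swap p q p') (Equiv.swap p q q') (u' * ε) (v' * η)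
    (fun h0 => h'.ne ((Equiv.swap p q).injective h0)) (hmul _ _ h'.left hε) (hmul _ _ h'.right hη)
  refine ⟨κ, hκ, fun y => ?_⟩
  rw [hk.eq, happ, h'.eq, h'.eq, h'.eq, h.eq]
  linear_combination (-u') * e1 y - v' * e2 y

lemma IsSigned.apply_coroot (hγ : γ.IsNonZero) (h : IsSigned l γ p q u v) (δ : Weight ℝ 𝔞 𝔤) :
    δ (coroot γ) = u * δ (x p) + v * δ (x q) := by
  have := map_add (Weight.toLinear ℝ 𝔞 𝔤 δ) (u • x p) (v • x q)
  rw [map_smul, map_smul] at this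
  rw [h.coroot_eq S hγ]
  exact this

/-- The relative position of two index pairs. -/
lemma IsSignedSystem.position (hpq : p ≠ q) (hδ : δ.IsNonZero) :
    (∃ u v, IsSigned l δ p q u v) ∨ (∃ r u v, r ≠ p ∧ r ≠ q ∧ IsSigned l δ p r u v) ∨
    (∃ r u v, r ≠ p ∧ r ≠ q ∧ IsSigned l δ q r u v) ∨
    (∃ r s u v, r ≠ p ∧ r ≠ q ∧ s ≠ p ∧ s ≠ q ∧ IsSigned l δ r s u v) := by
  obtain ⟨r, s, u, v, h⟩ := S.exists_signed δ hδ
  by_cases hrp : r = p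
  · subst hrp
    by_cases hsq : s = q
    · subst hsq; exact Or.inl ⟨u, v, h⟩
    · exact Or.inr (Or.inl ⟨s, u, v, h.ne.symm, hsq, h⟩)
  by_cases hrq : r = q
  · subst hrq
    by_cases hsp : s = p
    · subst hsp; exact Or.inl ⟨v, u, h.symm⟩
    · exact Or.inr (Or.inr (Or.inl ⟨s, u, v, hsp, h.ne.symm, h⟩))
  by_cases hsp : s = p
  · subst hsp; exact Or.inr (Or.inl ⟨r, v, u, hrp, hrq, h.symm⟩)
  by_cases hsq : s = q
  · subst hsq; exact Or.inr (Or.inr (Or.inl ⟨r, v, u, hrp, hrq, h.symm⟩))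
  · exact Or.inr (Or.inr (Or.inr ⟨r, s, u, v, hrp, hrq, hsp, hsq, h⟩))

lemma IsSigned.isLong (hγ : γ.IsNonZero) (h : IsSigned l γ p q u v) : IsLong γ := by
  intro δ
  by_cases hδ : δ.IsNonZero
  · rw [h.apply_coroot S hγ]
    rcases S.position h.ne hδ with ⟨a, b, h'⟩ | ⟨r, a, b, h1, h2, h'⟩ | ⟨r, a, b, h1, h2, h'⟩ |
      ⟨r, s, a, b, h1, h2, h3, h4, h'⟩
    · rw [h'.apply_left S, h'.apply_right S]
      have e1 := h.eq
      have e2 := h'.eq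
      rcases h.left with rfl | rfl <;> rcases h.right with rfl | rfl <;>
        rcases h'.left with rfl | rfl <;> rcases h'.right with rfl | rfl <;>
        first
        | (left; funext y; rw [e1, e2]; done)
        | (right; left; funext y; rw [Pi.neg_apply, e1, e2] <;> ring1)
        | (right; right; left; norm_num)
    · rw [h'.apply_left S, h'.apply_other S h.ne.symm h2.symm]
      rcases h.left with rfl | rfl <;> rcases h'.left with rfl | rfl <;> norm_num
    · rw [h'.apply_left S, h'.apply_other S h.ne h1.symm]
      rcases h.right with rfl | rfl <;> rcases h'.left with rfl | rfl <;> norm_num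
    · rw [h'.apply_other S h1.symm h3.symm, h'.apply_other S h2.symm h4.symm]
      norm_num
  · have h0 : (δ : 𝔞 → ℝ) = 0 := not_not.1 hδ
    right; right; left
    rw [h0, Pi.zero_apply]

lemma IsSigned.isLongPair (hα : α.IsNonZero) (hβ : β.IsNonZero) (h : IsSigned l α p q u v)
    (h' : IsSigned l β p q u (-v)) : IsLongPair α β where
  nonzero₁ := hα
  nonzero₂ := hβ
  long₁ := h.isLong S hα
  long₂ := h'.isLong S hβ
  orth := by
    rw [h.apply_coroot S hα, h'.apply_left S, h'.apply_right S]
    rcases h.left with rfl | rfl <;> rcases h.right with rfl | rfl <;> norm_num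
  cases γ hγ := by
    rw [h.apply_coroot S hα, h'.apply_coroot S hβ]
    rcases S.position h.ne hγ with ⟨a, b, hγ'⟩ | ⟨r, a, b, h1, h2, hγ'⟩ | ⟨r, a, b, h1, h2, hγ'⟩ |
      ⟨r, s, a, b, h1, h2, h3, h4, hγ'⟩
    · have e1 := h.eq
      have e2 := h'.eq
      have e3 := hγ'.eq
      rcases h.left with rfl | rfl <;> rcases h.right with rfl | rfl <;>
        rcases hγ'.left with rfl | rfl <;> rcases hγ'.right with rfl | rfl <;>
        first
        | (left; funext y; rw [e1, e3]; done)
        | (right; left; funext y; rw [Pi.neg_apply, e1, e3] <;> ring1)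
        | (right; right; left; funext y; rw [e2, e3] <;> ring1)
        | (right; right; right; left; funext y; rw [Pi.neg_apply, e2, e3] <;> ring1)
    · rw [hγ'.apply_left S, hγ'.apply_other S h.ne.symm h2.symm]
      rcases h.left with rfl | rfl <;> rcases hγ'.left with rfl | rfl <;> norm_num
    · rw [hγ'.apply_left S, hγ'.apply_other S h.ne h1.symm]
      rcases h.right with rfl | rfl <;> rcases hγ'.left with rfl | rfl <;> norm_num
    · rw [hγ'.apply_other S h1.symm h3.symm, hγ'.apply_other S h2.symm h4.symm]
      norm_num

/-- Separation of characters when exactly one index is shared. -/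
lemma IsSigned.not_charEq (hθ : IsCartanInvolution 𝔞 θ) (h : IsSigned l α p q u v)
    (hr' : r ≠ q) (h' : IsSigned l γ p r u' v') : ¬ CharEq 𝔞 θ α γ := by
  intro hc
  -- Test root `l_p + l_q`: its coroot pairs evenly with `α` and oddly with `γ`.
  obtain ⟨δ, hδ, hs⟩ := S.exists_weight p q 1 1 h.ne (Or.inl rfl) (Or.inl rfl)
  have := hc.cos_eq hθ hδ (hs.isLong S hδ)
  rw [hs.apply_coroot S hδ, hs.apply_coroot S hδ, h.apply_left S, h.apply_right S, h'.apply_left S,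
    h'.apply_other S h.ne.symm hr'.symm] at this
  have h0 : Real.cos ((1 * u' + 1 * 0) * Real.pi) = -1 := by
    rcases h'.left with rfl | rfl <;> simp
  have h1 : Real.cos ((1 * u + 1 * v) * Real.pi) = 1 := by
    rcases h.left with rfl | rfl <;> rcases h.right with rfl | rfl <;> norm_num
  rw [h0, h1] at this
  norm_num at this

/-- Separation of characters when no index is shared, but there is a fifth index. -/
lemma IsSigned.not_charEq_of_disjoint (hθ : IsCartanInvolution 𝔞 θ) (h : IsSigned l α p q u v)
    {r s t : Fin n} (hr : r ≠ p) (hs : s ≠ p) (htp : t ≠ p) (htq : t ≠ q)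
    (htr : t ≠ r) (hts : t ≠ s) (h' : IsSigned l γ r s u' v') : ¬ CharEq 𝔞 θ α γ := by
  intro hc
  -- Test root `l_p + l_t`: it shares one index with `α` and none with `γ`.
  obtain ⟨δ, hδ, hd⟩ := S.exists_weight p t 1 1 htp.symm (Or.inl rfl) (Or.inl rfl)
  have := hc.cos_eq hθ hδ (hd.isLong S hδ)
  rw [hd.apply_coroot S hδ, hd.apply_coroot S hδ, h.apply_left S, h.apply_other S htp htq,
    h'.apply_other S hr.symm hs.symm, h'.apply_other S htr hts] at this
  have h1 : Real.cos ((1 * u + 1 * 0) * Real.pi) = -1 := by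
    rcases h.left with rfl | rfl <;> simp
  rw [h1] at this
  norm_num at this

/-- The hypothesis on `n` enters through disjoint index pairs: for `n = 3` there are none, and for
`n ≥ 5` a fifth index separates them. -/
lemma IsSignedSystem.exists_isPartner (hn : n = 3 ∨ 5 ≤ n) (hθ : IsCartanInvolution 𝔞 θ)
    (hα : α.IsNonZero) : ∃ β, IsPartner θ α β := by
  obtain ⟨p, q, u, v, h⟩ := S.exists_signed α hα
  have hv' : -v = 1 ∨ -v = -1 := by rcases h.right with h | h <;> simp [h]
  obtain ⟨β, hβ, h'⟩ := S.exists_weight p q u (-v) h.ne h.left hv'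
  have hv0 : v ≠ 0 := by rcases h.right with h | h <;> simp [h]
  have hu0 : u ≠ 0 := by rcases h.left with h | h <;> simp [h]
  have hfresh : ∀ s : Finset (Fin n), s.card < n → ∃ t, t ∉ s := by
    intro s hs
    by_contra! hall
    have := Finset.card_le_card (fun t _ => hall t : Finset.univ ⊆ s)
    rw [Finset.card_univ, Fintype.card_fin] at this
    omega
  obtain ⟨t, ht⟩ := hfresh {p, q} (lt_of_le_of_lt Finset.card_le_two (by omega))
  simp only [Finset.mem_insert, Finset.mem_singleton, not_or] at ht
  obtain ⟨κ, hκ, hk⟩ := S.exists_weight p t 1 1 (Ne.symm ht.1) (Or.inl rfl) (Or.inl rfl)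
  refine ⟨β, hβ, ?_, ?_, ?_, ?_⟩
  · rintro rfl
    have := (h.apply_right S).symm.trans (h'.apply_right S)
    exact hv0 (by linarith)
  · rintro rfl
    have := (h.neg.apply_left S).symm.trans (h'.apply_left S)
    exact hu0 (by linarith)
  · refine (h.isLongPair S hα hβ h').charEq hθ (γ := κ) ?_
    rw [h.apply_coroot S hα, hk.apply_left S, hk.apply_other S h.ne.symm (Ne.symm ht.2)]
    rcases h.left with rfl | rfl <;> norm_num
  · intro γ hγ hc
    rcases S.position h.ne hγ with ⟨a, b, hγ'⟩ | ⟨r, a, b, h1, h2, hγ'⟩ | ⟨r, a, b, h1, h2, hγ'⟩ |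
      ⟨r, s, a, b, h1, h2, h3, h4, hγ'⟩
    · have hsgn : ∀ a b : ℝ, (a = 1 ∨ a = -1) → (b = 1 ∨ b = -1) → b = a ∨ b = -a := by
        rintro a b (rfl | rfl) (rfl | rfl) <;> norm_num
      rcases hsgn u a h.left hγ'.left with rfl | rfl <;>
        rcases hsgn v b h.right hγ'.right with rfl | rfl
      · exact Or.inl (hγ'.ext h)
      · exact Or.inr (Or.inr (Or.inl (hγ'.ext h')))
      · refine Or.inr (Or.inr (Or.inr (hγ'.ext ?_)))
        simpa using h'.neg
      · exact Or.inr (Or.inl (hγ'.ext h.neg))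
    · exact absurd hc (h.not_charEq S hθ h2 hγ')
    · exact absurd hc (h.symm.not_charEq S hθ h1 hγ')
    · rcases hn with rfl | hn
      · have hne := h.ne
        have hne' := hγ'.ne
        omega
      · obtain ⟨t, ht⟩ := hfresh {p, q, r, s} (lt_of_le_of_lt Finset.card_le_four (by omega))
        simp only [Finset.mem_insert, Finset.mem_singleton, not_or] at ht
        exact absurd hc (h.not_charEq_of_disjoint S hθ h1 h3 ht.1 ht.2.1 ht.2.2.1 ht.2.2.2 hγ')

end Signed

lemma IsTypeD.exists_isPartner {n : ℕ} (hn : 5 ≤ n) (h : IsTypeD 𝔞 n)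
    (hθ : IsCartanInvolution 𝔞 θ) (hα : α.IsNonZero) : ∃ β, IsPartner θ α β := by
  obtain ⟨l, hl, hroot⟩ := h
  obtain ⟨x, hx⟩ := exists_dual_vectors hl
  refine IsSignedSystem.exists_isPartner (l := l) (x := x) ⟨hx, fun γ hγ => ?_, ?_⟩ (Or.inr hn) hθ hα
  · have hmem : Weight.toLinear ℝ 𝔞 𝔤 γ ∈ Set.range (rootSystem 𝔞).root :=
      exists_weight_iff.2 ⟨γ, hγ, fun _ => rfl⟩
    rw [hroot] at hmem
    obtain ⟨i, j, hij, hf⟩ := hmem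
    have he : ∀ f : Dual ℝ 𝔞, Weight.toLinear ℝ 𝔞 𝔤 γ = f → ∀ y, γ y = f y :=
      fun f hf y => LinearMap.congr_fun hf y
    rcases hf with hf | hf | hf | hf
    · exact ⟨i, j, 1, 1, hij.ne, Or.inl rfl, Or.inl rfl, fun y => by
        rw [he _ hf]; simp⟩
    · exact ⟨i, j, -1, -1, hij.ne, Or.inr rfl, Or.inr rfl, fun y => by
        rw [he _ hf]; simp; ring⟩
    · exact ⟨i, j, 1, -1, hij.ne, Or.inl rfl, Or.inr rfl, fun y => by
        rw [he _ hf]; simp; ring⟩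
    · exact ⟨i, j, -1, 1, hij.ne, Or.inr rfl, Or.inl rfl, fun y => by
        rw [he _ hf]; simp; ring⟩
  · have key : ∀ p q (u v : ℝ), p < q → (u = 1 ∨ u = -1) → (v = 1 ∨ v = -1) →
        ∃ γ : Weight ℝ 𝔞 𝔤, γ.IsNonZero ∧ IsSigned l γ p q u v := by
      intro p q u v hpq hu hv
      have hmem : u • l p + v • l q ∈ Set.range (rootSystem 𝔞).root := by
        rw [hroot]
        refine ⟨p, q, hpq, ?_⟩
        rcases hu with rfl | rfl <;> rcases hv with rfl | rfl
        · left; module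
        · right; right; left; module
        · right; right; right; module
        · right; left; module
      obtain ⟨γ, hγ, h⟩ := exists_weight_iff.1 hmem
      exact ⟨γ, hγ, hpq.ne, hu, hv, fun y => by rw [h]; simp⟩
    intro p q u v hpq hu hv
    rcases lt_or_gt_of_ne hpq with h | h
    · exact key p q u v h hu hv
    · obtain ⟨γ, hγ, hs⟩ := key q p v u h hv hu
      exact ⟨γ, hγ, hs.symm⟩

/-- The coordinates of twice the vectors `L_p` with `± L_p ± L_q` the roots of type `A₃ = D₃`. -/
def d3Coord : Fin 3 → Fin 4 → ℤ := ![![1, 1, -1, -1], ![1, -1, 1, -1], ![1, -1, -1, 1]]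

/-- With its converse below, this is the isomorphism `A₃ = D₃` as a finite check; the factor `2`
clears denominators. -/
lemma exists_d3_of_a3 : ∀ i j : Fin 4, i ≠ j → ∃ p q : Fin 3, ∃ u v : ℤˣ, p ≠ q ∧ ∀ k,
    2 * ((if k = i then 1 else 0) - (if k = j then 1 else 0)) =
      (u : ℤ) * d3Coord p k + (v : ℤ) * d3Coord q k := by
  decide

lemma exists_a3_of_d3 : ∀ p q : Fin 3, ∀ u v : ℤˣ, p ≠ q → ∃ i j : Fin 4, i ≠ j ∧ ∀ k,
    2 * ((if k = i then 1 else 0) - (if k = j then 1 else 0)) =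
      (u : ℤ) * d3Coord p k + (v : ℤ) * d3Coord q k := by
  decide

lemma IsTypeA3.exists_isPartner (h : IsTypeA3 𝔞) (hθ : IsCartanInvolution 𝔞 θ)
    (hα : α.IsNonZero) : ∃ β, IsPartner θ α β := by
  obtain ⟨l, hl, hroot⟩ := h
  obtain ⟨x, hx⟩ := exists_dual_vectors hl
  let L : Fin 3 → Dual ℝ 𝔞 := fun p => ∑ k, ((d3Coord p k : ℝ) / 2) • l k
  have hL : ∀ p y, L p y = ∑ k, (d3Coord p k : ℝ) / 2 * l k y := by
    intro p y; simp [L]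
  have hid : ∀ {i j : Fin 4} {p q : Fin 3} {u v : ℤˣ}, (∀ k,
      2 * ((if k = i then 1 else 0) - (if k = j then 1 else 0)) =
      (u : ℤ) * d3Coord p k + (v : ℤ) * d3Coord q k) → ∀ y : 𝔞, l i y - l j y =
        ((u : ℤ) : ℝ) * L p y + ((v : ℤ) : ℝ) * L q y := by
    intro i j p q u v h y
    rw [hL, hL, Finset.mul_sum, Finset.mul_sum, ← Finset.sum_add_distrib]
    have h2 : ∀ k, ((u : ℤ) : ℝ) * ((d3Coord p k : ℝ) / 2 * l k y) +
        ((v : ℤ) : ℝ) * ((d3Coord q k : ℝ) / 2 * l k y) =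
        (if k = i then l k y else 0) - (if k = j then l k y else 0) := by
      intro k
      have h3 := congrArg (Int.cast : ℤ → ℝ) (h k)
      push_cast at h3
      have h4 : (if k = i then l k y else 0) - (if k = j then l k y else 0) =
          ((if k = i then 1 else 0) - (if k = j then 1 else 0)) * l k y := by
        split_ifs <;> ring
      rw [h4]
      linear_combination (-(l k y) / 2) * h3
    rw [Finset.sum_congr rfl fun k _ => h2 k, Finset.sum_sub_distrib]
    simp
  have hunit : ∀ u : ℤˣ, ((u : ℤ) : ℝ) = 1 ∨ ((u : ℤ) : ℝ) = -1 := by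
    intro u
    rcases Int.units_eq_one_or u with rfl | rfl <;> simp
  have hunit' : ∀ u : ℝ, (u = 1 ∨ u = -1) → ∃ w : ℤˣ, ((w : ℤ) : ℝ) = u := by
    rintro u (rfl | rfl)
    · exact ⟨1, by simp⟩
    · exact ⟨-1, by simp⟩
  -- In the simple roots `a_i = l_i - l_{i+1}`, the forms are `L₀ = a₁ + (a₀ + a₂)/2`, `L₁ = (a₀ +
  -- a₂)/2`, `L₂ = (a₀ - a₂)/2`. The vectors given are dual to them, `x i` being dual to `a_i`.
  refine IsSignedSystem.exists_isPartner (l := L) (x := ![x 1, x 0 + x 2 - x 1, x 0 - x 2])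
    ⟨?_, fun γ hγ => ?_, ?_⟩ (Or.inl rfl) hθ hα
  · have e := hx
    have a : ∀ (i : Fin 3) j, l i.castSucc (x j) = l i.succ (x j) + if i = j then 1 else 0 := by
      intro i j
      have := hx i j
      rw [LinearMap.sub_apply] at this
      linarith
    have a0 := a 0
    have a1 := a 1
    have a2 := a 2
    simp only [show (0 : Fin 3).castSucc = (0 : Fin 4) from rfl,
      show (0 : Fin 3).succ = (1 : Fin 4) from rfl, show (1 : Fin 3).castSucc = (1 : Fin 4) from rfl,
      show (1 : Fin 3).succ = (2 : Fin 4) from rfl, show (2 : Fin 3).castSucc = (2 : Fin 4) from rfl,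
      show (2 : Fin 3).succ = (3 : Fin 4) from rfl] at a0 a1 a2
    intro i j
    rw [hL, Fin.sum_univ_four]
    fin_cases i <;> fin_cases j <;> simp [d3Coord, a0, a1, a2] <;> ring
  · have hmem : Weight.toLinear ℝ 𝔞 𝔤 γ ∈ Set.range (rootSystem 𝔞).root :=
      exists_weight_iff.2 ⟨γ, hγ, fun _ => rfl⟩
    rw [hroot] at hmem
    obtain ⟨i, j, hij, hf⟩ := hmem
    obtain ⟨p, q, u, v, hpq, hk⟩ := exists_d3_of_a3 i j hij
    refine ⟨p, q, (u : ℤ), (v : ℤ), hpq, hunit u, hunit v, fun y => ?_⟩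
    rw [← hid hk]
    exact LinearMap.congr_fun hf y
  · intro p q u v hpq hu hv
    obtain ⟨u, rfl⟩ := hunit' u hu
    obtain ⟨v, rfl⟩ := hunit' v hv
    obtain ⟨i, j, hij, hk⟩ := exists_a3_of_d3 p q u v hpq
    have hmem : l i - l j ∈ Set.range (rootSystem 𝔞).root := by
      rw [hroot]; exact ⟨i, j, hij, rfl⟩
    obtain ⟨γ, hγ, h⟩ := exists_weight_iff.1 hmem
    exact ⟨γ, hγ, hpq, hu, hv, fun y => by rw [h, LinearMap.sub_apply, hid hk]⟩

end RealFlag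

namespace RealFlag

open LieAlgebra LieAlgebra.IsKilling GenCplx

variable {𝔤 : Type*} [LieRing 𝔤] [LieAlgebra ℝ 𝔤] [FiniteDimensional ℝ 𝔤]
variable [IsKilling ℝ 𝔤]
variable {𝔞 : LieSubalgebra ℝ 𝔤} [𝔞.IsCartanSubalgebra] [IsTriangularizable ℝ 𝔞 𝔤]
variable {θ : 𝔤 ≃ₗ⁅ℝ⁆ 𝔤} {α β γ δ : Weight ℝ 𝔞 𝔤}

/-! ### Root systems of rank two -/

/-- The coordinates of `γ` with respect to `l₁`, `l₂` are `v`. -/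
def HasCoord (l₁ l₂ : Dual ℝ 𝔞) (γ : Weight ℝ 𝔞 𝔤) (v : ℤ × ℤ) : Prop :=
  ∀ h, γ h = v.1 * l₁ h + v.2 * l₂ h

/-- The roots are the vectors with coordinates in `R`. -/
structure IsPlaneSystem (l₁ l₂ : Dual ℝ 𝔞) (x₁ x₂ : 𝔞) (R : Finset (ℤ × ℤ)) : Prop where
  l₁x₁ : l₁ x₁ = 1
  l₁x₂ : l₁ x₂ = 0
  l₂x₁ : l₂ x₁ = 0
  l₂x₂ : l₂ x₂ = 1
  exists_coord : ∀ γ : Weight ℝ 𝔞 𝔤, γ.IsNonZero → ∃ v ∈ R, HasCoord l₁ l₂ γ v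
  exists_weight : ∀ v ∈ R, ∃ γ : Weight ℝ 𝔞 𝔤, γ.IsNonZero ∧ HasCoord l₁ l₂ γ v

/-- The dot product of integer vectors. -/
def dot (v c : ℤ × ℤ) : ℤ := v.1 * c.1 + v.2 * c.2

/-- The vector `c` is the coroot of `v` in the root system `R`. -/
def IsPlaneCoroot (R : Finset (ℤ × ℤ)) (v c : ℤ × ℤ) : Prop :=
  dot v c = 2 ∧ ∀ w ∈ R, (w.1 - dot w c * v.1, w.2 - dot w c * v.2) ∈ R

instance (R : Finset (ℤ × ℤ)) (v c : ℤ × ℤ) : Decidable (IsPlaneCoroot R v c) := by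
  unfold IsPlaneCoroot; infer_instance

/-- The root `v` with coroot `c` is long in the root system `R`. -/
def IsPlaneLong (R : Finset (ℤ × ℤ)) (v c : ℤ × ℤ) : Prop :=
  ∀ w ∈ R, w = v ∨ w = -v ∨ dot w c = 0 ∨ dot w c = 1 ∨ dot w c = -1

instance (R : Finset (ℤ × ℤ)) (v c : ℤ × ℤ) : Decidable (IsPlaneLong R v c) := by
  unfold IsPlaneLong; infer_instance

section Plane

variable {l₁ l₂ : Dual ℝ 𝔞} {x₁ x₂ : 𝔞} {R : Finset (ℤ × ℤ)} {v w c : ℤ × ℤ}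

lemma HasCoord.ext (h : HasCoord l₁ l₂ γ v) (h' : HasCoord l₁ l₂ δ v) : γ = δ :=
  DFunLike.ext _ _ fun y => by rw [h, h']

lemma HasCoord.neg (h : HasCoord l₁ l₂ γ v) : HasCoord l₁ l₂ (-γ) (-v) := fun y => by
  rw [Weight.coe_neg, Pi.neg_apply, h, Prod.fst_neg, Prod.snd_neg]; push_cast; ring

lemma HasCoord.coe_add {κ : Weight ℝ 𝔞 𝔤} (h : HasCoord l₁ l₂ γ v) (h' : HasCoord l₁ l₂ δ w)
    (h'' : HasCoord l₁ l₂ κ (v + w)) : (κ : 𝔞 → ℝ) = γ + δ := by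
  funext y
  rw [h'', Pi.add_apply, h, h', Prod.fst_add, Prod.snd_add]; push_cast; ring

variable (S : IsPlaneSystem l₁ l₂ x₁ x₂ R)

include S

lemma HasCoord.unique (h : HasCoord l₁ l₂ γ v) (h' : HasCoord l₁ l₂ γ w) : v = w := by
  have e1 := (h x₁).symm.trans (h' x₁)
  have e2 := (h x₂).symm.trans (h' x₂)
  rw [S.l₁x₁, S.l₂x₁] at e1
  rw [S.l₁x₂, S.l₂x₂] at e2
  simp only [mul_one, mul_zero, add_zero, zero_add, Int.cast_inj] at e1 e2
  exact Prod.ext e1 e2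

lemma HasCoord.apply_coroot (hγ : γ.IsNonZero) (h : HasCoord l₁ l₂ γ v) (hc : IsPlaneCoroot R v c)
    (h' : HasCoord l₁ l₂ δ w) : δ (coroot γ) = (dot w c : ℤ) := by
  have hev : ∀ {κ : Weight ℝ 𝔞 𝔤} {w : ℤ × ℤ}, HasCoord l₁ l₂ κ w →
      κ ((c.1 : ℝ) • x₁ + (c.2 : ℝ) • x₂) = (dot w c : ℤ) := by
    intro κ w hw
    rw [hw, map_add, map_add, map_smul, map_smul, map_smul, map_smul, S.l₁x₁, S.l₁x₂, S.l₂x₁,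
      S.l₂x₂, dot]
    simp only [smul_eq_mul]
    push_cast
    ring
  rw [coroot_eq_of_reflection (y := (c.1 : ℝ) • x₁ + (c.2 : ℝ) • x₂) hγ, hev h']
  · rw [hev h, hc.1]; norm_num
  · intro κ hκ
    obtain ⟨w, hw, hκw⟩ := S.exists_coord κ hκ
    obtain ⟨ε, hε, he⟩ := S.exists_weight _ (hc.2 w hw)
    refine ⟨ε, hε, fun y => ?_⟩
    rw [hev hκw, he, h, hκw]
    push_cast
    ring

lemma HasCoord.isLong (hγ : γ.IsNonZero) (h : HasCoord l₁ l₂ γ v) (hc : IsPlaneCoroot R v c)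
    (hl : IsPlaneLong R v c) : IsLong γ := by
  intro δ
  by_cases hδ : δ.IsNonZero
  · obtain ⟨w, hw, h'⟩ := S.exists_coord δ hδ
    rw [h.apply_coroot S hγ hc h']
    rcases hl w hw with rfl | rfl | h1 | h1 | h1
    · exact Or.inl (congrArg _ (h'.ext h))
    · exact Or.inr (Or.inl (by rw [← Weight.coe_neg]; exact congrArg _ (h'.ext h.neg)))
    all_goals simp [h1]
  · have h0 : (δ : 𝔞 → ℝ) = 0 := not_not.1 hδ
    right; right; left
    rw [h0, Pi.zero_apply]

lemma HasCoord.cos_eq (hθ : IsCartanInvolution 𝔞 θ) (hc : IsPlaneCoroot R v c)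
    (hl : IsPlaneLong R v c) (hv : v ∈ R) {w w' : ℤ × ℤ} (hγ : HasCoord l₁ l₂ γ w)
    (hδ : HasCoord l₁ l₂ δ w') (h : CharEq 𝔞 θ γ δ) : dot w c % 2 = dot w' c % 2 := by
  obtain ⟨κ, hκ, hk⟩ := S.exists_weight v hv
  have h1 := h.cos_eq hθ hκ (hk.isLong S hκ hc hl)
  rw [hk.apply_coroot S hκ hc hγ, hk.apply_coroot S hκ hc hδ] at h1
  have hcos : ∀ n : ℤ, Real.cos (n * Real.pi) = if n % 2 = 0 then 1 else -1 := by
    intro n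
    rw [Real.cos_int_mul_pi]
    rcases Int.emod_two_eq_zero_or_one n with h | h
    · rw [if_pos h, (Int.even_iff.2 h).neg_one_zpow]
    · rw [if_neg (by omega), (Int.odd_iff.2 h).neg_one_zpow]
  rw [hcos, hcos] at h1
  split_ifs at h1 with h2 h3 h3
  · omega
  · norm_num at h1
  · norm_num at h1
  · omega

/-- If the characters are classified by a function of the coordinates, partners can be read off
from the coordinates. -/
lemma IsPlaneSystem.exists_isPartner {T : Type*} (cls : ℤ × ℤ → T)
    (hne : ∀ γ δ : Weight ℝ 𝔞 𝔤, ∀ v w, HasCoord l₁ l₂ γ v → HasCoord l₁ l₂ δ w →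
      CharEq 𝔞 θ γ δ → cls v = cls w)
    (heq : ∀ m ∈ groupM 𝔞 θ, ∃ χ : T → ℝ, ∀ v ∈ R, ∀ γ : Weight ℝ 𝔞 𝔤, γ.IsNonZero →
      HasCoord l₁ l₂ γ v → ActsBy m γ (χ (cls v)))
    (hR : ∀ v ∈ R, ∃ w ∈ R, w ≠ v ∧ w ≠ -v ∧ cls w = cls v ∧
      ∀ u ∈ R, cls u = cls v → u = v ∨ u = -v ∨ u = w ∨ u = -w)
    (hα : α.IsNonZero) : ∃ β, IsPartner θ α β := by
  obtain ⟨v, hv, hαv⟩ := S.exists_coord α hα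
  obtain ⟨w, hw, h1, h2, h3, h4⟩ := hR v hv
  obtain ⟨β, hβ, hβw⟩ := S.exists_weight w hw
  refine ⟨β, hβ, ?_, ?_, ?_, ?_⟩
  · rintro rfl; exact h1 (hβw.unique S hαv)
  · rintro rfl; exact h2 (hβw.unique S hαv.neg)
  · intro m hm s hs
    obtain ⟨χ, hχ⟩ := heq m hm
    have := hχ w hw β hβ hβw
    rwa [h3, ← hs.unique (hχ v hv α hα hαv)] at this
  · intro γ hγ hc
    obtain ⟨u, hu, hγu⟩ := S.exists_coord γ hγ
    rcases h4 u hu (hne _ _ _ _ hαv hγu hc).symm with rfl | rfl | rfl | rfl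
    · exact Or.inl (hγu.ext hαv)
    · exact Or.inr (Or.inl (hγu.ext hαv.neg))
    · exact Or.inr (Or.inr (Or.inl (hγu.ext hβw)))
    · exact Or.inr (Or.inr (Or.inr (hγu.ext hβw.neg)))

/-- Multiplicativity of the characters of `M`, in coordinates. -/
lemma HasCoord.actsBy_add {κ : Weight ℝ 𝔞 𝔤} {m : 𝔤 ≃ₗ⁅ℝ⁆ 𝔤} {s t : ℝ}
    (hθ : IsCartanInvolution 𝔞 θ)
    (hγ : γ.IsNonZero) (hκ : κ.IsNonZero) (h : HasCoord l₁ l₂ γ v) (h' : HasCoord l₁ l₂ δ w)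
    (h'' : HasCoord l₁ l₂ κ (v + w)) (hs : ActsBy m γ s) (ht : ActsBy m δ t)
    (hc : IsPlaneCoroot R v c) (hneg : dot w c < 0) : ActsBy m κ (s * t) := by
  refine ActsBy.add hθ hγ hκ ?_ (h.coe_add h' h'') hs ht
  rw [h.apply_coroot S hγ hc h']
  exact_mod_cast hneg

end Plane

lemma exists_plane_dual {l₁ l₂ : Dual ℝ 𝔞} (hl : LinearIndependent ℝ ![l₁, l₂]) :
    ∃ x₁ x₂ : 𝔞, l₁ x₁ = 1 ∧ l₁ x₂ = 0 ∧ l₂ x₁ = 0 ∧ l₂ x₂ = 1 := by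
  obtain ⟨x, hx⟩ := exists_dual_vectors hl
  exact ⟨x 0, x 1, by simpa using hx 0 0, by simpa using hx 0 1, by simpa using hx 1 0,
    by simpa using hx 1 1⟩

lemma isPlaneSystem_of_range {l₁ l₂ : Dual ℝ 𝔞} {x₁ x₂ : 𝔞} (h11 : l₁ x₁ = 1) (h12 : l₁ x₂ = 0)
    (h21 : l₂ x₁ = 0) (h22 : l₂ x₂ = 1) {R : Finset (ℤ × ℤ)}
    (hR : Set.range (rootSystem 𝔞).root =
      (fun v : ℤ × ℤ => (v.1 : ℝ) • l₁ + (v.2 : ℝ) • l₂) '' R) :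
    IsPlaneSystem l₁ l₂ x₁ x₂ R := by
  refine ⟨h11, h12, h21, h22, fun γ hγ => ?_, fun v hv => ?_⟩
  · have hmem : Weight.toLinear ℝ 𝔞 𝔤 γ ∈ Set.range (rootSystem 𝔞).root :=
      exists_weight_iff.2 ⟨γ, hγ, fun _ => rfl⟩
    rw [hR] at hmem
    obtain ⟨v, hv, h⟩ := hmem
    exact ⟨v, hv, fun y => (LinearMap.congr_fun h y).symm⟩
  · obtain ⟨γ, hγ, h⟩ := exists_weight_iff.1 (hR ▸ Set.mem_image_of_mem _ hv)
    exact ⟨γ, hγ, h⟩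

/-- The roots of `B₂` in coordinates. -/
def rootsB2 : Finset (ℤ × ℤ) :=
  {(1, 0), (-1, 0), (0, 1), (0, -1), (1, 1), (-1, -1), (1, -1), (-1, 1)}

/-- The roots of `G₂` in coordinates. -/
def rootsG2 : Finset (ℤ × ℤ) :=
  {(1, 0), (-1, 0), (0, 1), (0, -1), (1, 1), (-1, -1), (1, 2), (-1, -2), (1, 3), (-1, -3),
    (2, 3), (-2, -3)}

/-- The character depends only on the parity of the coordinate sum. The long roots `l₁ ± l₂` form a
pair with trivial character, and then `l₁ = (l₁ - l₂) + l₂` equates the short characters. The long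
root `l₁ + l₂` separates the two classes. -/
lemma IsTypeB2.exists_isPartner (h : IsTypeB2 𝔞) (hθ : IsCartanInvolution 𝔞 θ)
    (hα : α.IsNonZero) : ∃ β, IsPartner θ α β := by
  obtain ⟨l₁, l₂, hl, hroot⟩ := h
  obtain ⟨x₁, x₂, h11, h12, h21, h22⟩ := exists_plane_dual hl
  have S : IsPlaneSystem l₁ l₂ x₁ x₂ rootsB2 := by
    refine isPlaneSystem_of_range h11 h12 h21 h22 ?_
    rw [hroot, rootsB2]
    simp only [Finset.coe_insert, Finset.coe_singleton, Set.image_insert_eq, Set.image_singleton]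
    refine congrArg₂ insert ?_ (congrArg₂ insert ?_ (congrArg₂ insert ?_ (congrArg₂ insert ?_ (congrArg₂ insert ?_ (congrArg₂ insert ?_ (congrArg₂ insert ?_ (congrArg singleton ?_)))))))
    all_goals push_cast; module
  have c1 : IsPlaneCoroot rootsB2 (1, 1) (1, 1) := by decide
  have c2 : IsPlaneCoroot rootsB2 (1, -1) (1, -1) := by decide
  have L1 : IsPlaneLong rootsB2 (1, 1) (1, 1) := by decide
  have L2 : IsPlaneLong rootsB2 (1, -1) (1, -1) := by decide
  obtain ⟨κ₁, k1, hk1⟩ := S.exists_weight (1, 1) (by decide)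
  obtain ⟨κ₂, k2, hk2⟩ := S.exists_weight (1, -1) (by decide)
  obtain ⟨ε₁, e1, he1⟩ := S.exists_weight (1, 0) (by decide)
  obtain ⟨ε₂, e2, he2⟩ := S.exists_weight (0, 1) (by decide)
  have hcoe : ∀ {v w : ℤ × ℤ} {γ δ : Weight ℝ 𝔞 𝔤}, HasCoord l₁ l₂ γ v → HasCoord l₁ l₂ δ w →
      (v = w ∨ v = -w) → (γ : 𝔞 → ℝ) = δ ∨ (γ : 𝔞 → ℝ) = -δ := by
    rintro v w γ δ h h' (rfl | rfl)
    · exact Or.inl (congrArg _ (h.ext h'))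
    · exact Or.inr (by rw [← Weight.coe_neg]; exact congrArg _ (h.ext h'.neg))
  have hpair : IsLongPair κ₁ κ₂ := by
    refine ⟨k1, k2, hk1.isLong S k1 c1 L1, hk2.isLong S k2 c2 L2, ?_, ?_⟩
    · rw [hk1.apply_coroot S k1 c1 hk2]; simp [dot]
    · intro γ hγ
      obtain ⟨w, hw, hγw⟩ := S.exists_coord γ hγ
      have hw' : (w = (1, 1) ∨ w = -(1, 1)) ∨ (w = (1, -1) ∨ w = -(1, -1)) ∨
          (dot w (1, 1) = 1 ∨ dot w (1, 1) = -1) ∧ (dot w (1, -1) = 1 ∨ dot w (1, -1) = -1) := by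
        clear hγw
        revert w; decide
      rcases hw' with h | h | h
      · rcases hcoe hγw hk1 h with h | h <;> simp [h]
      · rcases hcoe hγw hk2 h with h | h <;> simp [h]
      · rw [hk1.apply_coroot S k1 c1 hγw, hk2.apply_coroot S k2 c2 hγw]
        right; right; right; right; right
        exact_mod_cast h
  have hone : ∀ m ∈ groupM 𝔞 θ, ActsBy m κ₁ 1 := by
    intro m hm
    refine hpair.actsBy_one hθ (γ := ε₁) (δ := -ε₂) ?_ ?_ ?_ ?_ ?_ hm
    · rw [hk1.apply_coroot S k1 c1 he1]; simp [dot]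
    · rw [hk2.apply_coroot S k2 c2 he1]; simp [dot]
    · funext y
      rw [Weight.coe_neg, Pi.neg_apply, Pi.sub_apply, he1, he2, hk1]
      push_cast; ring
    · funext y
      rw [Pi.neg_apply, Pi.sub_apply, Pi.sub_apply, he1, hk1, hk2]
      push_cast; ring
    · intro γ hγ
      obtain ⟨w, hw, hγw⟩ := S.exists_coord γ hγ
      have hw' : (w = (1, 1) ∨ w = -(1, 1)) ∨ (w = (1, -1) ∨ w = -(1, -1)) ∨
          (w = (1, 0) ∨ w = -(1, 0)) ∨ (w = -(0, 1) ∨ w = -(-(0, 1))) := by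
        clear hγw
        revert w; decide
      rcases hw' with h | h | h | h
      · rcases hcoe hγw hk1 h with h | h <;> simp [h]
      · rcases hcoe hγw hk2 h with h | h <;> simp [h]
      · rcases hcoe hγw he1 h with h | h <;> simp [h]
      · rcases hcoe hγw he2.neg h with h | h
        · exact Or.inr (Or.inr (Or.inr (Or.inl h)))
        · exact Or.inr (Or.inr (Or.inr (Or.inr h)))
  refine S.exists_isPartner (fun v => (v.1 + v.2) % 2) ?_ ?_ (by decide) hα
  · intro γ δ v w hv hw hc
    have := HasCoord.cos_eq S hθ c1 L1 (by decide) hv hw hc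
    simpa [dot] using this
  · intro m hm
    obtain ⟨s, -, hs⟩ := exists_actsBy hθ hm e2
    have a1 := hone m hm
    have a2 := hpair.charEq hθ (γ := ε₁)
      (by rw [hk1.apply_coroot S k1 c1 he1]; simp [dot]) m hm 1 a1
    have a3 := HasCoord.actsBy_add S hθ k2 e1 hk2 he2 he1 a2 hs c2 (by decide)
    rw [one_mul] at a3
    refine ⟨fun i => if i = 0 then 1 else s, fun v hv γ hγ hγv => ?_⟩
    have hall : ∀ {κ : Weight ℝ 𝔞 𝔤} {w : ℤ × ℤ} {t : ℝ}, HasCoord l₁ l₂ κ w → κ.IsNonZero →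
        ActsBy m κ t → (v = w ∨ v = -w) → ActsBy m γ t := by
      rintro κ w t hκ h0 ht (rfl | rfl)
      · rwa [hγv.ext hκ]
      · rw [hγv.ext hκ.neg, Weight.coe_neg]
        exact ht.neg hθ hm
    have hv' : (((v = (1, 1) ∨ v = -(1, 1)) ∨ (v = (1, -1) ∨ v = -(1, -1))) ∧ (v.1 + v.2) % 2 = 0) ∨
        (((v = (1, 0) ∨ v = -(1, 0)) ∨ (v = (0, 1) ∨ v = -(0, 1))) ∧ (v.1 + v.2) % 2 ≠ 0) := by
      clear hγv hall
      revert v; decide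
    rcases hv' with ⟨h | h, h'⟩ | ⟨h | h, h'⟩
    · simp only [if_pos h']; exact hall hk1 k1 a1 h
    · simp only [if_pos h']; exact hall hk2 k2 a2 h
    · simp only [if_neg h']; exact hall he1 e1 a3 h
    · simp only [if_neg h']; exact hall he2 e2 hs h

/-- The character is determined by the coordinates modulo `2`, through multiplicativity along sums
of roots. Conversely, two long roots recover both parities. -/
lemma IsTypeG2.exists_isPartner (h : IsTypeG2 𝔞) (hθ : IsCartanInvolution 𝔞 θ)
    (hα : α.IsNonZero) : ∃ β, IsPartner θ α β := by
  obtain ⟨l₁, l₂, hl, hroot⟩ := h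
  obtain ⟨x₁, x₂, h11, h12, h21, h22⟩ := exists_plane_dual hl
  have S : IsPlaneSystem l₁ l₂ x₁ x₂ rootsG2 := by
    refine isPlaneSystem_of_range h11 h12 h21 h22 ?_
    rw [hroot, rootsG2]
    simp only [Finset.coe_insert, Finset.coe_singleton, Set.image_insert_eq, Set.image_singleton]
    refine congrArg₂ insert ?_ (congrArg₂ insert ?_ (congrArg₂ insert ?_ (congrArg₂ insert ?_ (congrArg₂ insert ?_ (congrArg₂ insert ?_ (congrArg₂ insert ?_ (congrArg₂ insert ?_ (congrArg₂ insert ?_ (congrArg₂ insert ?_ (congrArg₂ insert ?_ (congrArg singleton ?_)))))))))))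
    all_goals push_cast; module
  have c1 : IsPlaneCoroot rootsG2 (1, 0) (2, -1) := by decide
  have c2 : IsPlaneCoroot rootsG2 (0, 1) (-3, 2) := by decide
  have c3 : IsPlaneCoroot rootsG2 (1, 3) (-1, 1) := by decide
  have L1 : IsPlaneLong rootsG2 (1, 0) (2, -1) := by decide
  have L3 : IsPlaneLong rootsG2 (1, 3) (-1, 1) := by decide
  refine S.exists_isPartner (fun v => (v.1 % 2, v.2 % 2)) ?_ ?_ (by decide) hα
  · intro γ δ v w hv hw hc
    have h1 := HasCoord.cos_eq S hθ c1 L1 (by decide) hv hw hc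
    have h3 := HasCoord.cos_eq S hθ c3 L3 (by decide) hv hw hc
    simp only [dot] at h1 h3
    exact Prod.ext (by dsimp only; omega) (by dsimp only; omega)
  · intro m hm
    obtain ⟨ε₁, e1, h1⟩ := S.exists_weight (1, 0) (by decide)
    obtain ⟨ε₂, e2, h2⟩ := S.exists_weight (0, 1) (by decide)
    obtain ⟨ε₃, e3, h3⟩ := S.exists_weight (1, 1) (by decide)
    obtain ⟨ε₄, e4, h4⟩ := S.exists_weight (1, 2) (by decide)
    obtain ⟨ε₅, e5, h5⟩ := S.exists_weight (1, 3) (by decide)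
    obtain ⟨ε₆, e6, h6⟩ := S.exists_weight (2, 3) (by decide)
    obtain ⟨s, hs, a1⟩ := exists_actsBy hθ hm e1
    obtain ⟨t, ht, a2⟩ := exists_actsBy hθ hm e2
    have a3 : ActsBy m ε₃ (s * t) := HasCoord.actsBy_add S hθ e1 e3 h1 h2 h3 a1 a2 c1 (by decide)
    have a4 : ActsBy m ε₄ s := by
      have := HasCoord.actsBy_add S hθ e2 e4 h2 h3 h4 a2 a3 c2 (by decide)
      rwa [mul_left_comm, ht, mul_one] at this
    obtain ⟨r, -, a5⟩ := exists_actsBy hθ hm e5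
    -- Descend from `l₁ + 3 l₂` to `l₁ + 2 l₂`: adding `l₂` to `l₁ + 2 l₂` has a positive pairing,
    -- so `HasCoord.actsBy_add` does not apply upwards.
    have hr : r = s * t := by
      have h2' : ActsBy m (-ε₂ : Weight ℝ 𝔞 𝔤) t := by rw [Weight.coe_neg]; exact a2.neg hθ hm
      have := a4.unique (HasCoord.actsBy_add S hθ e5 e4 h5 h2.neg h4 a5 h2' c3 (by decide))
      rw [this, mul_assoc, ht, mul_one]
    rw [hr] at a5
    have a6 : ActsBy m ε₆ t := by
      have := HasCoord.actsBy_add S hθ e1 e6 h1 h5 h6 a1 a5 c1 (by decide)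
      rwa [← mul_assoc, hs, one_mul] at this
    refine ⟨fun i => if i = (1, 0) then s else if i = (0, 1) then t else s * t,
      fun v hv γ hγ hγv => ?_⟩
    have hall : ∀ {κ : Weight ℝ 𝔞 𝔤} {w : ℤ × ℤ} {t : ℝ}, HasCoord l₁ l₂ κ w → κ.IsNonZero →
        ActsBy m κ t → (v = w ∨ v = -w) → ActsBy m γ t := by
      rintro κ w t hκ h0 ht (rfl | rfl)
      · rwa [hγv.ext hκ]
      · rw [hγv.ext hκ.neg, Weight.coe_neg]
        exact ht.neg hθ hm
    have hv' : (((v = (1, 0) ∨ v = -(1, 0)) ∨ (v = (1, 2) ∨ v = -(1, 2))) ∧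
          (v.1 % 2, v.2 % 2) = (1, 0)) ∨
        (((v = (0, 1) ∨ v = -(0, 1)) ∨ (v = (2, 3) ∨ v = -(2, 3))) ∧
          (v.1 % 2, v.2 % 2) = (0, 1)) ∨
        (((v = (1, 1) ∨ v = -(1, 1)) ∨ (v = (1, 3) ∨ v = -(1, 3))) ∧
          (v.1 % 2, v.2 % 2) = (1, 1)) := by
      clear hγv hall
      revert v; decide
    rcases hv' with ⟨h | h, h'⟩ | ⟨h | h, h'⟩ | ⟨h | h, h'⟩ <;> simp only [h'] <;> norm_num
    · exact hall h1 e1 a1 h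
    · exact hall h4 e4 a4 h
    · exact hall h2 e2 a2 h
    · exact hall h6 e6 a6 h
    · exact hall h3 e3 a3 h
    · exact hall h5 e5 a5 h

end RealFlag

/-! ### Equivalence classes of negative roots and the basis of `𝔫⁻` -/

namespace RealFlag

open LieAlgebra LieAlgebra.IsKilling GenCplx

variable {𝔤 : Type*} [LieRing 𝔤] [LieAlgebra ℝ 𝔤] [FiniteDimensional ℝ 𝔤]
variable [IsKilling ℝ 𝔤]
variable {𝔞 : LieSubalgebra ℝ 𝔤} [𝔞.IsCartanSubalgebra] [IsTriangularizable ℝ 𝔞 𝔤]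
variable {θ : 𝔤 ≃ₗ⁅ℝ⁆ 𝔤} {b : (rootSystem 𝔞).Base} {X : Weight ℝ 𝔞 𝔤 → 𝔤}

lemma exists_isPartner
    (htype : IsTypeA3 𝔞 ∨ IsTypeB2 𝔞 ∨ IsTypeG2 𝔞 ∨ ∃ l : ℕ, 5 ≤ l ∧ IsTypeD 𝔞 l)
    (hθ : IsCartanInvolution 𝔞 θ) {α : Weight ℝ 𝔞 𝔤} (hα : α.IsNonZero) :
    ∃ β, IsPartner θ α β := by
  rcases htype with h | h | h | ⟨l, hl, h⟩
  · exact h.exists_isPartner hθ hα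
  · exact h.exists_isPartner hθ hα
  · exact h.exists_isPartner hθ hα
  · exact h.exists_isPartner hl hθ hα

lemma NegRoot.isNonZero (α : NegRoot b) : α.wt.IsNonZero :=
  LieSubalgebra.isNonZero_coe_root (H := 𝔞) α.1

lemma NegRoot.wt_injective {α β : NegRoot b} (h : α.wt = β.wt) : α = β :=
  Subtype.ext (Subtype.ext h)

lemma isPos_neg_iff {i j : 𝔞.root} (h : (j : Weight ℝ 𝔞 𝔤) = -(i : Weight ℝ 𝔞 𝔤)) :
    b.IsPos j ↔ ¬ b.IsPos i := by
  have hj : j = (rootSystem 𝔞).reflectionPerm i i := by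
    apply (rootSystem 𝔞).root.injective
    rw [RootPairing.root_reflectionPerm, RootPairing.reflection_apply_self]
    ext y
    simp [h]
  rw [hj]
  exact RootPairing.Base.IsPos.neg_iff_not b i

lemma NegRoot.wt_ne_neg (α β : NegRoot b) : β.wt ≠ -α.wt := fun h =>
  β.2 ((isPos_neg_iff h).2 α.2)

lemma exists_negRoot (b : (rootSystem 𝔞).Base) {γ : Weight ℝ 𝔞 𝔤} (hγ : γ.IsNonZero) :
    ∃ β : NegRoot b, β.wt = γ ∨ β.wt = -γ := by
  let i : 𝔞.root := ⟨γ, by simpa using hγ⟩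
  by_cases h : b.IsPos i
  · let j : 𝔞.root := ⟨-γ, by simpa using hγ.neg⟩
    have hj : ¬ b.IsPos j := fun h' => (isPos_neg_iff (i := i) (j := j) rfl).1 h' h
    exact ⟨⟨j, hj⟩, Or.inr rfl⟩
  · exact ⟨⟨i, h⟩, Or.inl rfl⟩

lemma CharEq.neg (hθ : IsCartanInvolution 𝔞 θ) {α β : Weight ℝ 𝔞 𝔤} (h : CharEq 𝔞 θ α β) :
    CharEq 𝔞 θ α (-β : Weight ℝ 𝔞 𝔤) := by
  intro m hm s hs
  rw [Weight.coe_neg]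
  exact (h m hm s hs).neg hθ hm

/-- The root spaces are lines on which `M` acts by scalars, so any linear isomorphism intertwines
equal characters. -/
lemma mSetoid_iff (hθ : IsCartanInvolution 𝔞 θ) (α β : NegRoot b) :
    (mSetoid θ b).r α β ↔ CharEq 𝔞 θ α.wt β.wt := by
  constructor
  · rintro ⟨e, he⟩ m hm s hs y hy
    have h1 : actRoot θ α.wt ⟨m, hm⟩ (e.symm ⟨y, hy⟩) = s • e.symm ⟨y, hy⟩ :=
      Subtype.ext (hs _ (e.symm ⟨y, hy⟩).2)
    have h2 := he ⟨m, hm⟩ (e.symm ⟨y, hy⟩)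
    rw [h1, map_smul, LinearEquiv.apply_symm_apply] at h2
    exact (congrArg Subtype.val h2).symm
  · intro h
    have hf : finrank ℝ (rootSub α.wt) = finrank ℝ (rootSub β.wt) :=
      (finrank_rootSpace_eq_one _ α.isNonZero).trans (finrank_rootSpace_eq_one _ β.isNonZero).symm
    refine ⟨LinearEquiv.ofFinrankEq _ _ hf, fun m x => ?_⟩
    obtain ⟨s, -, hs⟩ := exists_actsBy hθ m.2 α.isNonZero
    have h1 : actRoot θ α.wt m x = s • x := Subtype.ext (hs _ x.2)
    rw [h1, map_smul]
    exact (Subtype.ext (h m m.2 s hs _ (Subtype.prop _))).symm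

/-- A partner is determined up to sign, and exactly one root of each opposite pair is negative. -/
lemma existsUnique_equivalent
    (hpart : ∀ α : Weight ℝ 𝔞 𝔤, α.IsNonZero → ∃ β, IsPartner θ α β)
    (hθ : IsCartanInvolution 𝔞 θ) (α : NegRoot b) :
    ∃! β : NegRoot b, β ≠ α ∧ (mSetoid θ b).r α β := by
  obtain ⟨γ, hγ⟩ := hpart α.wt α.isNonZero
  obtain ⟨β, hβ⟩ := exists_negRoot b hγ.nonzero
  refine ⟨β, ⟨?_, (mSetoid_iff hθ α β).2 ?_⟩, ?_⟩
  · rintro rfl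
    rcases hβ with h | h
    · exact hγ.ne h.symm
    · exact hγ.ne_neg (by rw [h, neg_neg])
  · rcases hβ with h | h
    · rw [h]; exact hγ.charEq
    · rw [h]; exact hγ.charEq.neg hθ
  · rintro δ ⟨h1, h2⟩
    rcases hγ.unique δ.wt δ.isNonZero ((mSetoid_iff hθ α δ).1 h2) with h | h | h | h
    · exact absurd (NegRoot.wt_injective h) h1
    · exact absurd h (NegRoot.wt_ne_neg α δ)
    · rcases hβ with h' | h'
      · exact NegRoot.wt_injective (h.trans h'.symm)
      · exact absurd (show β.wt = -δ.wt by rw [h, h']) (NegRoot.wt_ne_neg δ β)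
    · rcases hβ with h' | h'
      · exact absurd (show δ.wt = -β.wt by rw [h, h']) (NegRoot.wt_ne_neg β δ)
      · exact NegRoot.wt_injective (h.trans h'.symm)

/-! ### The basis of `𝔫⁻` -/

lemma covec_vec_self (hX : IsWeylBasis X) (α : NegRoot b) : covec b X α (vec hX α) = 1 := by
  change killingForm ℝ 𝔤 (X (-α.wt)) (X α.wt) = 1
  rw [killingForm, traceForm_comm]
  exact hX.pair _ α.isNonZero

lemma covec_vec_of_ne (hX : IsWeylBasis X) {α β : NegRoot b} (h : α ≠ β) :
    covec b X α (vec hX β) = 0 := by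
  change killingForm ℝ 𝔤 (X (-α.wt)) (X β.wt) = 0
  refine killingForm_apply_eq_zero_of_mem_rootSpace_of_add_ne_zero ℝ 𝔤 𝔞
    (hX.mem _ α.isNonZero.neg) (hX.mem _ β.isNonZero) fun h0 => h ?_
  refine NegRoot.wt_injective (DFunLike.coe_injective ?_)
  rwa [Weight.coe_neg, neg_add_eq_zero] at h0

lemma IsWeylBasis.ne_zero (hX : IsWeylBasis X) {α : Weight ℝ 𝔞 𝔤} (hα : α.IsNonZero) : X α ≠ 0 := by
  intro h
  have := hX.pair α hα
  rw [h] at this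
  simp at this

lemma top_le_span_vec (hX : IsWeylBasis X) :
    ⊤ ≤ Submodule.span ℝ (Set.range (vec hX : NegRoot b → nMinus b)) := by
  rintro ⟨x, hx⟩ -
  have h1 : nMinus b ≤
      (Submodule.span ℝ (Set.range (vec hX : NegRoot b → nMinus b))).map (nMinus b).subtype := by
    refine iSup_le fun α y hy => ?_
    obtain ⟨c, rfl⟩ := exists_eq_smul α.isNonZero (hX.mem _ α.isNonZero)
      (hX.ne_zero α.isNonZero) hy
    exact ⟨c • vec hX α, Submodule.smul_mem _ _ (Submodule.subset_span ⟨α, rfl⟩), rfl⟩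
  obtain ⟨y, hy, hyx⟩ := h1 hx
  rwa [← show y = ⟨x, hx⟩ from Subtype.ext hyx]

lemma linearIndependent_vec (hX : IsWeylBasis X) :
    LinearIndependent ℝ (vec hX : NegRoot b → nMinus b) := by
  classical
  rw [linearIndependent_iff']
  intro s g hg i hi
  have h := congrArg (covec b X i) hg
  rw [map_sum, map_zero, Finset.sum_eq_single i] at h
  · rwa [map_smul, covec_vec_self, smul_eq_mul, mul_one] at h
  · intro j _ hj
    rw [map_smul, covec_vec_of_ne hX hj.symm, smul_zero]
  · exact fun h => absurd hi h

/-- The basis `X_α` of `𝔫⁻`. -/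
def rootBasis (b : (rootSystem 𝔞).Base) (hX : IsWeylBasis X) :
    Basis (NegRoot b) ℝ (nMinus b) :=
  Basis.mk (linearIndependent_vec hX) (top_le_span_vec hX)

lemma rootBasis_apply (hX : IsWeylBasis X) (α : NegRoot b) : rootBasis b hX α = vec hX α := by
  rw [rootBasis, Basis.mk_apply]

lemma coord_rootBasis (hX : IsWeylBasis X) (α : NegRoot b) :
    (rootBasis b hX).coord α = covec b X α := by
  refine (rootBasis b hX).ext fun β => ?_
  rw [Basis.coord_apply, Basis.repr_self, rootBasis_apply]
  by_cases h : α = β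
  · subst h; rw [Finsupp.single_eq_same, covec_vec_self]
  · rw [Finsupp.single_eq_of_ne h, covec_vec_of_ne hX h]

lemma ext_covec (hX : IsWeylBasis X) {v w : nMinus b}
    (h : ∀ γ : NegRoot b, covec b X γ v = covec b X γ w) : v = w := by
  refine (rootBasis b hX).ext_elem fun γ => ?_
  rw [← Basis.coord_apply, ← Basis.coord_apply, coord_rootBasis, h]

lemma ext_vec (hX : IsWeylBasis X) {ξ η : Dual ℝ (nMinus b)}
    (h : ∀ γ : NegRoot b, ξ (vec hX γ) = η (vec hX γ)) : ξ = η :=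
  (rootBasis b hX).ext fun γ => by rw [rootBasis_apply, h]

/-- `M` acts on the basis and the dual basis by characters. -/
lemma exists_character (hθ : IsCartanInvolution 𝔞 θ) (hX : IsWeylBasis X) (m : groupM 𝔞 θ) :
    ∃ s : NegRoot b → ℝ, (∀ α, s α * s α = 1) ∧ (∀ α, ActsBy m.1 α.wt (s α)) ∧
      (∀ α, actN θ b m (vec hX α) = s α • vec hX α) ∧
      ∀ α, (actN θ b m).dualMap (covec b X α) = s α • covec b X α := by
  choose s hs hs' using fun α : NegRoot b => exists_actsBy hθ m.2 α.isNonZero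
  have h1 : ∀ α, actN θ b m (vec hX α) = s α • vec hX α := fun α =>
    Subtype.ext (hs' α _ (hX.mem _ α.isNonZero))
  refine ⟨s, hs, hs', h1, fun α => ext_vec hX fun γ => ?_⟩
  rw [LinearMap.dualMap_apply, h1, map_smul, LinearMap.smul_apply]
  by_cases h : α = γ
  · rw [h]
  · rw [covec_vec_of_ne hX h, smul_zero, smul_zero]

/-- A sign is its own inverse, so `m⁻¹` has the same character values as `m`, and vectors and
covectors of one root transform alike. -/
lemma actGen_vec (hθ : IsCartanInvolution 𝔞 θ) (hX : IsWeylBasis X) (m : groupM 𝔞 θ) :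
    ∃ s : NegRoot b → ℝ, (∀ α, ActsBy m.1 α.wt (s α)) ∧ ∀ u γ,
      covec b X γ (actGen θ b m u).1 = s γ * covec b X γ u.1 ∧
      (actGen θ b m u).2 (vec hX γ) = s γ * u.2 (vec hX γ) := by
  obtain ⟨s, hs, hact, h1, h2⟩ := exists_character (b := b) hθ hX m
  obtain ⟨t, -, hact', h3, -⟩ := exists_character (b := b) hθ hX m⁻¹
  have hst : ∀ γ, t γ = s γ := by
    intro γ
    have h4 : actN θ b m (actN θ b m⁻¹ (vec hX γ)) = vec hX γ := by
      apply Subtype.ext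
      exact m.1.apply_symm_apply _
    rw [h3, map_smul, h1, smul_smul] at h4
    have h5 := congrArg (covec b X γ) h4
    rw [map_smul, covec_vec_self, smul_eq_mul, mul_one] at h5
    linear_combination s γ * h5 - t γ * hs γ
  refine ⟨s, hact, fun u γ => ⟨?_, ?_⟩⟩
  · exact LinearMap.congr_fun (h2 γ) u.1
  · change u.2 (actN θ b m⁻¹ (vec hX γ)) = _
    rw [h3, map_smul, hst, smul_eq_mul]

/-- A vector on which `M` acts by the character of `α` lies in `V_[α] ⊕ V_[α]*`. -/
lemma eq_of_actGen (hθ : IsCartanInvolution 𝔞 θ) (hX : IsWeylBasis X) {α β : NegRoot b}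
    (hαβ : α ≠ β) (hclass : ∀ γ : NegRoot b, CharEq 𝔞 θ α.wt γ.wt → γ = α ∨ γ = β)
    {u : GenTangent (nMinus b)}
    (hu : ∀ (m : groupM 𝔞 θ) (s : ℝ), ActsBy m.1 α.wt s → actGen θ b m u = s • u) :
    ∃ v₁ v₂ w₁ w₂ : ℝ, u = (v₁ • vec hX α + v₂ • vec hX β,
      w₁ • covec b X α + w₂ • covec b X β) := by
  have hzero : ∀ γ, γ ≠ α → γ ≠ β → covec b X γ u.1 = 0 ∧ u.2 (vec hX γ) = 0 := by
    intro γ h1 h2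
    have hn : ¬ CharEq 𝔞 θ α.wt γ.wt := fun h => (hclass γ h).elim h1 h2
    -- Some `m` acts on `𝔤_γ` by a scalar other than the eigenvalue of `u`, so both `γ`-components
    -- of `u` vanish.
    simp only [CharEq, not_forall] at hn
    obtain ⟨m, hm, s, hs, hn⟩ := hn
    obtain ⟨t, ht, h⟩ := actGen_vec (b := b) hθ hX ⟨m, hm⟩
    have hne : t γ - s ≠ 0 := fun h0 => hn (by rw [← sub_eq_zero.1 h0]; exact ht γ)
    obtain ⟨e1, e2⟩ := h u γ
    rw [hu ⟨m, hm⟩ s hs] at e1 e2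
    rw [Prod.smul_fst, map_smul, smul_eq_mul] at e1
    rw [Prod.smul_snd, LinearMap.smul_apply, smul_eq_mul] at e2
    refine ⟨?_, ?_⟩
    · exact (mul_eq_zero.1 (show (t γ - s) * covec b X γ u.1 = 0 by linear_combination -e1)
        ).resolve_left hne
    · exact (mul_eq_zero.1 (show (t γ - s) * u.2 (vec hX γ) = 0 by linear_combination -e2)
        ).resolve_left hne
  refine ⟨covec b X α u.1, covec b X β u.1, u.2 (vec hX α), u.2 (vec hX β), Prod.ext ?_ ?_⟩
  · refine ext_covec hX fun γ => ?_
    rw [map_add, map_smul, map_smul]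
    by_cases h1 : γ = α
    · subst h1
      rw [covec_vec_self, covec_vec_of_ne hX hαβ]; simp
    by_cases h2 : γ = β
    · subst h2
      rw [covec_vec_self, covec_vec_of_ne hX h1]; simp
    · rw [(hzero γ h1 h2).1, covec_vec_of_ne hX h1, covec_vec_of_ne hX h2]; simp
  · refine ext_vec hX fun γ => ?_
    rw [LinearMap.add_apply, LinearMap.smul_apply, LinearMap.smul_apply]
    by_cases h1 : γ = α
    · subst h1
      rw [covec_vec_self, covec_vec_of_ne hX hαβ.symm]; simp
    by_cases h2 : γ = β
    · subst h2
      rw [covec_vec_self, covec_vec_of_ne hX hαβ]; simp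
    · rw [(hzero γ h1 h2).2, covec_vec_of_ne hX (Ne.symm h1), covec_vec_of_ne hX (Ne.symm h2)]
      simp

end RealFlag

/-! ### The restriction of `J` to a class -/

namespace RealFlag

open LieAlgebra LieAlgebra.IsKilling GenCplx

variable {𝔤 : Type*} [LieRing 𝔤] [LieAlgebra ℝ 𝔤] [FiniteDimensional ℝ 𝔤]
variable [IsKilling ℝ 𝔤]
variable {𝔞 : LieSubalgebra ℝ 𝔤} [𝔞.IsCartanSubalgebra] [IsTriangularizable ℝ 𝔞 𝔤]
variable {θ : 𝔤 ≃ₗ⁅ℝ⁆ 𝔤} {b : (rootSystem 𝔞).Base} {X : Weight ℝ 𝔞 𝔤 → 𝔤}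
variable {J : GenTangent (nMinus b) →ₗ[ℝ] GenTangent (nMinus b)} {α β : NegRoot b}

lemma pairing_map_left (hJ : IsGenAlmostComplex J) (u v : GenTangent (nMinus b)) :
    pairing (J u) v = -pairing u (J v) := by
  have h := hJ.2 u (J v)
  rw [hJ.1, map_neg] at h
  linarith

lemma pairing_apply (u v : GenTangent (nMinus b)) :
    pairing u v = (u.2 v.1 + v.2 u.1) / 2 := rfl

/-- The real algebra of the blocks: a skew matrix of square `-1`. -/
lemma block_cases {a₁₁ a₂₁ a₁₂ a₂₂ x y : ℝ} (h1 : a₁₁ * a₁₁ + a₂₁ * a₁₂ - x * y = -1)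
    (h2 : a₂₁ * (a₁₁ + a₂₂) = 0) (h3 : a₂₁ * y = 0) (h4 : (a₁₁ - a₂₂) * y = 0)
    (h5 : a₁₂ * y = 0) (h6 : a₁₂ * x = 0) (h7 : (a₁₁ - a₂₂) * x = 0) (h8 : a₂₁ * x = 0) :
    (a₂₁ = 0 ∧ a₁₂ = 0 ∧ a₂₂ = a₁₁ ∧ a₁₁ ^ 2 = x * y - 1) ∨
      (x = 0 ∧ y = 0 ∧ a₂₁ ≠ 0 ∧ a₂₂ = -a₁₁ ∧ a₁₂ = -((1 + a₁₁ ^ 2) / a₂₁)) := by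
  -- If `x` or `y` is nonzero, the off-diagonal entries vanish and the diagonal ones agree. If both
  -- are zero, `a₂₁ = 0` would give `a₁₁² = -1`.
  by_cases hx : x = 0
  · by_cases hy : y = 0
    · right
      subst hx hy
      have hne : a₂₁ ≠ 0 := by
        rintro rfl
        nlinarith [mul_self_nonneg a₁₁]
      refine ⟨rfl, rfl, hne, ?_, ?_⟩
      · have := (mul_eq_zero.1 h2).resolve_left hne
        linarith
      · field_simp
        linear_combination h1
    · left
      have e1 := (mul_eq_zero.1 h3).resolve_right hy
      have e2 := (mul_eq_zero.1 h5).resolve_right hy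
      have e3 := (mul_eq_zero.1 h4).resolve_right hy
      exact ⟨e1, e2, by linarith, by rw [e1] at h1; linear_combination h1⟩
  · left
    have e1 := (mul_eq_zero.1 h8).resolve_right hx
    have e2 := (mul_eq_zero.1 h6).resolve_right hx
    have e3 := (mul_eq_zero.1 h7).resolve_right hx
    exact ⟨e1, e2, by linarith, by rw [e1] at h1; linear_combination h1⟩

/-- Equivariance confines `J` of each of the four basis vectors to their span. Skewness leaves six
of the sixteen entries, and `J² = -1` is then the system of `block_cases`. -/
lemma block_or (hθ : IsCartanInvolution 𝔞 θ) (hX : IsWeylBasis X) (hJ : IsInvariantGACS θ b J)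
    (hαβ : α ≠ β) (heq : CharEq 𝔞 θ α.wt β.wt)
    (hclass : ∀ γ : NegRoot b, CharEq 𝔞 θ α.wt γ.wt → γ = α ∨ γ = β) :
    (∃ a x y : ℝ, IsNoncomplexBlock hX J α β a x y) ∨ ∃ p c : ℝ, IsComplexBlock hX J α β p c := by
  have hvec : ∀ (m : groupM 𝔞 θ) (s : ℝ) (γ : NegRoot b), ActsBy m.1 γ.wt s →
      actGen θ b m (vec hX γ, 0) = s • (vec hX γ, 0) := by
    intro m s γ hs
    refine Prod.ext (Subtype.ext (hs _ (hX.mem _ γ.isNonZero))) ?_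
    change (actN θ b m⁻¹).dualMap 0 = s • (0 : Dual ℝ (nMinus b))
    rw [map_zero, smul_zero]
  have hcov : ∀ (m : groupM 𝔞 θ) (s : ℝ) (γ : NegRoot b), ActsBy m.1 γ.wt s →
      actGen θ b m (0, covec b X γ) = s • (0, covec b X γ) := by
    intro m s γ hs
    obtain ⟨t, ht, h⟩ := actGen_vec (b := b) hθ hX m
    refine Prod.ext ?_ (ext_vec hX fun δ => ?_)
    · change actN θ b m 0 = s • (0 : nMinus b)
      rw [map_zero, smul_zero]
    · rw [(h _ δ).2, Prod.smul_snd, LinearMap.smul_apply, smul_eq_mul]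
      by_cases hδ : γ = δ
      · subst hδ; rw [(ht γ).unique hs]
      · dsimp only; rw [covec_vec_of_ne hX hδ, mul_zero, mul_zero]
  have hform : ∀ u, (∀ (m : groupM 𝔞 θ) (s : ℝ), ActsBy m.1 α.wt s → actGen θ b m u = s • u) →
      ∃ v₁ v₂ w₁ w₂ : ℝ, J u = (v₁ • vec hX α + v₂ • vec hX β,
        w₁ • covec b X α + w₂ • covec b X β) := by
    intro u hu
    refine eq_of_actGen hθ hX hαβ hclass fun m s hs => ?_
    rw [← hJ.2, hu m s hs, map_smul]
  obtain ⟨a₁₁, a₂₁, q₁, q₂, e1⟩ := hform (vec hX α, 0) fun m s hs => hvec m s α hs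
  obtain ⟨a₁₂, a₂₂, q₃, q₄, e2⟩ := hform (vec hX β, 0) fun m s hs => hvec m s β (heq m m.2 s hs)
  obtain ⟨r₁, r₂, d₁, d₂, e3⟩ := hform (0, covec b X α) fun m s hs => hcov m s α hs
  obtain ⟨r₃, r₄, d₃, d₄, e4⟩ := hform (0, covec b X β)
    fun m s hs => hcov m s β (heq m m.2 s hs)
  -- skewness
  have c1 := covec_vec_self (b := b) hX α
  have c2 := covec_vec_self (b := b) hX β
  have c3 := covec_vec_of_ne (b := b) hX hαβ
  have c4 := covec_vec_of_ne (b := b) hX hαβ.symm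
  have sk := pairing_map_left hJ.1
  have s11 := sk (vec hX α, 0) (vec hX α, 0)
  have s12 := sk (vec hX α, 0) (vec hX β, 0)
  have s22 := sk (vec hX β, 0) (vec hX β, 0)
  have s13 := sk (vec hX α, 0) (0, covec b X α)
  have s14 := sk (vec hX α, 0) (0, covec b X β)
  have s23 := sk (vec hX β, 0) (0, covec b X α)
  have s24 := sk (vec hX β, 0) (0, covec b X β)
  have s33 := sk (0, covec b X α) (0, covec b X α)
  have s34 := sk (0, covec b X α) (0, covec b X β)
  have s44 := sk (0, covec b X β) (0, covec b X β)
  simp only [e1, e2, e3, e4, pairing_apply, LinearMap.add_apply, LinearMap.smul_apply, map_add,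
    map_smul, c1, c2, c3, c4, LinearMap.zero_apply, map_zero, smul_eq_mul, mul_one, mul_zero,
    add_zero, zero_add] at s11 s12 s22 s13 s14 s23 s24 s33 s34 s44
  obtain rfl : q₁ = 0 := by linarith
  obtain rfl : q₃ = -q₂ := by linarith
  obtain rfl : q₄ = 0 := by linarith
  obtain rfl : d₁ = -a₁₁ := by linarith
  obtain rfl : d₃ = -a₂₁ := by linarith
  obtain rfl : d₂ = -a₁₂ := by linarith
  obtain rfl : d₄ = -a₂₂ := by linarith
  obtain rfl : r₁ = 0 := by linarith
  obtain rfl : r₃ = -r₂ := by linarith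
  obtain rfl : r₄ = 0 := by linarith
  -- the square
  have hsplit : ∀ p q r s : ℝ, J (p • vec hX α + q • vec hX β, r • covec b X α + s • covec b X β) =
      p • J (vec hX α, 0) + q • J (vec hX β, 0) + r • J (0, covec b X α) +
        s • J (0, covec b X β) := by
    intro p q r s
    rw [← map_smul, ← map_smul, ← map_smul, ← map_smul, ← map_add, ← map_add, ← map_add]
    congr 1
    simp
  have sq1 := hJ.1.1 (vec hX α, 0)
  have sq2 := hJ.1.1 (vec hX β, 0)
  have sq3 := hJ.1.1 (0, covec b X α)
  have sq4 := hJ.1.1 (0, covec b X β)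
  rw [e1, hsplit] at sq1
  rw [e2, hsplit] at sq2
  rw [e3, hsplit] at sq3
  rw [e4, hsplit] at sq4
  have ev : ∀ {u w : GenTangent (nMinus b)}, u = w → covec b X α u.1 = covec b X α w.1 ∧
      covec b X β u.1 = covec b X β w.1 ∧ u.2 (vec hX α) = w.2 (vec hX α) ∧
      u.2 (vec hX β) = w.2 (vec hX β) := by
    rintro u w rfl; exact ⟨rfl, rfl, rfl, rfl⟩
  replace sq1 := ev sq1
  replace sq2 := ev sq2
  replace sq3 := ev sq3
  replace sq4 := ev sq4
  simp only [e1, e2, e3, e4, LinearMap.add_apply, LinearMap.smul_apply, map_add,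
    map_smul, c1, c2, c3, c4, LinearMap.zero_apply, map_zero, smul_eq_mul, mul_one, mul_zero,
    add_zero, zero_add, Prod.fst_add, Prod.snd_add, Prod.smul_fst, Prod.smul_snd, Prod.fst_neg,
    Prod.snd_neg, map_neg, LinearMap.neg_apply] at sq1 sq2 sq3 sq4
  obtain ⟨t1, t2, t3, t4⟩ := sq1
  obtain ⟨t5, t6, t7, t8⟩ := sq2
  obtain ⟨t9, t10, t11, t12⟩ := sq3
  obtain ⟨t13, t14, t15, t16⟩ := sq4
  rcases block_cases (a₁₁ := a₁₁) (a₂₁ := a₂₁) (a₁₂ := a₁₂) (a₂₂ := a₂₂) (x := r₂) (y := q₂)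
    (by linarith) (by linarith) (by linarith) (by linarith) (by linarith) (by linarith)
    (by linarith) (by linarith) with
    ⟨rfl, rfl, rfl, h4⟩ | ⟨rfl, rfl, h3, rfl, rfl⟩
  · refine Or.inl ⟨a₂₂, r₂, q₂, h4, ?_, ?_, ?_, ?_⟩
    · rw [e1]; simp
    · rw [e2]; simp
    · rw [e3]; simp
    · rw [e4]; simp
  · refine Or.inr ⟨a₁₁, a₂₁, h3, ?_, ?_, ?_, ?_⟩
    · rw [e1]; simp
    · rw [e2]; simp [sub_eq_add_neg]
    · rw [e3]; simp
    · rw [e4]; simp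

lemma IsNoncomplexBlock.not_isComplexBlock {hX : IsWeylBasis X} (hαβ : α ≠ β) {a x y p c : ℝ}
    (h : IsNoncomplexBlock hX J α β a x y) (h' : IsComplexBlock hX J α β p c) : False := by
  have h1 := congrArg (fun u : GenTangent (nMinus b) => covec b X β u.1)
    (h.col₁.symm.trans h'.col₁)
  simp only [map_add, map_smul, covec_vec_self, covec_vec_of_ne hX hαβ.symm, smul_eq_mul, mul_zero,
    mul_one, zero_add] at h1
  exact h'.ne h1.symm

/-- The condition at `X_α` alone fixes the ratio of the two coefficients, as `c ≠ 0`; the condition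
at `X_β` is then automatic from the form of the block. -/
lemma isOneZeroForm_iff {hX : IsWeylBasis X} (hαβ : α ≠ β) {p c : ℝ}
    (h : IsComplexBlock hX J α β p c) (Ω : ℂ ⊗[ℝ] Dual ℝ (nMinus b)) :
    IsOneZeroForm hX J α β Ω ↔
      ∃ z : ℂ, Ω = z • (-(c : ℂ) • ((1 : ℂ) ⊗ₜ[ℝ] covec b X α) +
        ((p : ℂ) + Complex.I) • ((1 : ℂ) ⊗ₜ[ℝ] covec b X β)) := by
  have c1 := covec_vec_self (b := b) hX α
  have c2 := covec_vec_self (b := b) hX β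
  have c3 := covec_vec_of_ne (b := b) hX hαβ
  have c4 := covec_vec_of_ne (b := b) hX hαβ.symm
  have hc : (c : ℂ) ≠ 0 := Complex.ofReal_ne_zero.2 h.ne
  constructor
  · rintro ⟨hmem, hv⟩
    obtain ⟨z₁, z₂, rfl⟩ := Submodule.mem_span_pair.1 hmem
    have h1 := hv (vec hX α) (Submodule.subset_span (by simp))
    rw [h.col₁] at h1
    simp only [map_add, map_smul, evalAt_tmul, c1, c2, c3, c4, smul_eq_mul, map_neg, mul_one,
      mul_zero, add_zero, zero_add, Complex.ofReal_one, Complex.ofReal_zero, one_mul,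
      Complex.ofReal_neg] at h1
    refine ⟨-z₁ / c, ?_⟩
    rw [smul_add, smul_smul, smul_smul]
    congr 2
    · field_simp
    · field_simp
      linear_combination -h1
  · rintro ⟨z, rfl⟩
    refine ⟨Submodule.smul_mem _ _ (add_mem (Submodule.smul_mem _ _ (Submodule.subset_span
      (by simp))) (Submodule.smul_mem _ _ (Submodule.subset_span (by simp)))), fun v hv => ?_⟩
    obtain ⟨r, t, rfl⟩ := Submodule.mem_span_pair.1 hv
    have hJv : J (r • vec hX α + t • vec hX β, 0) =
        r • J (vec hX α, 0) + t • J (vec hX β, 0) := by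
      rw [← map_smul, ← map_smul, ← map_add]
      congr 1
      simp
    rw [hJv, h.col₁, h.col₂]
    simp only [map_add, map_smul, map_sub, evalAt_tmul, c1, c2, c3, c4, smul_eq_mul, map_neg,
      mul_one, mul_zero, add_zero, zero_add, one_mul, sub_zero, zero_sub, Prod.fst_add,
      Prod.smul_fst]
    push_cast
    field_simp
    linear_combination (-(z * t)) * Complex.I_sq

/-- The basis of `𝔫⁻` arranged by classes. -/
def classBasis (hX : IsWeylBasis X) {κ : Type*} (e : κ ⊕ κ ≃ NegRoot b) :
    Basis (κ ⊕ κ) ℝ (nMinus b) :=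
  (rootBasis b hX).reindex e.symm

lemma classBasis_apply (hX : IsWeylBasis X) {κ : Type*} (e : κ ⊕ κ ≃ NegRoot b) (i : κ ⊕ κ) :
    classBasis hX e i = vec hX (e i) := by
  rw [classBasis, Basis.reindex_apply, Equiv.symm_symm, rootBasis_apply]

lemma coord_classBasis (hX : IsWeylBasis X) {κ : Type*} (e : κ ⊕ κ ≃ NegRoot b) (i : κ ⊕ κ) :
    (classBasis hX e).coord i = covec b X (e i) := by
  rw [← coord_rootBasis hX]
  ext v
  simp [classBasis]

/-- Representatives of the classes enumerate the negative roots. -/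
lemma bijective_sum_elim (hclass : ∀ α : NegRoot b, ∃! β : NegRoot b, β ≠ α ∧ (mSetoid θ b).r α β)
    {α β : MClass θ b → NegRoot b}
    (h : ∀ k, Quotient.mk (mSetoid θ b) (α k) = k ∧ Quotient.mk (mSetoid θ b) (β k) = k ∧
      α k ≠ β k) : Function.Bijective (Sum.elim α β) := by
  have hq : ∀ i, Quotient.mk (mSetoid θ b) (Sum.elim α β i) = Sum.elim id id i := by
    rintro (k | k)
    · exact (h k).1
    · exact (h k).2.1
  constructor
  · intro i j hij
    have h1 : (Sum.elim id id i : MClass θ b) = Sum.elim id id j := by rw [← hq, ← hq, hij]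
    rcases i with i | i <;> rcases j with j | j <;> simp only [Sum.elim_inl, Sum.elim_inr, id] at h1
      <;> subst h1
    · rfl
    · exact absurd hij (h i).2.2
    · exact absurd hij.symm (h i).2.2
    · rfl
  · intro γ
    set k := Quotient.mk (mSetoid θ b) γ with hk
    by_cases hγ : γ = α k
    · exact ⟨.inl k, hγ.symm⟩
    · have h1 : (mSetoid θ b).r (α k) γ := Quotient.exact ((h k).1.trans hk)
      have h2 : (mSetoid θ b).r (α k) (β k) := Quotient.exact ((h k).1.trans (h k).2.1.symm)
      exact ⟨.inr k, (hclass (α k)).unique ⟨(h k).2.2.symm, h2⟩ ⟨hγ, h1⟩⟩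

end RealFlag

end

/-! ### The theorem -/

open RealFlag GenCplx LieAlgebra LieAlgebra.IsKilling in
theorem corollary5 {𝔤 : Type*} [LieRing 𝔤] [LieAlgebra ℝ 𝔤] [FiniteDimensional ℝ 𝔤]
    [IsKilling ℝ 𝔤] (𝔞 : LieSubalgebra ℝ 𝔤) [𝔞.IsCartanSubalgebra] [IsTriangularizable ℝ 𝔞 𝔤]
    (htype : IsTypeA3 𝔞 ∨ IsTypeB2 𝔞 ∨ IsTypeG2 𝔞 ∨ ∃ l : ℕ, 5 ≤ l ∧ IsTypeD 𝔞 l)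
    (θ : 𝔤 ≃ₗ⁅ℝ⁆ 𝔤) (hθ : IsCartanInvolution 𝔞 θ)
    (b : (rootSystem 𝔞).Base)
    (X : Weight ℝ 𝔞 𝔤 → 𝔤) (hX : IsWeylBasis X)
    (J : GenTangent (nMinus b) →ₗ[ℝ] GenTangent (nMinus b)) (hJ : IsInvariantGACS θ b J) :
    -- every class consists of exactly two roots
    (∀ α : NegRoot b, ∃! β : NegRoot b, β ≠ α ∧ (mSetoid θ b).r α β) ∧
    -- on every class, `J` is either of noncomplex or of complex type
    (∀ α β : NegRoot b, α ≠ β → (mSetoid θ b).r α β →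
      Xor (∃ a x y : ℝ, IsNoncomplexBlock hX J α β a x y)
        (∃ p c : ℝ, IsComplexBlock hX J α β p c)) ∧
    -- the (1,0)-forms on a class of complex type
    (∀ α β : NegRoot b, α ≠ β → (mSetoid θ b).r α β → ∀ p c : ℝ, IsComplexBlock hX J α β p c →
      ∀ Ω : ℂ ⊗[ℝ] Dual ℝ (nMinus b), IsOneZeroForm hX J α β Ω ↔
        ∃ z : ℂ, Ω = z • (-(c : ℂ) • ((1 : ℂ) ⊗ₜ[ℝ] covec b X α) +
          ((p : ℂ) + Complex.I) • ((1 : ℂ) ⊗ₜ[ℝ] covec b X β))) ∧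
    -- the generator of the pure spinor line
    (∀ (α β : MClass θ b → NegRoot b),
      (∀ k, Quotient.mk (mSetoid θ b) (α k) = k ∧ Quotient.mk (mSetoid θ b) (β k) = k ∧
        α k ≠ β k) →
      ∀ (nc : Finset (MClass θ b)) (a x y p c : MClass θ b → ℝ),
      (∀ k ∈ nc, IsNoncomplexBlock hX J (α k) (β k) (a k) (x k) (y k)) →
      (∀ k ∉ nc, IsComplexBlock hX J (α k) (β k) (p k) (c k)) →
      ∀ (Ω : MClass θ b → ℂ ⊗[ℝ] Dual ℝ (nMinus b)),
      (∀ k ∉ nc, IsOneZeroForm hX J (α k) (β k) (Ω k) ∧ Ω k ≠ 0) →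
      ∀ (cplx : List (MClass θ b)), cplx.Nodup → (∀ k, k ∈ cplx ↔ k ∉ nc) →
      ∀ φ : Forms (nMinus b),
      φ = formExp (∑ k ∈ nc, (formB X (α k) (β k) (a k) (x k) +
            Complex.I • formOmega X (α k) (β k) (x k))) *
          (cplx.map fun k => ExteriorAlgebra.ι ℂ (Ω k)).prod →
      φ ≠ 0 ∧ spinorLine J = Submodule.span ℂ {φ} ∧
      IsPureSpinor φ ∧ nullSpace φ = plusEigenspace J ∧
      (∀ w ∈ nullSpace φ, conjT w ∈ nullSpace φ → w = 0) ∧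
      (∀ m : groupM 𝔞 θ, (spinorLine J).map (pullback (actN θ b m)) = spinorLine J)) := by
  have hpart : ∀ α : Weight ℝ 𝔞 𝔤, α.IsNonZero → ∃ β, IsPartner θ α β :=
    fun α hα => exists_isPartner htype hθ hα
  have huniq : ∀ α : NegRoot b, ∃! β : NegRoot b, β ≠ α ∧ (mSetoid θ b).r α β :=
    fun α => existsUnique_equivalent hpart hθ α
  refine ⟨huniq, ?_, fun α β hαβ _ p c h Ω => isOneZeroForm_iff hαβ h Ω, ?_⟩
  · intro α β hαβ hr
    have hclass : ∀ γ : NegRoot b, CharEq 𝔞 θ α.wt γ.wt → γ = α ∨ γ = β := by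
      intro γ hγ
      by_cases h : γ = α
      · exact Or.inl h
      · exact Or.inr ((huniq α).unique ⟨h, (mSetoid_iff hθ α γ).2 hγ⟩ ⟨hαβ.symm, hr⟩)
    rcases block_or hθ hX hJ hαβ ((mSetoid_iff hθ α β).1 hr) hclass with h | h
    · obtain ⟨a, x, y, h'⟩ := h
      exact Or.inl ⟨⟨a, x, y, h'⟩, fun ⟨p, c, h''⟩ => h'.not_isComplexBlock hαβ h''⟩
    · obtain ⟨p, c, h'⟩ := h
      exact Or.inr ⟨⟨p, c, h'⟩, fun ⟨a, x, y, h''⟩ => h''.not_isComplexBlock hαβ h'⟩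
  · intro α β hrep nc a x y p c hnc hc Ω hΩ cplx hnodup hmem φ hφ
    -- The chosen orderings list the negative roots as two copies of the set of classes, which is
    -- the paired basis that the spinor lemmas need.
    let e : MClass θ b ⊕ MClass θ b ≃ NegRoot b :=
      Equiv.ofBijective _ (bijective_sum_elim huniq hrep)
    have : Fintype (MClass θ b) := Fintype.ofFinite _
    let B := classBasis hX e
    have hB1 : ∀ k, B (.inl k) = vec hX (α k) := fun k => classBasis_apply hX e _
    have hB2 : ∀ k, B (.inr k) = vec hX (β k) := fun k => classBasis_apply hX e _
    have hC1 : ∀ k, B.coord (.inl k) = covec b X (α k) := fun k => coord_classBasis hX e _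
    have hC2 : ∀ k, B.coord (.inr k) = covec b X (β k) := fun k => coord_classBasis hX e _
    let t : MClass θ b → ℂ := fun k =>
      ((-(a k / x k) : ℝ) : ℂ) + Complex.I * ((1 / x k : ℝ) : ℂ)
    have hform : φ = formExp (pairForm B nc t) *
        (cplx.map fun k => ExteriorAlgebra.ι ℂ (Ω k)).prod := by
      rw [hφ, pairForm]
      congr 2
      refine Finset.sum_congr rfl fun k _ => ?_
      rw [formB, formOmega, hC1, hC2, smul_smul, ← add_smul]
    have hspan : ∀ k ∈ cplx, Ω k ∈ Submodule.span ℂ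
        {(1 : ℂ) ⊗ₜ[ℝ] B.coord (.inl k), (1 : ℂ) ⊗ₜ[ℝ] B.coord (.inr k)} := by
      intro k hk
      rw [hC1, hC2]
      exact (hΩ k ((hmem k).1 hk)).1.1
    have hz : ∀ k, ∃ z : ℂ, k ∉ nc → z ≠ 0 ∧ Ω k = z • (-(c k : ℂ) • ((1 : ℂ) ⊗ₜ[ℝ] B.coord (.inl k)) +
        ((p k : ℂ) + Complex.I) • ((1 : ℂ) ⊗ₜ[ℝ] B.coord (.inr k))) := by
      intro k
      by_cases hk : k ∈ nc
      · exact ⟨0, fun h => absurd hk h⟩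
      · obtain ⟨z, hz⟩ := (isOneZeroForm_iff (hrep k).2.2 (hc k hk) (Ω k)).1 (hΩ k hk).1
        refine ⟨z, fun _ => ⟨?_, by rw [hC1, hC2, hz]⟩⟩
        rintro rfl
        exact (hΩ k hk).2 (by rw [hz, zero_smul])
    choose z hz using hz
    have hne : φ ≠ 0 := by
      rw [hform]
      exact spinor_ne_zero hnodup (fun k hk => (hmem k).1 hk) hspan
        fun k hk => (hΩ k ((hmem k).1 hk)).2
    have hline : φ ∈ spinorLine J := by
      rw [hform]
      refine spinor_mem_spinorLine (a := a) (x := x) (y := y) (p := p) (c := c) (z := z) hmem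
        (fun k hk => ?_) (fun k hk => ?_) (fun k hk => hz k hk) (fun k _ => rfl)
      · have h := hnc k hk
        rw [hB1, hB2, hC1, hC2]
        exact ⟨h.eqn, h.col₁, h.col₂, h.col₃, h.col₄⟩
      · have h := hc k hk
        rw [hB1, hB2, hC1, hC2]
        exact ⟨h.ne, h.col₁, h.col₂, h.col₃, h.col₄⟩
    have hnull := hJ.1.nullSpace_eq hne hline
    have hsp := hJ.1.spinorLine_eq_span hne hline
    refine ⟨hne, hsp, hJ.1.isPureSpinor hne hline, hnull, ?_, fun m => ?_⟩
    · rw [hnull]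
      exact fun w hw hw' => eq_zero_of_conjT_mem hw hw'
    · obtain ⟨s, hs, hact, -, hdual⟩ := exists_character (b := b) hθ hX m
      -- Both roots of a class have the same character; so `m` scales each pair by one sign and
      -- `pullback_spinor` applies.
      have hsβ : ∀ k, s (β k) = s (α k) := by
        intro k
        have hr : (mSetoid θ b).r (α k) (β k) :=
          Quotient.exact ((hrep k).1.trans (hrep k).2.1.symm)
        exact (hact (β k)).unique ((mSetoid_iff hθ _ _).1 hr m m.2 _ (hact (α k)))
      have hpull := pullback_spinor (B := B) (f := actN θ b m) (σ := fun k => s (α k)) (s := nc)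
        (t := t) (fun k => hs (α k)) (fun k => by rw [hC1, hdual])
        (fun k => by rw [hC2, hdual, hsβ]) hspan
      rw [← hform] at hpull
      rw [hsp, Submodule.map_span, Set.image_singleton, hpull]
      -- The spinor is multiplied by a product of signs, which is nonzero, so the line is preserved.
      refine Submodule.span_singleton_smul_eq (IsUnit.mk0 _ ?_) φ
      refine List.prod_ne_zero fun hmem0 => ?_
      obtain ⟨k, -, h0⟩ := List.mem_map.1 hmem0
      have h1 := hs (α k)
      rw [Complex.ofReal_eq_zero.1 h0] at h1
      norm_num at h1
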